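/- Let $L$ be a countable language and let $\mathbb M$ be an uncountable quasiminimal pregeometry structure, that is, an $L$-structure with a pregeometry $\mathrm{cl}$ such that, writing $\mathrm{tp}$ for quantifier-free $L$-type: (QM1) if $a,a'$ are single elements, $b,b'$ are finite tuples and $\mathrm{tp}(a,b)=\mathrm{tp}(a',b')$, then $a\in\mathrm{cl}(b)$ if and only if $a'\in\mathrm{cl}(b')$; (QM2) $\mathbb M$ is infinite-dimensional with respect to $\mathrm{cl}$; (QM3) $\mathrm{cl}(A)$ is countable for every finite $A\subseteq\mathbb M$; (QM4) if $H,H'$ are countable closed sets, enumerated so that $\mathrm{tp}(H)=\mathrm{tp}(H')$, and $a\notin H$, $a'\notin H'$ are single elements, then $\mathrm{tp}(H,a)=\mathrm{tp}(H',a')$; (QM5) if $H,H'$ are countable closed sets or empty, enumerated so that $\mathrm{tp}(H)=\mathrm{tp}(H')$, if $b,b'$ are finite tuples with $\mathrm{tp}(H,b)=\mathrm{tp}(H',b')$, and if $a\in\mathrm{cl}(H,b)$ is a single element, then there is $a'\in\mathbb M$ with $\mathrm{tp}(H,b,a)=\mathrm{tp}(H',b',a')$. The elements of $\mathbb M^{eq}$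 are the classes $x/E$, where $x\in\mathbb M^n$ and $E$ is an $\mathrm{Aut}(\mathbb M)$-invariant equivalence relation on $\mathbb M^n$ (a sort), for some $n$. A group $G$ in $\mathbb M^{eq}$ is Galois definable over a set $A \subseteq \mathbb M$ if its elements lie in countably many sorts and every automorphism of $\mathbb M$ fixing $A$ pointwise maps the set $G$, and the graph of its operation, onto itself. Two elements have the same Galois type over $A$ if some automorphism in $\mathrm{Aut}(\mathbb M/A)$ maps one to the other. The bounded closure $\mathrm{bcl}(B)$ of a set $B$ of elements of $\mathbb M^{eq}$ (with $\mathbb M \subseteq \mathbb M^{eq}$) is the set of those $a\in\mathbb M$ whose orbit under $\mathrm{Aut}(\mathbb M/B)$ has fewer than $|\mathbb M|$ elements. For a finite tuple $x$ of $\mathbb M$, $\dim(x/B)$ is the least size of a subtuple $y$ of $x$ such that every coordinate of $x$ is in $\mathrm{bcl}(By)$; for $\alpha=x/E$ in $\mathbb M^{eq}$, $\dim(\alpha/A)=\dim(x/A)-\dim(x/A\alpha)$. An element of $G$ is generic over $A$ if its dimension over $A$ is maximal among the elements of $G$. An infinite group $H$ carries an $\omega$-homogeneous pregeometry if there is a pregeometry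 $\mathrm{cl}_H$ on $H$ with $\dim_{\mathrm{cl}_H}(H)=|H|$ such that, whenever $S\subseteq H$ is finite and $a,b\in H\setminus\mathrm{cl}_H(S)$, some automorphism of the group $H$ preserves $\mathrm{cl}_H$, fixes $S$ pointwise and maps $a$ to $b$. A group is non-classical if it is non-Abelian and carries an $\omega$-homogeneous pregeometry. $\mathbb M$ interprets a non-classical group if some group in $\mathbb M^{eq}$, Galois definable over some finite subset of $\mathbb M$, is non-classical. Theorem. Suppose that $\mathbb M$ does not interpret a non-classical group. Let $G$ be a group in $\mathbb M^{eq}$, Galois definable over a finite set $A\subseteq\mathbb M$. Suppose that $G$ has unique generic type (there are generic elements of $G$ over $A$, and all of them have the same Galois type over $A$) and that the generic elements of $G$ have dimension $1$ over $A$. Then $G$ is Abelian. -/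

import Mathlib

open FirstOrder Cardinal

namespace Quasiminimal

universe u v w

/-- `cl` is a pregeometry on `X`: an exchange closure operator of finite character. -/
structure IsPregeometry {X : Type w} (cl : Set X → Set X) : Prop where
  subset_cl : ∀ S, S ⊆ cl S
  mono : ∀ S T, S ⊆ T → cl S ⊆ cl T
  idem : ∀ S, cl (cl S) = cl S
  finitary : ∀ S a, a ∈ cl S → ∃ F : Set X, F.Finite ∧ F ⊆ S ∧ a ∈ cl F
  exchange : ∀ S a b, a ∈ cl (insert b S) → a ∉ cl S → b ∈ cl (insert a S)

/-- `B` is a basis of `X` with respect to `cl`: it is independent and spans `X`. -/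
def IsClBasis {X : Type w} (cl : Set X → Set X) (B : Set X) : Prop :=
  (∀ b ∈ B, b ∉ cl (B \ {b})) ∧ cl B = Set.univ

/-- An infinite group carries an `ω`-homogeneous pregeometry. -/
def CarriesOmegaHomogeneousPregeometry (G : Type w) [Group G] : Prop :=
  Infinite G ∧ ∃ cl : Set G → Set G, IsPregeometry cl ∧
    (∃ B : Set G, IsClBasis cl B ∧ #B = #G) ∧
    ∀ (S : Set G) (a b : G), S.Finite → a ∉ cl S → b ∉ cl S →
      ∃ σ : G ≃* G, (∀ T : Set G, σ '' cl T = cl (σ '' T)) ∧ (∀ s ∈ S, σ s = s) ∧ σ a = b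

/-- A non-classical group: non-Abelian, and carrying an `ω`-homogeneous pregeometry. -/
def IsNonclassical (G : Type w) [Group G] : Prop :=
  (¬ ∀ g h : G, g * h = h * g) ∧ CarriesOmegaHomogeneousPregeometry G

section Structures

variable (L : FirstOrder.Language.{u, v}) {M : Type w} [L.Structure M]

/-- The tuples `x` and `y` (indexed by an arbitrary type) have the same quantifier-free type. -/
def SameQFType {ι : Type*} (x y : ι → M) : Prop :=
  ∀ φ : L.Formula ι, φ.IsQF → (φ.Realize x ↔ φ.Realize y)

/-- The tuple `x` followed by the tuple `y`. -/
def join {ι κ : Type*} (x : ι → M) (y : κ → M) : ι ⊕ κ → M := Sum.elim x y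

/-- A single element as a tuple of length one. -/
def single (a : M) : Unit → M := fun _ => a

/-- `M` with `cl` is a quasiminimal pregeometry structure. A set `H` is enumerated by its own
inclusion into `M`; an enumeration `e` of `H'` with the same quantifier-free type is then a map
`H → M` with range `H'`. -/
structure IsQuasiminimalPregeometryStructure (cl : Set M → Set M) : Prop where
  pregeometry : IsPregeometry cl
  qm1 : ∀ (n : ℕ) (b b' : Fin n → M) (a a' : M),
    SameQFType L (join (single a) b) (join (single a') b') →
      (a ∈ cl (Set.range b) ↔ a' ∈ cl (Set.range b'))
  qm2 : ∀ S : Set M, S.Finite → cl S ≠ Set.univ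
  qm3 : ∀ S : Set M, S.Finite → (cl S).Countable
  qm4 : ∀ (H H' : Set M) (e : H → M), H.Countable → cl H = H → H'.Countable → cl H' = H' →
    Set.range e = H' → SameQFType L (fun h : H => (h : M)) e →
    ∀ a a' : M, a ∉ H → a' ∉ H' →
      SameQFType L (join (fun h : H => (h : M)) (single a)) (join e (single a'))
  qm5 : ∀ (H H' : Set M) (e : H → M), (H.Countable ∧ cl H = H) ∨ H = ∅ →
    (H'.Countable ∧ cl H' = H') ∨ H' = ∅ →
    Set.range e = H' → SameQFType L (fun h : H => (h : M)) e →
    ∀ (n : ℕ) (b b' : Fin n → M),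
      SameQFType L (join (fun h : H => (h : M)) b) (join e b') →
      ∀ a ∈ cl (H ∪ Set.range b), ∃ a' : M,
        SameQFType L (join (join (fun h : H => (h : M)) b) (single a))
          (join (join e b') (single a'))

variable (M)

/-- A sort of `M^eq`: an equivalence relation on `Mⁿ` that is invariant under all automorphisms
of `M`. -/
structure ImagSort where
  arity : ℕ
  rel : Setoid (Fin arity → M)
  invariant : ∀ (f : M ≃[L] M) (x y : Fin arity → M), rel x y → rel (f ∘ x) (f ∘ y)

/-- `M^eq`: the elements `x/E`, where `E` is an invariant equivalence relation on some `Mⁿ` and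
`x` is in `Mⁿ`. -/
abbrev Meq : Type w := Σ E : ImagSort L M, Quotient E.rel

variable {L M}

/-- The action of an automorphism of `M` on `M^eq`. -/
def Meq.map (f : M ≃[L] M) (α : Meq L M) : Meq L M :=
  ⟨α.1, Quotient.map (fun x => f ∘ x) (fun x y h => α.1.invariant f x y h) α.2⟩

/-- A tuple of `M` that represents the imaginary element `α`. -/
noncomputable def Meq.rep (α : Meq L M) : Fin α.1.arity → M := α.2.out

/-- `f` is in `Aut(M/A)`. -/
def Fixes (f : M ≃[L] M) (A : Set M) : Prop := ∀ a ∈ A, f a = a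

/-- `f` fixes pointwise the set `T` of imaginary elements. -/
def FixesEq (f : M ≃[L] M) (T : Set (Meq L M)) : Prop := ∀ α ∈ T, α.map f = α

variable (L) in
/-- The bounded closure in `M` of a set `A` of elements and a set `T` of imaginary elements:
those `a` whose Galois type over `A ∪ T` has fewer than `|M|` realizations. -/
def bcl (A : Set M) (T : Set (Meq L M)) : Set M :=
  {a | #{b : M | ∃ f : M ≃[L] M, Fixes f A ∧ FixesEq f T ∧ f a = b} < #M}

/-- The dimension of a tuple `x` of `M` over `A ∪ T` in the pregeometry `bcl`: the least size of
a subtuple over which, together with `A ∪ T`, all of `x` is bounded. -/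
noncomputable def tupleDim (A : Set M) (T : Set (Meq L M)) {n : ℕ} (x : Fin n → M) : ℕ :=
  sInf {k | ∃ I : Finset (Fin n), I.card = k ∧ ∀ i, x i ∈ bcl L (A ∪ x '' I) T}

/-- The dimension `dim(α/A)` of an imaginary element. For a tuple `x` that represents `α` one has
`dim(x/A) = dim(xα/A) = dim(α/A) + dim(x/Aα)`. -/
noncomputable def Meq.dim (A : Set M) (α : Meq L M) : ℕ :=
  tupleDim A (∅ : Set (Meq L M)) α.rep - tupleDim A {α} α.rep

/-- `α` and `β` have the same Galois type over `A`. -/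
def SameGaloisType (A : Set M) (α β : Meq L M) : Prop :=
  ∃ f : M ≃[L] M, Fixes f A ∧ α.map f = β

/-- The graph of the group operation, as a subset of `(M^eq)³`. -/
def opGraph (G : Set (Meq L M)) [Group G] : Set (Meq L M × Meq L M × Meq L M) :=
  {t | ∃ g h : G, t = ((g : Meq L M), (h : Meq L M), ((g * h : G) : Meq L M))}

/-- `G` is a group in `M^eq`, Galois definable over the finite set `A`: `Aut(M/A)` preserves the
set `G` and the graph of the operation. The elements of `G` are taken from countably many
sorts. -/
structure IsGaloisDefinableGroup (A : Set M) (G : Set (Meq L M)) [Group G] : Prop where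
  finite : A.Finite
  sorts : (Sigma.fst '' G).Countable
  carrier : ∀ f : M ≃[L] M, Fixes f A → Meq.map f '' G = G
  op : ∀ f : M ≃[L] M, Fixes f A →
    Prod.map (Meq.map f) (Prod.map (Meq.map f) (Meq.map f)) '' opGraph G = opGraph G

/-- `α` is a generic element of `G` over `A`: it has maximal dimension over `A` in `G`. -/
def IsGeneric (A : Set M) (G : Set (Meq L M)) (α : Meq L M) : Prop :=
  α ∈ G ∧ ∀ β ∈ G, β.dim A ≤ α.dim A

/-- `G` has generic elements over `A`, and they all have the same Galois type over `A`. -/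
def HasUniqueGenericType (A : Set M) (G : Set (Meq L M)) : Prop :=
  (∃ α, IsGeneric A G α) ∧ ∀ α β, IsGeneric A G α → IsGeneric A G β → SameGaloisType A α β

variable (L M) in
/-- `M` interprets a non-classical group: there is one in `M^eq`, Galois definable over some
finite set. -/
def InterpretsNonclassicalGroup : Prop :=
  ∃ (A : Set M) (G : Set (Meq L M)) (_ : Group G),
    IsGaloisDefinableGroup A G ∧ IsNonclassical G

end Structures

end Quasiminimal

/-! The argument is by contraposition: a group as in the theorem carries an ω-homogeneous
pregeometry whether or not it is Abelian, so a non-Abelian one would be a non-classical group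
interpreted in `M`. Call a countable closed infinite-dimensional set containing `A` a model. The
pregeometry is `groupCl`: `g` is in the closure of a finite `F` when every model that contains
representatives of all elements of `F` contains one of `g`.

Homogeneity rests on `IsOneDimensionalGroup.sameGaloisType_of_notMem`: over every model `N`, and not
only over `A`, the elements of `G` outside `N` form one Galois type. Take independent realizations
`k`, `g` of a generic type over `N`; then `t = g * k⁻¹` sends `k` to an element of the same type
over `N`. As all generics are conjugate over `A`, every generic `t` behaves in this way for some
generic `k`; right translation, which commutes with left translation, extends this to all elements
generic over `N` and `t`. If now `s`, `t` are generic over `N` and `m` is independent of them, both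
`s * m` and `t * m` have the type of `m`, and `m` can be cancelled on the right.

This uses a calculus of dimension-one types over models: they extend to larger models
(`exists_sameGaloisType_notMem`), uniquely
(`IsQuasiminimalPregeometryStructure.sameGaloisType_of_notMem`), and independent extensions of `N`
meet in `N` (`mem_imag_of_mem_insert`).

Underneath lies a supply of automorphisms of the possibly very large `M`: partial isomorphisms
between countable closed sets of infinite dimension extend to `M` (`exists_automorphism`). The
axioms extend maps over countable closed sets only; to go on one needs that the type of a finite
tuple over a union of closures of subsets of a basis is determined by a finite part
(`isolating_spanSet`). This is a form of excellence, obtained from a coheir argument and the Baire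
category theorem for automorphisms of a countable closed set. -/

namespace Quasiminimal

/-! ### Pregeometries: relative independence, exchange, cardinality of bases. -/

section Pregeometry

variable {X : Type*} {cl : Set X → Set X}

/-- `W` is independent over `P` with respect to `cl`. -/
def IndepOver (cl : Set X → Set X) (P W : Set X) : Prop :=
  ∀ w ∈ W, w ∉ cl (P ∪ W \ {w})

namespace IsPregeometry

theorem cl_le (h : IsPregeometry cl) {S T : Set X} (hST : S ⊆ cl T) : cl S ⊆ cl T :=
  (h.mono _ _ hST).trans (h.idem T).subset

theorem cl_mono (h : IsPregeometry cl) {S T : Set X} (hST : S ⊆ T) : cl S ⊆ cl T :=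
  h.mono _ _ hST

theorem mem_cl (h : IsPregeometry cl) {S : Set X} {a : X} (ha : a ∈ S) : a ∈ cl S :=
  h.subset_cl _ ha

theorem cl_cl_union (h : IsPregeometry cl) (S T : Set X) : cl (cl S ∪ T) = cl (S ∪ T) :=
  (h.cl_le (Set.union_subset (h.cl_mono Set.subset_union_left)
    (Set.subset_union_right.trans (h.subset_cl _)))).antisymm
    (h.cl_mono (Set.union_subset_union_left _ (h.subset_cl _)))

theorem exists_finite_union (h : IsPregeometry cl) {P W : Set X} {a : X} (ha : a ∈ cl (P ∪ W)) :
    ∃ F : Set X, F.Finite ∧ F ⊆ W ∧ a ∈ cl (P ∪ F) := by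
  obtain ⟨F, hF, hFs, haF⟩ := h.finitary _ _ ha
  refine ⟨F ∩ W, hF.inter_of_left _, Set.inter_subset_right, h.cl_mono ?_ haF⟩
  intro x hx
  rcases hFs hx with h1 | h1
  · exact Or.inl h1
  · exact Or.inr ⟨hx, h1⟩

theorem exists_finite_of_finite (h : IsPregeometry cl) {S V : Set X} (hV : V.Finite)
    (hVS : V ⊆ cl S) : ∃ F : Set X, F.Finite ∧ F ⊆ S ∧ V ⊆ cl F := by
  choose! F hF hFS hVF using fun a (ha : a ∈ V) => h.finitary S a (hVS ha)
  refine ⟨⋃ a ∈ V, F a, hV.biUnion hF, Set.iUnion₂_subset hFS, fun a ha => ?_⟩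
  exact h.cl_mono (Set.subset_biUnion_of_mem ha) (hVF a ha)

/-- If `a` is in the closure of `P ∪ W` but not of `P`, then some element of the finite set `W` is
responsible for it. -/
theorem exists_exchange (h : IsPregeometry cl) {P W : Set X} (hW : W.Finite) {a : X}
    (ha : a ∈ cl (P ∪ W)) (haP : a ∉ cl P) :
    ∃ w ∈ W, w ∈ cl (insert a (P ∪ W \ {w})) := by
  induction W, hW using Set.Finite.induction_on generalizing P with
  | empty => simp at ha; exact absurd ha haP
  | @insert b W hb hW ih =>
    -- Either `b` accounts for `a` over `P`, and exchange applies, or `b` joins the base and the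
    -- induction hypothesis is used over `insert b P`.
    by_cases hab : a ∈ cl (insert b P)
    · refine ⟨b, Or.inl rfl, h.cl_mono ?_ (h.exchange _ _ _ hab haP)⟩
      exact Set.insert_subset_insert Set.subset_union_left
    · obtain ⟨w, hw, hw'⟩ := ih (P := insert b P) (by
        refine h.cl_mono ?_ ha
        intro x; simp; tauto) hab
      refine ⟨w, Or.inr hw, h.cl_mono ?_ hw'⟩
      have : b ≠ w := fun e => hb (e ▸ hw)
      intro x; simp only [Set.mem_insert_iff, Set.mem_union, Set.mem_sdiff, Set.mem_singleton_iff]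
      rintro (h | (h | h) | h)
      · tauto
      · subst h; tauto
      · tauto
      · tauto

end IsPregeometry

theorem IndepOver.mono {P Q W W' : Set X} (h : IsPregeometry cl) (hW : IndepOver cl Q W)
    (hP : P ⊆ Q) (hW' : W' ⊆ W) : IndepOver cl P W' := fun w hw hw' =>
  hW w (hW' hw) (h.cl_mono (Set.union_subset_union hP (Set.sdiff_subset_sdiff_left hW')) hw')

/-- If `W` is independent over `Q ⊇ P`, then the closure of `P ∪ W` meets `Q` in the closure
of `P`. -/
theorem IndepOver.mem_cl (h : IsPregeometry cl) {P Q W : Set X} (hW : IndepOver cl Q W)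
    (hPQ : P ⊆ cl Q) {x : X} (hx : x ∈ cl Q) (hxW : x ∈ cl (P ∪ W)) : x ∈ cl P := by
  by_contra hxP
  obtain ⟨F, hF, hFW, hxF⟩ := h.exists_finite_union hxW
  -- Otherwise some `w ∈ W` depends on `x`, `P` and the rest of `W`, all contained in the closure of
  -- `Q ∪ W \ {w}`.
  obtain ⟨w, hw, hw'⟩ := h.exists_exchange hF hxF hxP
  refine hW w (hFW hw) (h.cl_le ?_ hw')
  refine Set.insert_subset (h.cl_mono Set.subset_union_left hx) (Set.union_subset
    (hPQ.trans (h.cl_mono Set.subset_union_left)) ?_)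
  exact (Set.sdiff_subset_sdiff_left hFW).trans (Set.subset_union_right.trans (h.subset_cl _))

theorem IndepOver.insert_of_notMem_cl (h : IsPregeometry cl) {P W : Set X} (hW : IndepOver cl P W) {a : X}
    (ha : a ∉ cl (P ∪ W)) : IndepOver cl P (insert a W) := by
  have haW : a ∉ W := fun haW => ha (h.mem_cl (Or.inr haW))
  rintro w (rfl | hw) hw'
  · refine ha (h.cl_mono ?_ hw')
    intro x; simp only [Set.mem_union, Set.mem_sdiff, Set.mem_insert_iff, Set.mem_singleton_iff]
    tauto
  · have haw : a ≠ w := fun e => haW (e ▸ hw)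
    have h1 : w ∈ cl (insert a (P ∪ W \ {w})) := by
      refine h.cl_mono ?_ hw'
      intro x; simp only [Set.mem_union, Set.mem_sdiff, Set.mem_insert_iff, Set.mem_singleton_iff]
      tauto
    have h2 := h.exchange _ _ _ h1 (hW w hw)
    refine ha (h.cl_mono ?_ h2)
    intro x; simp only [Set.mem_union, Set.mem_sdiff, Set.mem_insert_iff, Set.mem_singleton_iff]
    rintro (rfl | h | h)
    · exact Or.inr hw
    · tauto
    · tauto

theorem IndepOver.cl_left (h : IsPregeometry cl) {P W : Set X} (hW : IndepOver cl P W) :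
    IndepOver cl (cl P) W := fun w hw hw' => hW w hw (by rwa [h.cl_cl_union] at hw')

/-- Every independent subset of `Y` extends to one that spans `Y`. -/
theorem IsPregeometry.exists_indep_extend (h : IsPregeometry cl) {P W₀ Y : Set X}
    (hW₀ : IndepOver cl P W₀) (hY : W₀ ⊆ Y) :
    ∃ W, W₀ ⊆ W ∧ W ⊆ Y ∧ IndepOver cl P W ∧ Y ⊆ cl (P ∪ W) := by
  obtain ⟨W, hW₀W, hW⟩ := zorn_subset_nonempty {W | IndepOver cl P W ∧ W ⊆ Y} (by
    intro c hc hchain hne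
    refine ⟨⋃₀ c, ⟨?_, Set.sUnion_subset fun s hs => (hc hs).2⟩, fun s hs =>
      Set.subset_sUnion_of_mem hs⟩
    rintro w ⟨s, hs, hws⟩ hw
    obtain ⟨F, hF, hFs, hwF⟩ := h.exists_finite_union hw
    have : ∃ t ∈ c, s ⊆ t ∧ F ⊆ t := by
      clear hwF
      induction F, hF using Set.Finite.induction_on with
      | empty => exact ⟨s, hs, subset_rfl, Set.empty_subset _⟩
      | @insert b F hb hF ih =>
        obtain ⟨t, ht, hst, hFt⟩ := ih ((Set.subset_insert _ _).trans hFs)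
        obtain ⟨u, hu, hbu⟩ := (hFs (Set.mem_insert _ _)).1
        rcases hchain.total ht hu with htu | hut
        · exact ⟨u, hu, hst.trans htu, Set.insert_subset hbu (hFt.trans htu)⟩
        · exact ⟨t, ht, hst, Set.insert_subset (hut hbu) hFt⟩
    obtain ⟨t, ht, hst, hFt⟩ := this
    refine (hc ht).1 w (hst hws) (h.cl_mono (Set.union_subset_union_right _ ?_) hwF)
    exact fun x hx => ⟨hFt hx, (hFs hx).2⟩) W₀ ⟨hW₀, hY⟩
  refine ⟨W, hW₀W, hW.1.2, hW.1.1, fun y hy => ?_⟩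
  by_contra hyW
  have := hW.2 (y := insert y W) ⟨hW.1.1.insert_of_notMem_cl h hyW, Set.insert_subset hy hW.1.2⟩
    (Set.subset_insert _ _) (Set.mem_insert _ _)
  exact hyW (h.mem_cl (Or.inr this))

theorem IsPregeometry.indepOver_empty (P : Set X) : IndepOver cl P ∅ := fun _ hw => hw.elim

/-- Steinitz exchange. -/
theorem IndepOver.exists_replace (h : IsPregeometry cl) {P W Q : Set X} (hWf : W.Finite)
    (hW : IndepOver cl P W) (hQ : Q.Finite) (hWQ : W ⊆ cl (P ∪ Q)) :
    ∃ Q' ⊆ Q, Q'.ncard + W.ncard ≤ Q.ncard ∧ Q ⊆ cl (P ∪ W ∪ Q') := by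
  induction W, hWf using Set.Finite.induction_on with
  | empty => exact ⟨Q, subset_rfl, by simp, Set.subset_union_right.trans (h.subset_cl _)⟩
  | @insert w W hw hWf ih =>
    obtain ⟨Q', hQ'Q, hcard, hQQ'⟩ := ih (hW.mono h subset_rfl (Set.subset_insert _ _))
      ((Set.subset_insert _ _).trans hWQ)
    have hw1 : w ∈ cl (P ∪ W ∪ Q') := by
      refine h.cl_le ?_ (hWQ (Set.mem_insert _ _))
      exact Set.union_subset (fun x hx => h.mem_cl (Or.inl (Or.inl hx))) hQQ'
    have hw2 : w ∉ cl (P ∪ W) := by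
      have := hW w (Set.mem_insert _ _)
      rwa [Set.insert_sdiff_of_mem _ (Set.mem_singleton w), Set.sdiff_singleton_eq_self hw] at this
    obtain ⟨q, hq, hq'⟩ := h.exists_exchange (hQ.subset hQ'Q) hw1 hw2
    refine ⟨Q' \ {q}, Set.sdiff_subset.trans hQ'Q, ?_, ?_⟩
    · have h1 := Set.ncard_sdiff_singleton_add_one hq (hQ.subset hQ'Q)
      rw [Set.ncard_insert_of_notMem hw hWf]
      omega
    · refine hQQ'.trans (h.cl_le ?_)
      have h3 : insert w (P ∪ W ∪ Q' \ {q}) = P ∪ insert w W ∪ Q' \ {q} := by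
        ext x; simp only [Set.mem_union, Set.mem_insert_iff]; tauto
      rw [h3] at hq'
      refine Set.union_subset (fun x hx => h.mem_cl (Or.inl ?_)) (fun x hx => ?_)
      · exact hx.imp id Or.inr
      · by_cases hxq : x = q
        · subst hxq; exact hq'
        · exact h.mem_cl (Or.inr ⟨hx, hxq⟩)

theorem IsPregeometry.countable_cl (h : IsPregeometry cl)
    (hc : ∀ S : Set X, S.Finite → (cl S).Countable) {S : Set X} (hS : S.Countable) :
    (cl S).Countable := by
  have : cl S ⊆ ⋃ F ∈ {F : Set X | F.Finite ∧ F ⊆ S}, cl F := by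
    intro a ha
    obtain ⟨F, hF, hFS, haF⟩ := h.finitary _ _ ha
    exact Set.mem_biUnion (show F ∈ {F : Set X | F.Finite ∧ F ⊆ S} from ⟨hF, hFS⟩) haF
  refine Set.Countable.mono this (Set.Countable.biUnion ?_ fun F hF => hc F hF.1)
  exact Set.countable_ofPred_finite_subset hS

/-- A set that together with a countable set spans an uncountable `X` has the cardinality
of `X`. -/
theorem IsPregeometry.mk_of_spans (h : IsPregeometry cl)
    (hc : ∀ S : Set X, S.Finite → (cl S).Countable) [Uncountable X] {P B : Set X}
    (hP : P.Countable) (hB : cl (P ∪ B) = Set.univ) : #B = #X := by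
  have hBinf : ℵ₀ < #B := by
    by_contra hcon
    have hBc : B.Countable := by rwa [← Cardinal.le_aleph0_iff_set_countable, ← not_lt]
    have := h.countable_cl hc (hP.union hBc)
    rw [hB, Set.countable_univ_iff] at this
    exact not_countable (α := X) this
  have : Infinite B := Cardinal.infinite_iff.2 hBinf.le
  refine le_antisymm (Cardinal.mk_set_le B) ?_
  -- `X` is covered by countable closures, one for each finite subset of `B`, so its size is at most
  -- `#B * ℵ₀`.
  have h1 : (Set.univ : Set X) ⊆ ⋃ F : Finset B, cl (P ∪ Subtype.val '' (F : Set B)) := by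
    rw [← hB]
    intro a ha
    obtain ⟨F, hF, hFB, haF⟩ := h.exists_finite_union ha
    lift F to Set B using hFB
    have hF' : F.Finite := hF.of_finite_image Subtype.val_injective.injOn
    exact Set.mem_iUnion.2 ⟨hF'.toFinset, by simpa using haF⟩
  calc #X = #(Set.univ : Set X) := Cardinal.mk_univ.symm
    _ ≤ #(⋃ F : Finset B, cl (P ∪ Subtype.val '' (F : Set B))) := Cardinal.mk_le_mk_of_subset h1
    _ ≤ #(Finset B) * ⨆ F : Finset B, #(cl (P ∪ Subtype.val '' (F : Set B))) :=
      Cardinal.mk_iUnion_le _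
    _ ≤ #(Finset B) * ℵ₀ := by
      refine mul_le_mul_right (ciSup_le' fun F => ?_) _
      rw [Cardinal.le_aleph0_iff_set_countable]
      exact h.countable_cl hc (hP.union (F.finite_toSet.image _).countable)
    _ = #B := by
      rw [Cardinal.mk_finset_of_infinite]
      exact Cardinal.mul_aleph0_eq hBinf.le

end Pregeometry

/-! ### Partial isomorphisms, handled as relations. -/

section PartialIso

variable {L : FirstOrder.Language} {M : Type*} [L.Structure M]

theorem SameQFType.comp {ι κ : Type*} {x y : ι → M} (h : SameQFType L x y) (σ : κ → ι) :
    SameQFType L (x ∘ σ) (y ∘ σ) := by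
  intro φ hφ
  rw [← FirstOrder.Language.Formula.realize_relabel, ← FirstOrder.Language.Formula.realize_relabel]
  exact h _ (FirstOrder.Language.BoundedFormula.IsQF.relabel hφ _)

theorem exists_finset_term {ι : Type*} (t : L.Term ι) :
    ∃ s : Finset ι, ∀ v v' : ι → M, (∀ i ∈ s, v i = v' i) → t.realize v = t.realize v' := by
  classical
  induction t with
  | var i => exact ⟨{i}, fun v v' h => h i (by simp)⟩
  | func f ts ih =>
    choose s hs using ih
    refine ⟨Finset.univ.biUnion s, fun v v' h => ?_⟩
    simp only [FirstOrder.Language.Term.realize_func]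
    congr 1
    funext i
    exact hs i v v' fun j hj => h j (Finset.mem_biUnion.2 ⟨i, Finset.mem_univ _, hj⟩)

theorem exists_finset_isQF {ι : Type*} {n : ℕ} {φ : L.BoundedFormula ι n} (hφ : φ.IsQF) :
    ∃ s : Finset ι, ∀ (v v' : ι → M) (xs : Fin n → M), (∀ i ∈ s, v i = v' i) →
      (φ.Realize v xs ↔ φ.Realize v' xs) := by
  classical
  have key : ∀ t : L.Term (ι ⊕ Fin n), ∃ s : Finset ι, ∀ (v v' : ι → M) (xs : Fin n → M),
      (∀ i ∈ s, v i = v' i) → t.realize (Sum.elim v xs) = t.realize (Sum.elim v' xs) := by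
    intro t
    obtain ⟨s, hs⟩ := exists_finset_term (M := M) t
    refine ⟨s.toLeft, fun v v' xs h => hs _ _ ?_⟩
    rintro (i | i) hi
    · exact h i (by simpa using hi)
    · rfl
  induction hφ with
  | falsum => exact ⟨∅, fun _ _ _ _ => Iff.rfl⟩
  | of_isAtomic h =>
    cases h with
    | equal t₁ t₂ =>
      obtain ⟨s₁, h₁⟩ := key t₁
      obtain ⟨s₂, h₂⟩ := key t₂
      refine ⟨s₁ ∪ s₂, fun v v' xs h => ?_⟩
      rw [FirstOrder.Language.BoundedFormula.realize_bdEqual,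
        FirstOrder.Language.BoundedFormula.realize_bdEqual,
        h₁ v v' xs fun i hi => h i (Finset.mem_union_left _ hi),
        h₂ v v' xs fun i hi => h i (Finset.mem_union_right _ hi)]
    | rel R ts =>
      choose s hs using fun i => key (ts i)
      refine ⟨Finset.univ.biUnion s, fun v v' xs h => ?_⟩
      rw [FirstOrder.Language.BoundedFormula.realize_rel,
        FirstOrder.Language.BoundedFormula.realize_rel]
      have : (fun i => (ts i).realize (Sum.elim v xs)) =
          fun i => (ts i).realize (Sum.elim v' xs) := funext fun i =>
        hs i v v' xs fun j hj => h j (Finset.mem_biUnion.2 ⟨i, Finset.mem_univ _, hj⟩)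
      rw [this]
  | imp _ _ ih₁ ih₂ =>
    obtain ⟨s₁, h₁⟩ := ih₁
    obtain ⟨s₂, h₂⟩ := ih₂
    refine ⟨s₁ ∪ s₂, fun v v' xs h => ?_⟩
    rw [FirstOrder.Language.BoundedFormula.realize_imp,
      FirstOrder.Language.BoundedFormula.realize_imp,
      h₁ v v' xs fun i hi => h i (Finset.mem_union_left _ hi),
      h₂ v v' xs fun i hi => h i (Finset.mem_union_right _ hi)]

variable (L) in

/-- `R` is (the graph of) a partial map of `M` that preserves quantifier-free types. -/
def PartialIso (R : Set (M × M)) : Prop :=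
  SameQFType L (fun p : R => p.1.1) (fun p : R => p.1.2)

/-- The domain of a relation. -/
def dom (R : Set (M × M)) : Set M := Prod.fst '' R

/-- The range of a relation. -/
def ran (R : Set (M × M)) : Set M := Prod.snd '' R

/-- The identity relation on `D`. -/
def diag (D : Set M) : Set (M × M) := {p | p.1 ∈ D ∧ p.1 = p.2}

/-- The inverse relation. -/
def inv (R : Set (M × M)) : Set (M × M) := {p | (p.2, p.1) ∈ R}

theorem dom_union (R S : Set (M × M)) : dom (R ∪ S) = dom R ∪ dom S := Set.image_union _ _ _

theorem ran_union (R S : Set (M × M)) : ran (R ∪ S) = ran R ∪ ran S := Set.image_union _ _ _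

theorem dom_insert (p : M × M) (S : Set (M × M)) : dom (insert p S) = insert p.1 (dom S) :=
  Set.image_insert_eq

theorem ran_insert (p : M × M) (S : Set (M × M)) : ran (insert p S) = insert p.2 (ran S) :=
  Set.image_insert_eq

theorem dom_mono {R S : Set (M × M)} (h : R ⊆ S) : dom R ⊆ dom S := Set.image_mono h

theorem ran_mono {R S : Set (M × M)} (h : R ⊆ S) : ran R ⊆ ran S := Set.image_mono h

theorem mem_dom {R : Set (M × M)} {a b : M} (h : (a, b) ∈ R) : a ∈ dom R := ⟨_, h, rfl⟩

theorem mem_ran {R : Set (M × M)} {a b : M} (h : (a, b) ∈ R) : b ∈ ran R := ⟨_, h, rfl⟩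

theorem exists_of_mem_dom {R : Set (M × M)} {a : M} (h : a ∈ dom R) : ∃ b, (a, b) ∈ R := by
  obtain ⟨⟨a, b⟩, h, rfl⟩ := h
  exact ⟨b, h⟩

theorem exists_of_mem_ran {R : Set (M × M)} {b : M} (h : b ∈ ran R) : ∃ a, (a, b) ∈ R := by
  obtain ⟨⟨a, b⟩, h, rfl⟩ := h
  exact ⟨a, h⟩

theorem dom_diag (D : Set M) : dom (diag D) = D := by
  ext x; constructor
  · rintro ⟨p, hp, rfl⟩; exact hp.1
  · intro hx; exact ⟨(x, x), ⟨hx, rfl⟩, rfl⟩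

theorem ran_diag (D : Set M) : ran (diag D) = D := by
  ext x; constructor
  · rintro ⟨p, hp, rfl⟩; exact hp.2 ▸ hp.1
  · intro hx; exact ⟨(x, x), ⟨hx, rfl⟩, rfl⟩

theorem dom_inv (R : Set (M × M)) : dom (inv R) = ran R := by
  ext x; constructor
  · rintro ⟨⟨a, b⟩, hp, rfl⟩; exact ⟨(b, a), hp, rfl⟩
  · rintro ⟨⟨a, b⟩, hp, rfl⟩; exact ⟨(b, a), hp, rfl⟩

theorem ran_inv (R : Set (M × M)) : ran (inv R) = dom R := by
  ext x; constructor
  · rintro ⟨⟨a, b⟩, hp, rfl⟩; exact ⟨(b, a), hp, rfl⟩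
  · rintro ⟨⟨a, b⟩, hp, rfl⟩; exact ⟨(b, a), hp, rfl⟩

theorem inv_inv (R : Set (M × M)) : inv (inv R) = R := rfl

theorem inv_union (R S : Set (M × M)) : inv (R ∪ S) = inv R ∪ inv S := rfl

theorem inv_insert (a b : M) (S : Set (M × M)) : inv (insert (a, b) S) = insert (b, a) (inv S) := by
  ext ⟨x, y⟩; simp [inv, and_comm]

theorem finite_inv {R : Set (M × M)} (h : R.Finite) : (inv R).Finite :=
  h.preimage (Prod.swap_injective.injOn (s := _))

theorem diag_mono {D E : Set M} (h : D ⊆ E) : diag D ⊆ diag E := fun _ hp => ⟨h hp.1, hp.2⟩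

theorem mem_diag {D : Set M} {a : M} (h : a ∈ D) : (a, a) ∈ diag D := ⟨h, rfl⟩

theorem diag_finite {D : Set M} (h : D.Finite) : (diag D).Finite :=
  (h.image fun x => (x, x)).subset (by
    rintro ⟨a, b⟩ ⟨h1, h2⟩; simp only at h1 h2; subst h2; exact ⟨a, h1, rfl⟩)

namespace PartialIso

theorem of_sameQFType {ι : Type*} {x y : ι → M} (h : SameQFType L x y) :
    PartialIso L (Set.range fun i => (x i, y i)) := by
  choose σ hσ using fun p : Set.range fun i => (x i, y i) => p.2
  have h1 : (fun p : Set.range fun i => (x i, y i) => p.1.1) = x ∘ σ := by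
    funext p; simp [← hσ p]
  have h2 : (fun p : Set.range fun i => (x i, y i) => p.1.2) = y ∘ σ := by
    funext p; simp [← hσ p]
  unfold PartialIso
  rw [h1, h2]
  exact h.comp σ

theorem sameQFType {R : Set (M × M)} (hR : PartialIso L R) {ι : Type*} {x y : ι → M}
    (h : ∀ i, (x i, y i) ∈ R) : SameQFType L x y :=
  SameQFType.comp (σ := fun i => (⟨_, h i⟩ : R)) hR

theorem mono {R S : Set (M × M)} (hS : PartialIso L S) (h : R ⊆ S) : PartialIso L R :=
  hS.sameQFType fun p => h p.2

/-- A quantifier-free formula mentions finitely many variables, so being a partial isomorphism has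
finite character. This drives the chain and back-and-forth arguments below. -/
theorem of_finite {R : Set (M × M)}
    (h : ∀ F ⊆ R, F.Finite → PartialIso L F) : PartialIso L R := by
  classical
  intro φ hφ
  obtain ⟨s, hs⟩ := exists_finset_isQF (M := M) hφ
  rcases R.eq_empty_or_nonempty with rfl | ⟨r₀, hr₀⟩
  · have : (fun p : (∅ : Set (M × M)) => p.1.1) = fun p => p.1.2 := funext fun p => p.2.elim
    rw [this]
  · let F : Set (M × M) := insert r₀ (Subtype.val '' (s : Set R))
    have hFR : F ⊆ R := Set.insert_subset hr₀ (by rintro _ ⟨p, -, rfl⟩; exact p.2)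
    have hF : F.Finite := (s.finite_toSet.image _).insert _
    -- Pairs outside `F` are collapsed to the default `r₀`; the formula does not see them.
    let ρ : R → F := fun p => if hp : p.1 ∈ F then ⟨p.1, hp⟩ else ⟨r₀, Set.mem_insert _ _⟩
    have hρ : ∀ p ∈ s, (ρ p).1 = p.1 := by
      intro p hp
      have : p.1 ∈ F := Or.inr ⟨p, hp, rfl⟩
      simp [ρ, this]
    have h1 := (h F hFR hF).comp ρ φ hφ
    have e1 := hs (fun p : R => p.1.1) ((fun p : F => p.1.1) ∘ ρ) default
      (fun p hp => by simp [hρ p hp])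
    have e2 := hs (fun p : R => p.1.2) ((fun p : F => p.1.2) ∘ ρ) default
      (fun p hp => by simp [hρ p hp])
    exact e1.trans (h1.trans e2.symm)

theorem inv {R : Set (M × M)} (hR : PartialIso L R) : PartialIso L (inv R) := by
  intro φ hφ
  exact (hR.sameQFType (x := fun p : Quasiminimal.inv R => p.1.2)
    (y := fun p : Quasiminimal.inv R => p.1.1) (fun p => p.2) φ hφ).symm

theorem comp {R S T : Set (M × M)} (hR : PartialIso L R) (hS : PartialIso L S)
    (h : ∀ a b, (a, b) ∈ T → ∃ c, (a, c) ∈ R ∧ (c, b) ∈ S) : PartialIso L T := by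
  choose m hm1 hm2 using fun p : T => h p.1.1 p.1.2 p.2
  intro φ hφ
  exact (hR.sameQFType hm1 φ hφ).trans (hS.sameQFType hm2 φ hφ)

theorem diag (D : Set M) : PartialIso L (diag D) := by
  intro φ _
  have : (fun p : Quasiminimal.diag D => p.1.1) = fun p => p.1.2 := funext fun p => p.2.2
  rw [this]

theorem eq_iff {R : Set (M × M)} (hR : PartialIso L R) {a b a' b' : M} (h : (a, a') ∈ R)
    (h' : (b, b') ∈ R) : a = b ↔ a' = b' := by
  let t₁ : L.Term (Fin 2) := FirstOrder.Language.Term.var 0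
  let t₂ : L.Term (Fin 2) := FirstOrder.Language.Term.var 1
  have := hR.sameQFType (x := ![a, b]) (y := ![a', b']) (by
    intro i; fin_cases i <;> simpa) (t₁.equal t₂)
      (FirstOrder.Language.BoundedFormula.IsAtomic.equal _ _).isQF
  simpa [t₁, t₂] using this

theorem right_unique {R : Set (M × M)} (hR : PartialIso L R) {a b b' : M} (h : (a, b) ∈ R)
    (h' : (a, b') ∈ R) : b = b' := (hR.eq_iff h h').1 rfl

theorem left_unique {R : Set (M × M)} (hR : PartialIso L R) {a a' b : M} (h : (a, b) ∈ R)
    (h' : (a', b) ∈ R) : a = a' := (hR.eq_iff h h').2 rfl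

theorem finite_of_dom {R : Set (M × M)} (hR : PartialIso L R) (h : (dom R).Finite) : R.Finite :=
  Set.Finite.of_finite_image h (by
    rintro ⟨a, b⟩ h1 ⟨a', b'⟩ h2 (rfl : a = a')
    rw [hR.right_unique h1 h2])

theorem finite_ran {R : Set (M × M)} (hR : PartialIso L R) (h : (dom R).Finite) :
    (ran R).Finite := (hR.finite_of_dom h).image _

theorem countable_of_dom {R : Set (M × M)} (hR : PartialIso L R) (h : (dom R).Countable) :
    R.Countable :=
  Set.countable_of_injective_of_countable_image (f := Prod.fst) (by
    rintro ⟨a, b⟩ h1 ⟨a', b'⟩ h2 (rfl : a = a')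
    rw [hR.right_unique h1 h2]) h

theorem countable_ran {R : Set (M × M)} (hR : PartialIso L R) (h : (dom R).Countable) :
    (ran R).Countable := (hR.countable_of_dom h).image _

theorem sUnion_chain {c : Set (Set (M × M))} (hc : IsChain (· ⊆ ·) c) (hne : c.Nonempty)
    (h : ∀ R ∈ c, PartialIso L R) : PartialIso L (⋃₀ c) := by
  refine of_finite fun F hF hFf => ?_
  have : ∃ t ∈ c, F ⊆ t := by
    induction F, hFf using Set.Finite.induction_on with
    | empty => exact ⟨_, hne.some_mem, Set.empty_subset _⟩
    | @insert b F hb hFf ih =>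
      obtain ⟨t, ht, hFt⟩ := ih ((Set.subset_insert _ _).trans hF)
      obtain ⟨u, hu, hbu⟩ := hF (Set.mem_insert _ _)
      rcases hc.total ht hu with htu | hut
      · exact ⟨u, hu, Set.insert_subset hbu (hFt.trans htu)⟩
      · exact ⟨t, ht, Set.insert_subset (hut hbu) hFt⟩
  obtain ⟨t, ht, hFt⟩ := this
  exact (h t ht).mono hFt

/-- A relation on `D ∪ E`, where it is the identity on `D`, can be tested on finite subsets
of `D`. -/
theorem diag_union_of_finite {D : Set M} {S : Set (M × M)}
    (h : ∀ d ⊆ D, d.Finite → PartialIso L (Quasiminimal.diag d ∪ S)) :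
    PartialIso L (Quasiminimal.diag D ∪ S) := by
  refine of_finite fun F hF hFf => ?_
  refine (h (D ∩ dom F) Set.inter_subset_left ((hFf.image _).inter_of_right _)).mono ?_
  intro p hp
  rcases hF hp with h1 | h1
  · exact Or.inl ⟨⟨h1.1, ⟨p, hp, rfl⟩⟩, h1.2⟩
  · exact Or.inr h1

/-- A partial isomorphism that is total and onto is an automorphism. -/
theorem exists_equiv {R : Set (M × M)} (hR : PartialIso L R) (hd : dom R = Set.univ)
    (hr : ran R = Set.univ) : ∃ f : M ≃[L] M, ∀ a b, (a, b) ∈ R ↔ f a = b := by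
  choose f hf using fun a => exists_of_mem_dom (R := R) (a := a) (hd ▸ Set.mem_univ a)
  choose g hg using fun a => exists_of_mem_ran (R := R) (b := a) (hr ▸ Set.mem_univ a)
  refine ⟨⟨⟨f, g, fun a => hR.left_unique (hg _) (hf _), fun a => hR.right_unique (hf _) (hg _)⟩,
    ?_, ?_⟩, ?_⟩
  · intro n F x
    -- The variable `none` stands for the value and `some i` for the arguments, so that preservation
    -- of `F` becomes preservation of one atomic formula.
    let t : L.Term (Option (Fin n)) :=
      FirstOrder.Language.Term.func F fun i => FirstOrder.Language.Term.var (some i)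
    let t' : L.Term (Option (Fin n)) := FirstOrder.Language.Term.var none
    have := hR.sameQFType
      (x := fun o : Option (Fin n) => o.elim (FirstOrder.Language.Structure.funMap F x) x)
      (y := fun o : Option (Fin n) => o.elim (f (FirstOrder.Language.Structure.funMap F x)) (f ∘ x))
      (by rintro (_ | i); exacts [hf _, hf _]) (t'.equal t)
      (FirstOrder.Language.BoundedFormula.IsAtomic.equal _ _).isQF
    simpa [t, t', Function.comp_def] using this
  · intro n r x
    have := hR.sameQFType (x := x) (y := f ∘ x) (fun i => hf _)
      (r.formula fun i => FirstOrder.Language.Term.var i)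
      (FirstOrder.Language.BoundedFormula.IsAtomic.rel _ _).isQF
    simpa [Function.comp_def] using this.symm
  · intro a b
    constructor
    · intro h; exact hR.right_unique (hf a) h
    · rintro rfl; exact hf a

/-- The graph of an automorphism. -/
theorem of_equiv (f : M ≃[L] M) : PartialIso L {p : M × M | f p.1 = p.2} := by
  intro φ hφ
  have h1 : (fun p : {p : M × M | f p.1 = p.2} => p.1.2) =
      f ∘ fun p : {p : M × M | f p.1 = p.2} => p.1.1 := funext fun p => p.2.symm
  rw [h1]
  exact (FirstOrder.Language.StrongHomClass.realize_formula f φ).symm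

end PartialIso

end PartialIso

/-! ### Extending partial isomorphisms to closures. -/

section Extension

variable {L : FirstOrder.Language} {M : Type*} [L.Structure M] {cl : Set M → Set M}

variable (L cl) in

/-- A partial isomorphism between countable closed sets. -/
structure ClosedIso (R : Set (M × M)) : Prop where
  iso : PartialIso L R
  countable : (dom R).Countable
  dom_closed : cl (dom R) = dom R
  ran_closed : cl (ran R) = ran R

theorem ClosedIso.inv {R : Set (M × M)} (hR : ClosedIso L cl R) : ClosedIso L cl (inv R) :=
  ⟨hR.iso.inv, by rw [dom_inv]; exact hR.iso.countable_ran hR.countable,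
    by rw [dom_inv]; exact hR.ran_closed, by rw [ran_inv]; exact hR.dom_closed⟩

/-- The part `R` is kept fixed and may be infinite; only the finite part grows, in countably many
steps, and it acquires pairs from `E ×ˢ E'` alone. -/
theorem back_and_forth {R S₀ : Set (M × M)} {E E' : Set M} (hE : E.Countable) (hE' : E'.Countable)
    (hS₀ : S₀.Finite) (hRS₀ : PartialIso L (R ∪ S₀))
    (forth : ∀ S : Set (M × M), S.Finite → S₀ ⊆ S → PartialIso L (R ∪ S) → ∀ a ∈ E,
      ∃ a' ∈ E', PartialIso L (R ∪ insert (a, a') S))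
    (back : ∀ S : Set (M × M), S.Finite → S₀ ⊆ S → PartialIso L (R ∪ S) → ∀ a' ∈ E',
      ∃ a ∈ E, PartialIso L (R ∪ insert (a, a') S)) :
    ∃ T, S₀ ⊆ T ∧ PartialIso L (R ∪ T) ∧ E ⊆ dom T ∧ E' ⊆ ran T ∧ T ⊆ S₀ ∪ E ×ˢ E' := by
  let St := {S : Set (M × M) // S.Finite ∧ S₀ ⊆ S ∧ PartialIso L (R ∪ S) ∧ S ⊆ S₀ ∪ E ×ˢ E'}
  have step : ∀ (x : E ⊕ E') (S : St), ∃ S' : St, S.1 ⊆ S'.1 ∧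
      Sum.elim (fun a : E => (a : M) ∈ dom S'.1) (fun a : E' => (a : M) ∈ ran S'.1) x := by
    rintro (⟨a, ha⟩ | ⟨a', ha'⟩) ⟨S, hS, hS₀S, hP, hsub⟩
    · obtain ⟨a', ha', h⟩ := forth S hS hS₀S hP a ha
      exact ⟨⟨insert (a, a') S, hS.insert _, hS₀S.trans (Set.subset_insert _ _), h,
        Set.insert_subset (Or.inr ⟨ha, ha'⟩) hsub⟩, Set.subset_insert _ _,
        mem_dom (Set.mem_insert _ _)⟩
    · obtain ⟨a, ha, h⟩ := back S hS hS₀S hP a' ha'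
      exact ⟨⟨insert (a, a') S, hS.insert _, hS₀S.trans (Set.subset_insert _ _), h,
        Set.insert_subset (Or.inr ⟨ha, ha'⟩) hsub⟩, Set.subset_insert _ _,
        mem_ran (Set.mem_insert _ _)⟩
  choose next hnext1 hnext2 using step
  have s₀ : St := ⟨S₀, hS₀, subset_rfl, hRS₀, Set.subset_union_left⟩
  have := hE.to_subtype
  have := hE'.to_subtype
  rcases isEmpty_or_nonempty (E ⊕ E') with hemp | hne
  · refine ⟨S₀, subset_rfl, hRS₀, fun a ha => (hemp.false (Sum.inl ⟨a, ha⟩)).elim,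
      fun a ha => (hemp.false (Sum.inr ⟨a, ha⟩)).elim, Set.subset_union_left⟩
  · obtain ⟨e, he⟩ := exists_surjective_nat (E ⊕ E')
    let s : ℕ → St := fun n => Nat.rec s₀ (fun k S => next (e k) S) n
    have hs : ∀ n, s (n + 1) = next (e n) (s n) := fun n => rfl
    have hmono : Monotone fun n => (s n).1 := monotone_nat_of_le_succ fun n => by
      show (s n).1 ⊆ (s (n + 1)).1
      rw [hs]; exact hnext1 _ _
    refine ⟨⋃ n, (s n).1, (s 0).2.2.1.trans (Set.subset_iUnion (fun n => (s n).1) 0), ?_, ?_, ?_,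
      Set.iUnion_subset fun n => (s n).2.2.2.2⟩
    · refine PartialIso.of_finite fun F hF hFf => ?_
      have : ∃ n, F ⊆ R ∪ (s n).1 := by
        induction F, hFf using Set.Finite.induction_on with
        | empty => exact ⟨0, Set.empty_subset _⟩
        | @insert b F hb hFf ih =>
          obtain ⟨n, hn⟩ := ih ((Set.subset_insert _ _).trans hF)
          rcases hF (Set.mem_insert _ _) with hb | hb
          · exact ⟨n, Set.insert_subset (Or.inl hb) hn⟩
          · obtain ⟨m, hm⟩ := Set.mem_iUnion.1 hb
            refine ⟨max n m, Set.insert_subset (Or.inr (hmono (le_max_right n m) hm)) ?_⟩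
            exact hn.trans (Set.union_subset_union_right _ (hmono (le_max_left n m)))
      obtain ⟨n, hn⟩ := this
      exact (s n).2.2.2.1.mono hn
    · intro a ha
      obtain ⟨n, hn⟩ := he (Sum.inl ⟨a, ha⟩)
      have := hnext2 (e n) (s n)
      rw [← hs, hn] at this
      exact dom_mono (Set.subset_iUnion (fun n => (s n).1) (n + 1)) this
    · intro a ha
      obtain ⟨n, hn⟩ := he (Sum.inr ⟨a, ha⟩)
      have := hnext2 (e n) (s n)
      rw [← hs, hn] at this
      exact ran_mono (Set.subset_iUnion (fun n => (s n).1) (n + 1)) this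

namespace IsQuasiminimalPregeometryStructure

variable (hM : IsQuasiminimalPregeometryStructure L cl)
include hM

/-- (QM1) concerns finite tuples; the finite character of `cl` reduces arbitrary `S` to it. -/
theorem mem_cl_ran {R S : Set (M × M)} (hR : PartialIso L R) (hSR : S ⊆ R) {a a' : M}
    (haa : (a, a') ∈ R) (ha : a ∈ cl (dom S)) : a' ∈ cl (ran S) := by
  obtain ⟨F, hF, hFS, haF⟩ := hM.pregeometry.finitary _ _ ha
  obtain ⟨n, b, hb⟩ := hF.fin_param
  choose b' hb' using fun i => exists_of_mem_dom (hFS (hb.2 ▸ Set.mem_range_self i : b i ∈ F))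
  have h := (hM.qm1 n b b' a a' (hR.sameQFType (by
    rintro (i | i)
    · exact haa
    · exact hSR (hb' i)))).1 (by rw [hb.2]; exact haF)
  refine hM.pregeometry.cl_mono ?_ h
  rintro _ ⟨i, rfl⟩
  exact mem_ran (hb' i)

theorem mem_cl_iff {R S : Set (M × M)} (hR : PartialIso L R) (hSR : S ⊆ R) {a a' : M}
    (haa : (a, a') ∈ R) : a ∈ cl (dom S) ↔ a' ∈ cl (ran S) := by
  refine ⟨hM.mem_cl_ran hR hSR haa, fun h => ?_⟩
  have := hM.mem_cl_ran (R := inv R) (S := inv S) hR.inv (fun p hp => hSR hp) (a := a') (a' := a)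
    haa (by rwa [dom_inv])
  rwa [ran_inv] at this

/-- (QM4), with the enumerations replaced by a relation. -/
theorem partialIso_insert_of_notMem {R : Set (M × M)} (hR : ClosedIso L cl R) {a a' : M}
    (ha : a ∉ dom R) (ha' : a' ∉ ran R) : PartialIso L (insert (a, a') R) := by
  choose e he using fun h : dom R => exists_of_mem_dom h.2
  have hran : Set.range e = ran R := by
    ext y; constructor
    · rintro ⟨h, rfl⟩; exact mem_ran (he h)
    · intro hy
      obtain ⟨x, hx⟩ := exists_of_mem_ran hy
      exact ⟨⟨x, mem_dom hx⟩, hR.iso.right_unique (he _) hx⟩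
  have := hM.qm4 (dom R) (ran R) e hR.countable hR.dom_closed
    (hR.iso.countable_ran hR.countable) hR.ran_closed hran (hR.iso.sameQFType he) a a' ha ha'
  refine (PartialIso.of_sameQFType this).mono ?_
  rintro ⟨x, y⟩ (h | h)
  · obtain ⟨rfl, rfl⟩ := Prod.mk.inj h
    exact ⟨Sum.inr (), rfl⟩
  · refine ⟨Sum.inl ⟨x, mem_dom h⟩, ?_⟩
    simp [join, hR.iso.right_unique (he ⟨x, mem_dom h⟩) h]

/-- (QM5) in relational form. The case `R = ∅` gives homogeneity over finite sets. -/
theorem exists_insert {R S : Set (M × M)} (hR : ClosedIso L cl R ∨ R = ∅) (hS : S.Finite)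
    (hRS : PartialIso L (R ∪ S)) {a : M} (ha : a ∈ cl (dom R ∪ dom S)) :
    ∃ a', PartialIso L (insert (a, a') (R ∪ S)) := by
  have hRi : PartialIso L R := hRS.mono Set.subset_union_left
  choose e he using fun h : dom R => exists_of_mem_dom h.2
  have hran : Set.range e = ran R := by
    ext y; constructor
    · rintro ⟨h, rfl⟩; exact mem_ran (he h)
    · intro hy
      obtain ⟨x, hx⟩ := exists_of_mem_ran hy
      exact ⟨⟨x, mem_dom hx⟩, hRi.right_unique (he _) hx⟩
  obtain ⟨n, b, hb⟩ := hS.fin_param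
  have hbS : ∀ i, b i ∈ S := fun i => hb.2 ▸ Set.mem_range_self i
  have hdS : Set.range (fun i => (b i).1) = dom S := by
    rw [dom, ← hb.2, ← Set.range_comp]; rfl
  obtain ⟨a', ha'⟩ := hM.qm5 (dom R) (ran R) e
    (by rcases hR with h | h
        · exact Or.inl ⟨h.countable, h.dom_closed⟩
        · right; simp [h, dom])
    (by rcases hR with h | h
        · exact Or.inl ⟨h.iso.countable_ran h.countable, h.ran_closed⟩
        · right; simp [h, ran])
    hran (hRi.sameQFType he) n (fun i => (b i).1) (fun i => (b i).2)
    (hRS.sameQFType (by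
      rintro (i | i)
      · exact Or.inl (he i)
      · exact Or.inr (hbS i))) a (by rwa [hdS])
  refine ⟨a', (PartialIso.of_sameQFType ha').mono ?_⟩
  rintro ⟨x, y⟩ (h | h | h)
  · obtain ⟨rfl, rfl⟩ := Prod.mk.inj h
    exact ⟨Sum.inr (), rfl⟩
  · refine ⟨Sum.inl (Sum.inl ⟨x, mem_dom h⟩), ?_⟩
    simp [join, hRi.right_unique (he ⟨x, mem_dom h⟩) h]
  · obtain ⟨i, hi⟩ : (x, y) ∈ Set.range b := hb.2.symm ▸ h
    refine ⟨Sum.inl (Sum.inr i), ?_⟩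
    simp [join, hi]

theorem exists_insert_left {R S : Set (M × M)} (hR : ClosedIso L cl R ∨ R = ∅) (hS : S.Finite)
    (hRS : PartialIso L (R ∪ S)) {a' : M} (ha' : a' ∈ cl (ran R ∪ ran S)) :
    ∃ a, PartialIso L (insert (a, a') (R ∪ S)) := by
  obtain ⟨a, ha⟩ := hM.exists_insert (R := inv R) (S := inv S)
    (hR.imp (fun h => h.inv) (fun h => by subst h; rfl)) (finite_inv hS) hRS.inv
    (by rwa [dom_inv, dom_inv])
  refine ⟨a, ?_⟩
  have := ha.inv
  rwa [← inv_union, inv_insert, inv_inv] at this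

theorem countable_cl {S : Set M} (hS : S.Countable) : (cl S).Countable :=
  hM.pregeometry.countable_cl hM.qm3 hS

/-- A partial isomorphism between closed sets together with a finite partial map extends to the
closure. -/
theorem exists_closure {R S : Set (M × M)} (hR : ClosedIso L cl R ∨ R = ∅) (hS : S.Finite)
    (hRS : PartialIso L (R ∪ S)) :
    ∃ T, R ∪ S ⊆ T ∧ ClosedIso L cl T ∧ dom T = cl (dom R ∪ dom S) ∧
      ran T = cl (ran R ∪ ran S) := by
  have hp := hM.pregeometry
  have hRc : (dom R).Countable := by
    rcases hR with h | h
    · exact h.countable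
    · simp [h, dom]
  have hRSc : (R ∪ S).Countable :=
    ((hRS.mono Set.subset_union_left).countable_of_dom hRc).union hS.countable
  have hc1 : (cl (dom R ∪ dom S)).Countable := by
    rw [← dom_union]; exact hM.countable_cl (hRSc.image _)
  have hc2 : (cl (ran R ∪ ran S)).Countable := by
    rw [← ran_union]; exact hM.countable_cl (hRSc.image _)
  -- (QM5) supplies the witnesses, and (QM1) places each of them in the opposite closure.
  obtain ⟨T, hST, hT, hd, hr, hsub⟩ := back_and_forth (R := R) (S₀ := S) hc1 hc2 hS hRS
    (by
      intro S' hS' hSS' hP a ha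
      obtain ⟨a', ha'⟩ := hM.exists_insert hR hS' hP
        (hp.cl_mono (Set.union_subset_union_right _ (dom_mono hSS')) ha)
      refine ⟨a', ?_, ha'.mono ?_⟩
      · have := hM.mem_cl_ran (S := R ∪ S) ha' ((Set.union_subset_union_right _ hSS').trans
          (Set.subset_insert _ _)) (Set.mem_insert _ _) (by rwa [dom_union])
        rwa [ran_union] at this
      · rw [Set.union_insert])
    (by
      intro S' hS' hSS' hP a ha
      obtain ⟨a', ha'⟩ := hM.exists_insert_left hR hS' hP
        (hp.cl_mono (Set.union_subset_union_right _ (ran_mono hSS')) ha)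
      refine ⟨a', ?_, ha'.mono ?_⟩
      · have := (hM.mem_cl_iff (S := R ∪ S) ha' ((Set.union_subset_union_right _ hSS').trans
          (Set.subset_insert _ _)) (Set.mem_insert _ _)).2 (by rwa [ran_union])
        rwa [dom_union] at this
      · rw [Set.union_insert])
  have hdT : dom (R ∪ T) = cl (dom R ∪ dom S) := by
    refine Set.Subset.antisymm ?_ (hd.trans (dom_mono Set.subset_union_right))
    rintro _ ⟨p, hp' | hp', rfl⟩
    · exact hp.mem_cl (Or.inl ⟨p, hp', rfl⟩)
    · rcases hsub hp' with h | h
      · exact hp.mem_cl (Or.inr ⟨p, h, rfl⟩)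
      · exact h.1
  have hrT : ran (R ∪ T) = cl (ran R ∪ ran S) := by
    refine Set.Subset.antisymm ?_ (hr.trans (ran_mono Set.subset_union_right))
    rintro _ ⟨p, hp' | hp', rfl⟩
    · exact hp.mem_cl (Or.inl ⟨p, hp', rfl⟩)
    · rcases hsub hp' with h | h
      · exact hp.mem_cl (Or.inr ⟨p, h, rfl⟩)
      · exact h.2
  exact ⟨R ∪ T, Set.union_subset_union_right _ hST, ⟨hT, hdT ▸ hc1, by rw [hdT, hp.idem],
    by rw [hrT, hp.idem]⟩, hdT, hrT⟩

/-- Independent sets over isomorphic closed sets can be matched. -/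
theorem exists_closure_indep {R S : Set (M × M)} (hR : ClosedIso L cl R) (hS : S.Finite)
    (h1 : Set.InjOn Prod.fst S) (h2 : Set.InjOn Prod.snd S) (hd : IndepOver cl (dom R) (dom S))
    (hr : IndepOver cl (ran R) (ran S)) :
    ∃ T, R ∪ S ⊆ T ∧ ClosedIso L cl T ∧ dom T = cl (dom R ∪ dom S) ∧
      ran T = cl (ran R ∪ ran S) := by
  have hp := hM.pregeometry
  induction S, hS using Set.Finite.induction_on with
  | empty =>
    refine ⟨R, by simp, hR, ?_, ?_⟩
    · rw [show dom (∅ : Set (M × M)) = ∅ from Set.image_empty _, Set.union_empty, hR.dom_closed]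
    · rw [show ran (∅ : Set (M × M)) = ∅ from Set.image_empty _, Set.union_empty, hR.ran_closed]
  | @insert p S hpS hS ih =>
    obtain ⟨a, a'⟩ := p
    rw [dom_insert] at hd
    rw [ran_insert] at hr
    obtain ⟨T, hT, hTc, hTd, hTr⟩ := ih (h1.mono (Set.subset_insert _ _))
      (h2.mono (Set.subset_insert _ _)) (hd.mono hp subset_rfl (Set.subset_insert _ _))
      (hr.mono hp subset_rfl (Set.subset_insert _ _))
    have ha : a ∉ dom T := by
      rw [hTd]
      refine fun h => hd a (Set.mem_insert _ _) (hp.cl_mono (Set.union_subset_union_right _ ?_) h)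
      rintro _ ⟨q, hq, rfl⟩
      refine ⟨Or.inr ⟨q, hq, rfl⟩, fun e => hpS ?_⟩
      rwa [← h1 (Or.inr hq) (Or.inl rfl) e]
    have ha' : a' ∉ ran T := by
      rw [hTr]
      refine fun h => hr a' (Set.mem_insert _ _) (hp.cl_mono (Set.union_subset_union_right _ ?_) h)
      rintro _ ⟨q, hq, rfl⟩
      refine ⟨Or.inr ⟨q, hq, rfl⟩, fun e => hpS ?_⟩
      rwa [← h2 (Or.inr hq) (Or.inl rfl) e]
    -- Independence puts the new pair outside both closed sets, (QM4) adds it, and passing to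
    -- closures restores the induction hypothesis.
    obtain ⟨U, hU, hUc, hUd, hUr⟩ := hM.exists_closure (S := {(a, a')}) (Or.inl hTc)
      (Set.finite_singleton _) (by
        rw [Set.union_singleton]; exact hM.partialIso_insert_of_notMem hTc ha ha')
    refine ⟨U, ?_, hUc, ?_, ?_⟩
    · rw [Set.union_insert, Set.insert_subset_iff]
      exact ⟨hU (Or.inr rfl), hT.trans (Set.subset_union_left.trans hU)⟩
    · rw [hUd, hTd, hp.cl_cl_union, dom_insert]
      simp [dom, Set.union_insert]
    · rw [hUr, hTr, hp.cl_cl_union, ran_insert]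
      simp [ran, Set.union_insert]

end IsQuasiminimalPregeometryStructure

end Extension

/-! ### Baire category for permutations of a countable set. -/

section Baire

/-- A set of permutations is closed for pointwise convergence. -/
def IsPointwiseClosed {X : Type*} (Q : Set (Equiv.Perm X)) : Prop :=
  ∀ σ, (∀ F : Set X, F.Finite → ∃ τ ∈ Q, ∀ x ∈ F, τ x = σ x) → σ ∈ Q

/-- A pointwise limit of permutations need not be a permutation. Recording the inverse as a second
coordinate forces the limit to be bijective. -/
theorem IsPointwiseClosed.isClosed {X : Type*} [TopologicalSpace X] [DiscreteTopology X]
    {Q : Set (Equiv.Perm X)} (hQ : IsPointwiseClosed Q) :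
    IsClosed {p : (X → X) × (X → X) | ∃ σ ∈ Q, p = (⇑σ, ⇑σ.symm)} := by
  refine isClosed_of_closure_subset fun p hp => ?_
  have approx : ∀ F : Set X, F.Finite →
      ∃ σ ∈ Q, ∀ x ∈ F, σ x = p.1 x ∧ σ.symm x = p.2 x := by
    intro F hF
    have hopen : IsOpen {q : (X → X) × (X → X) | ∀ x ∈ F, q.1 x = p.1 x ∧ q.2 x = p.2 x} := by
      have : {q : (X → X) × (X → X) | ∀ x ∈ F, q.1 x = p.1 x ∧ q.2 x = p.2 x} =
          ⋂ x ∈ F, ({q | q.1 x = p.1 x} ∩ {q | q.2 x = p.2 x}) := by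
        ext q; simp
      rw [this]
      refine hF.isOpen_biInter fun x _ => IsOpen.inter ?_ ?_
      · exact IsOpen.preimage (f := fun q : (X → X) × (X → X) => q.1 x)
          ((continuous_apply x).comp continuous_fst) (isOpen_discrete {p.1 x})
      · exact IsOpen.preimage (f := fun q : (X → X) × (X → X) => q.2 x)
          ((continuous_apply x).comp continuous_snd) (isOpen_discrete {p.2 x})
    obtain ⟨q, hq, σ, hσ, rfl⟩ := mem_closure_iff.1 hp _ hopen (fun x _ => ⟨rfl, rfl⟩)
    exact ⟨σ, hσ, hq⟩
  have h12 : ∀ x, p.1 (p.2 x) = x := by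
    intro x
    obtain ⟨σ, -, h⟩ := approx {x, p.2 x} (by simp)
    rw [← (h (p.2 x) (by simp)).1, ← (h x (by simp)).2, Equiv.apply_symm_apply]
  have h21 : ∀ x, p.2 (p.1 x) = x := by
    intro x
    obtain ⟨σ, -, h⟩ := approx {x, p.1 x} (by simp)
    rw [← (h (p.1 x) (by simp)).2, ← (h x (by simp)).1, Equiv.symm_apply_apply]
  refine ⟨⟨p.1, p.2, h21, h12⟩, hQ _ fun F hF => ?_, rfl⟩
  obtain ⟨σ, hσ, h⟩ := approx F hF
  exact ⟨σ, hσ, fun x hx => (h x hx).1⟩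

/-- The Baire category theorem for closed sets of permutations of a countable set. -/
theorem exists_stable_of_countable_cover {X Z : Type*} [Countable X] [Countable Z]
    {Q : Set (Equiv.Perm X)} (hne : Q.Nonempty) (hQ : IsPointwiseClosed Q)
    {A : Z → Set (Equiv.Perm X)} (hA : ∀ z, IsPointwiseClosed (A z)) (hcov : Q ⊆ ⋃ z, A z) :
    ∃ z, ∃ σ₀ ∈ Q, ∃ F : Set X, F.Finite ∧ ∀ σ ∈ Q, (∀ x ∈ F, σ x = σ₀ x) → σ ∈ A z := by
  let _ : TopologicalSpace X := ⊥
  have : DiscreteTopology X := ⟨rfl⟩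
  let K : (Set (Equiv.Perm X)) → Set ((X → X) × (X → X)) := fun Q => {p | ∃ σ ∈ Q, p = (⇑σ, ⇑σ.symm)}
  have : TopologicalSpace.IsCompletelyMetrizableSpace (K Q) :=
    (hQ.isClosed).isCompletelyMetrizableSpace
  obtain ⟨τ, hτ⟩ := hne
  have : Nonempty (K Q) := ⟨⟨(⇑τ, ⇑τ.symm), τ, hτ, rfl⟩⟩
  obtain ⟨z, ⟨⟨p, σ₀, hσ₀, rfl⟩, hp⟩⟩ := nonempty_interior_of_iUnion_of_closed
    (f := fun z : Z => (Subtype.val ⁻¹' K (A z) : Set (K Q)))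
    (fun z => (hA z).isClosed.preimage continuous_subtype_val) (by
      refine Set.eq_univ_of_forall ?_
      rintro ⟨p, σ, hσ, rfl⟩
      obtain ⟨z, hz⟩ := Set.mem_iUnion.1 (hcov hσ)
      exact Set.mem_iUnion.2 ⟨z, σ, hz, rfl⟩)
  rw [mem_interior] at hp
  obtain ⟨U, hUA, hU, hpU⟩ := hp
  obtain ⟨V, hV, rfl⟩ := isOpen_induced_iff.1 hU
  obtain ⟨V₁, V₂, hV₁, hV₂, h1, h2, hV12⟩ := isOpen_prod_iff.1 hV _ _ hpU
  obtain ⟨F₁, u₁, hu₁, hF₁⟩ := isOpen_pi_iff.1 hV₁ _ h1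
  obtain ⟨F₂, u₂, hu₂, hF₂⟩ := isOpen_pi_iff.1 hV₂ _ h2
  -- Agreement of `σ.symm` with `σ₀.symm` on `F₂` is the same as agreement of `σ` with `σ₀` on
  -- `σ₀.symm '' F₂`.
  refine ⟨z, σ₀, hσ₀, F₁ ∪ σ₀.symm '' F₂, F₁.finite_toSet.union (F₂.finite_toSet.image _), ?_⟩
  intro σ hσ hF
  have hmem : ((σ : X → X), (σ.symm : X → X)) ∈ V := by
    refine hV12 ⟨hF₁ fun x hx => ?_, hF₂ fun x hx => ?_⟩
    · show σ x ∈ u₁ x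
      rw [hF x (Or.inl hx)]
      exact (hu₁ x hx).2
    · have := hF (σ₀.symm x) (Or.inr ⟨x, hx, rfl⟩)
      rw [Equiv.apply_symm_apply] at this
      show σ.symm x ∈ u₂ x
      rw [(Equiv.symm_apply_eq σ).2 this.symm]
      exact (hu₂ x hx).2
  obtain ⟨σ', hσ', he⟩ := @hUA ⟨(⇑σ, ⇑σ.symm), σ, hσ, rfl⟩ hmem
  have : σ = σ' := Equiv.coe_fn_injective (congrArg Prod.fst he)
  rwa [this]

end Baire

/-! ### Coheirs over span sets, and isolation by finite sets. -/

section Coheir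

variable {L : FirstOrder.Language} {M : Type*} [L.Structure M] {cl : Set M → Set M}

theorem IndepOver.of_disjoint (h : IsPregeometry cl) {B J W : Set M} (hB : IndepOver cl ∅ B)
    (hJ : J ⊆ B) (hW : W ⊆ B) (hJW : Disjoint W J) : IndepOver cl J W := fun w hw hw' =>
  hB w (hW hw) (h.cl_mono (by
    rw [Set.empty_union]
    exact Set.union_subset (fun x hx => ⟨hJ hx, fun e => hJW.notMem_of_mem_left hw
      ((Set.mem_singleton_iff.1 e) ▸ hx)⟩) (Set.sdiff_subset_sdiff_left hW)) hw')

/-- The union of `B` and the closures of the members of `𝒵`. -/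
def spanSet (cl : Set M → Set M) (B : Set M) (𝒵 : Set (Set M)) : Set M := B ∪ ⋃ Z ∈ 𝒵, cl Z

theorem subset_spanSet (B : Set M) (𝒵 : Set (Set M)) : B ⊆ spanSet cl B 𝒵 :=
  Set.subset_union_left

theorem cl_subset_spanSet {B : Set M} {𝒵 : Set (Set M)} {Z : Set M} (hZ : Z ∈ 𝒵) :
    cl Z ⊆ spanSet cl B 𝒵 := fun _ hx => Or.inr (Set.mem_biUnion hZ hx)

theorem spanSet_insert (B : Set M) (𝒵 : Set (Set M)) (Z : Set M) :
    spanSet cl B (insert Z 𝒵) = spanSet cl B 𝒵 ∪ cl Z := by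
  simp only [spanSet, Set.biUnion_insert]
  rw [Set.union_comm (cl Z), Set.union_assoc]

variable (hM : IsQuasiminimalPregeometryStructure L cl)
include hM

namespace IsQuasiminimalPregeometryStructure

/-- Finitely many elements `W` of an independent set can be moved into an infinite subset `T`,
over the closure of `J`. -/
theorem exists_mover {B J W T : Set M} (hB : IndepOver cl ∅ B) (hJB : J ⊆ B) (hJ : J.Countable)
    (hWB : W ⊆ B) (hW : W.Finite) (hWJ : Disjoint W J) (hTB : T ⊆ B) (hT : (T \ J).Infinite) :
    ∃ (ι : M → M) (g : Set (M × M)), Set.MapsTo ι W (T \ J) ∧ ClosedIso L cl g ∧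
      diag (cl J) ⊆ g ∧ (∀ w ∈ W, (w, ι w) ∈ g) ∧ dom g = cl (J ∪ W) ∧ ran g = cl (J ∪ ι '' W) ∧
      ∀ F ⊆ J ∪ W, ∀ d d', (d, d') ∈ g → d ∈ cl F → d' ∈ cl ((F ∩ J) ∪ ι '' (F ∩ W)) := by
  have hp := hM.pregeometry
  have : Nonempty M := ⟨hT.nonempty.some⟩
  obtain ⟨ι, hι, hinj⟩ := hW.exists_injOn_of_encard_le (t := T \ J) (by
    rw [hT.encard_eq]; exact le_top)
  let S : Set (M × M) := (fun w => (w, ι w)) '' W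
  have hdS : dom S = W := by rw [dom, Set.image_image]; simp
  have hrS : ran S = ι '' W := by rw [ran, Set.image_image]
  have hcl : ClosedIso L cl (diag (cl J)) := ⟨PartialIso.diag _, by
    rw [dom_diag]; exact hM.countable_cl hJ, by rw [dom_diag, hp.idem], by
    rw [ran_diag, hp.idem]⟩
  have hιW : ι '' W ⊆ T \ J := Set.image_subset_iff.2 hι
  -- `W` and its image are subsets of the independent set `B` disjoint from `J`, hence both
  -- independent over `cl J`.
  obtain ⟨g, hg, hgc, hgd, hgr⟩ := hM.exists_closure_indep (R := diag (cl J)) (S := S) hcl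
    (hW.image _) (by
      rintro _ ⟨w, hw, rfl⟩ _ ⟨w', hw', rfl⟩ e
      simp only at e
      rw [e]) (by
      rintro _ ⟨w, hw, rfl⟩ _ ⟨w', hw', rfl⟩ e
      have := hinj hw hw' e
      rw [this]) (by
      rw [dom_diag, hdS]
      exact (IndepOver.of_disjoint hp hB hJB hWB hWJ).cl_left hp) (by
      rw [ran_diag, hrS]
      exact (IndepOver.of_disjoint hp hB hJB ((hιW.trans Set.sdiff_subset).trans hTB)
        (Set.disjoint_of_subset_left hιW Set.disjoint_sdiff_left)).cl_left hp)
  rw [dom_diag, hdS, hp.cl_cl_union] at hgd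
  rw [ran_diag, hrS, hp.cl_cl_union] at hgr
  have hgS : ∀ w ∈ W, (w, ι w) ∈ g := fun w hw => hg (Or.inr ⟨w, hw, rfl⟩)
  have hgJ : diag (cl J) ⊆ g := Set.subset_union_left.trans hg
  refine ⟨ι, g, hι, hgc, hgJ, hgS, hgd, hgr, ?_⟩
  intro F hF d d' hd hdF
  have hdom : dom {p ∈ g | p.1 ∈ F} = F := by
    ext x; constructor
    · rintro ⟨p, hp, rfl⟩; exact hp.2
    · intro hx
      obtain ⟨y, hy⟩ := exists_of_mem_dom (R := g) (a := x) (by rw [hgd]; exact hp.mem_cl (hF hx))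
      exact ⟨(x, y), ⟨hy, hx⟩, rfl⟩
  have := hM.mem_cl_ran hgc.iso (S := {p ∈ g | p.1 ∈ F}) (Set.sep_subset _ _) hd (by rwa [hdom])
  refine hp.cl_mono ?_ this
  rintro _ ⟨⟨x, y⟩, ⟨hxy, hx⟩, rfl⟩
  simp only at hx
  rcases hF hx with h | h
  · left
    rw [← hgc.iso.right_unique (hgJ (mem_diag (hp.mem_cl h))) hxy]
    exact ⟨hx, h⟩
  · right
    exact ⟨x, ⟨hx, h⟩, hgc.iso.right_unique (hgS x h) hxy⟩

/-- Types over the closure of a finite independent set `J` that agree on `C` agree on the whole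
`spanSet`, if `C` contains enough conjugates over `J`. -/
theorem partialIso_of_coheir {B J T C : Set M} {𝒵 : Set (Set M)} {S : Set (M × M)}
    (hB : IndepOver cl ∅ B) (hJB : J ⊆ B) (hJ : J.Finite) (hTB : T ⊆ B) (hT : T.Infinite)
    (h𝒵 : ∀ Z ∈ 𝒵, Z ⊆ B) (hSd : dom S ⊆ cl J) (hSr : ran S ⊆ cl J) (hJC : J ⊆ C) (hTC : T ⊆ C)
    (hC : ∀ Z ∈ 𝒵, cl ((Z ∩ J) ∪ T) ⊆ C) (hS : PartialIso L (diag C ∪ S)) :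
    PartialIso L (diag (spanSet cl B 𝒵) ∪ S) := by
  have hp := hM.pregeometry
  refine PartialIso.diag_union_of_finite fun d hd hdf => ?_
  have key : ∀ x ∈ d, ∃ F : Set M, F.Finite ∧ F ⊆ B ∧ x ∈ cl F ∧
      (F = {x} ∨ ∃ Z ∈ 𝒵, F ⊆ Z) := by
    intro x hx
    rcases hd hx with h | h
    · exact ⟨{x}, Set.finite_singleton x, by simpa, hp.mem_cl rfl, Or.inl rfl⟩
    · simp only [Set.mem_iUnion] at h
      obtain ⟨Z, hZ, hxZ⟩ := h
      obtain ⟨F, hF, hFZ, hxF⟩ := hp.finitary _ _ hxZ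
      exact ⟨F, hF, hFZ.trans (h𝒵 Z hZ), hxF, Or.inr ⟨Z, hZ, hFZ⟩⟩
  choose! F hF hFB hxF hFc using key
  -- The support of `d` outside `J` is moved into `T` over `cl J`. This takes `d` into `C` and
  -- leaves `S`, which lives in `cl J`, in place; so the wanted map is part of the conjugate of
  -- `diag C ∪ S` by the move.
  let W := (⋃ x ∈ d, F x) \ J
  obtain ⟨ι, g, hι, hgc, hgJ, hgW, hgd, hgr, hgF⟩ := hM.exists_mover (W := W) hB hJB hJ.countable
    (Set.sdiff_subset.trans (Set.iUnion₂_subset hFB)) ((hdf.biUnion hF).sdiff)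
    Set.disjoint_sdiff_left hTB (hT.sdiff hJ)
  have hFJW : ∀ x ∈ d, F x ⊆ J ∪ W := fun x hx y hy => by
    by_cases h : y ∈ J
    · exact Or.inl h
    · exact Or.inr ⟨Set.mem_biUnion hx hy, h⟩
  have hmove : ∀ x ∈ d, ∃ x' ∈ C, (x, x') ∈ g := by
    intro x hx
    obtain ⟨x', hx'⟩ := exists_of_mem_dom (R := g) (a := x) (by
      rw [hgd]; exact hp.cl_mono (hFJW x hx) (hxF x hx))
    refine ⟨x', ?_, hx'⟩
    rcases hFc x hx with h | ⟨Z, hZ, hFZ⟩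
    · rcases hFJW x hx (by rw [h]; rfl : x ∈ F x) with h1 | h1
      · rw [← hgc.iso.right_unique (hgJ (mem_diag (hp.mem_cl h1))) hx']
        exact hJC h1
      · rw [← hgc.iso.right_unique (hgW x h1) hx']
        exact hTC (hι h1).1
    · refine hC Z hZ (hp.cl_mono (Set.union_subset_union ?_ ?_) (hgF _ (hFJW x hx) _ _ hx' (hxF x hx)))
      · exact Set.inter_subset_inter_left _ hFZ
      · rintro _ ⟨w, hw, rfl⟩
        exact (hι hw.2).1
  have h1 : PartialIso L {p : M × M | ∃ c, (p.1, c) ∈ g ∧ (c, p.2) ∈ diag C ∪ S} :=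
    hgc.iso.comp hS fun a b h => h
  refine h1.comp hgc.iso.inv ?_
  rintro a b (⟨ha, rfl : a = b⟩ | h)
  · obtain ⟨a', ha'C, haa'⟩ := hmove a ha
    exact ⟨a', ⟨a', haa', Or.inl (mem_diag ha'C)⟩, haa'⟩
  · exact ⟨b, ⟨a, hgJ (mem_diag (hSd (mem_dom h))), Or.inr h⟩, hgJ (mem_diag (hSr (mem_ran h)))⟩

end IsQuasiminimalPregeometryStructure

omit hM in
variable (L cl) in

/-- Types over `D` of finite tuples are determined by finite subsets of `D`. -/
def Isolating (D : Set M) : Prop :=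
  ∀ V : Set M, V.Finite → ∃ c ⊆ D, c.Finite ∧ V ⊆ cl c ∧
    ∀ S : Set (M × M), dom S ⊆ V → PartialIso L (diag c ∪ S) → PartialIso L (diag D ∪ S)

namespace IsQuasiminimalPregeometryStructure

/-- A support `J ⊆ B` of `V` isolates: a partial map over `J` extends to an automorphism of `cl J`,
and the remaining elements of `B`, being independent over `cl J`, can be kept fixed. -/
theorem isolating_basis {B : Set M} (hB : IndepOver cl ∅ B) (hBs : cl B = Set.univ) :
    Isolating L cl B := by
  have hp := hM.pregeometry
  intro V hV
  obtain ⟨J, hJ, hJB, hVJ⟩ := hp.exists_finite_of_finite hV (S := B) (by simp [hBs])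
  refine ⟨J, hJB, hJ, hVJ, fun S hS hPS => PartialIso.diag_union_of_finite fun d hd hdf => ?_⟩
  have hSf : S.Finite := (hPS.mono Set.subset_union_right).finite_of_dom (hV.subset hS)
  obtain ⟨T, hT, hTc, hTd, hTr⟩ := hM.exists_closure (R := ∅) (S := diag J ∪ S) (Or.inr rfl)
    ((diag_finite hJ).union hSf) (by rwa [Set.empty_union])
  rw [Set.empty_union] at hT
  have hTd' : dom T = cl J := by
    rw [hTd]
    refine Set.Subset.antisymm (hp.cl_le ?_) (hp.cl_mono ?_)
    · rw [dom_union, dom_diag]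
      simp only [dom, Set.image_empty, Set.empty_union]
      exact Set.union_subset (hp.subset_cl _) (hS.trans hVJ)
    · rw [dom_union, dom_diag]; exact Set.subset_union_left.trans Set.subset_union_right
  have hTr' : ran T = cl J := by
    rw [hTr]
    refine Set.Subset.antisymm (hp.cl_le ?_) (hp.cl_mono ?_)
    · rw [ran_union, ran_diag]
      simp only [ran, Set.image_empty, Set.empty_union]
      refine Set.union_subset (hp.subset_cl _) ?_
      rintro _ ⟨⟨a, b⟩, h, rfl⟩
      have := hM.mem_cl_ran hTc.iso (S := diag J) (Set.subset_union_left.trans hT) (hT (Or.inr h))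
        (by rw [dom_diag]; exact hVJ (hS (mem_dom h)))
      rwa [ran_diag] at this
    · rw [ran_union, ran_diag]; exact Set.subset_union_left.trans Set.subset_union_right
  have hind : IndepOver cl (cl J) (d \ J) := (IndepOver.of_disjoint hp hB hJB
    (Set.sdiff_subset.trans hd) Set.disjoint_sdiff_left).cl_left hp
  obtain ⟨U, hU, hUc, -, -⟩ := hM.exists_closure_indep (S := diag (d \ J)) hTc
    (diag_finite hdf.sdiff) (by
      rintro ⟨a, b⟩ ⟨-, h⟩ ⟨a', b'⟩ ⟨-, h'⟩ e
      simp only at h h' e; subst h h' e; rfl) (by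
      rintro ⟨a, b⟩ ⟨-, h⟩ ⟨a', b'⟩ ⟨-, h'⟩ e
      simp only at h h' e; subst h h' e; rfl) (by rwa [hTd', dom_diag]) (by rwa [hTr', ran_diag])
  refine hUc.iso.mono ?_
  rintro ⟨a, b⟩ (⟨ha, rfl : a = b⟩ | h)
  · by_cases haJ : a ∈ J
    · exact hU (Or.inl (hT (Or.inl (mem_diag haJ))))
    · exact hU (Or.inr (mem_diag ⟨ha, haJ⟩))
  · exact hU (Or.inl (hT (Or.inr h)))

end IsQuasiminimalPregeometryStructure

/-- Over an isolating domain, partial isomorphisms extend one element at a time. -/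
theorem Isolating.exists_insert {R S : Set (M × M)} (hI : Isolating L cl (dom R)) (hS : S.Finite)
    (hRS : PartialIso L (R ∪ S)) (a : M) : ∃ a', PartialIso L (R ∪ insert (a, a') S) := by
  have hp := hM.pregeometry
  obtain ⟨c, hcR, hc, hVc, hiso⟩ := hI (insert a (dom S)) ((hS.image _).insert _)
  let Rc : Set (M × M) := {p ∈ R | p.1 ∈ c}
  have hRcd : dom Rc = c := by
    ext x; constructor
    · rintro ⟨p, hp, rfl⟩; exact hp.2
    · intro hx
      obtain ⟨y, hy⟩ := exists_of_mem_dom (hcR hx)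
      exact ⟨(x, y), ⟨hy, hx⟩, rfl⟩
  have hRcR : Rc ⊆ R := Set.sep_subset _ _
  have hRcf : Rc.Finite := (hRS.mono (hRcR.trans Set.subset_union_left)).finite_of_dom
    (by rwa [hRcd])
  obtain ⟨a', ha'⟩ := hM.exists_insert (R := ∅) (S := Rc ∪ S) (Or.inr rfl) (hRcf.union hS)
    (by rw [Set.empty_union]; exact hRS.mono (Set.union_subset_union_left _ hRcR)) (a := a)
    (by
      rw [dom_union, hRcd]
      exact hp.cl_mono (Set.subset_union_left.trans Set.subset_union_right)
        (hVc (Set.mem_insert _ _)))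
  rw [Set.empty_union, ← Set.union_insert] at ha'
  refine ⟨a', PartialIso.of_finite fun F hF hFf => ?_⟩
  let T := insert (a, a') S
  let R₁ : Set (M × M) := (F ∩ R) ∪ Rc
  have hR₁R : R₁ ⊆ R := Set.union_subset Set.inter_subset_right hRcR
  have hR₁ : PartialIso L R₁ := hRS.mono (hR₁R.trans Set.subset_union_left)
  -- Isolation compares tuples over the one set `dom R`. So the image tuple is carried back to the
  -- domain side by `U`, which extends the inverse of a finite part of `R`; `Sx` is the resulting
  -- map.
  obtain ⟨U, hU, hUc, hUd, -⟩ := hM.exists_closure (R := ∅) (S := inv R₁) (Or.inr rfl)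
    (finite_inv ((hFf.inter_of_left _).union hRcf)) (by rw [Set.empty_union]; exact hR₁.inv)
  rw [Set.empty_union] at hU
  have hTU : ∀ p ∈ T, p.2 ∈ dom U := by
    rintro ⟨x, y⟩ hxy
    rw [hUd, dom_inv]
    have := hM.mem_cl_ran (S := Rc) ha' Set.subset_union_left (Or.inr hxy) (by
      rw [hRcd]
      have : x ∈ dom T := mem_dom hxy
      rw [dom_insert] at this
      exact hVc this)
    exact hp.cl_mono ((ran_mono Set.subset_union_right).trans Set.subset_union_right) this
  let Sx : Set (M × M) := {p | ∃ v', (p.1, v') ∈ T ∧ (v', p.2) ∈ U}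
  have hSx : PartialIso L (diag (dom R) ∪ Sx) := by
    refine hiso Sx ?_ (ha'.comp hUc.iso ?_)
    · rintro _ ⟨⟨x, y⟩, ⟨v', h, -⟩, rfl⟩
      have : x ∈ dom T := mem_dom h
      rwa [dom_insert] at this
    · rintro x y (⟨hx, rfl : x = y⟩ | ⟨v', h1, h2⟩)
      · obtain ⟨z, hz⟩ := exists_of_mem_dom (hRcd.symm ▸ hx : x ∈ dom Rc)
        exact ⟨z, Or.inl hz, hU (Or.inr hz)⟩
      · exact ⟨v', Or.inr h1, h2⟩
  refine hSx.comp hUc.iso.inv ?_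
  intro x y hxy
  rcases hF hxy with h | h
  · exact ⟨x, Or.inl (mem_diag (mem_dom h)), hU (Or.inl ⟨hxy, h⟩)⟩
  · obtain ⟨v, hv⟩ := exists_of_mem_dom (hTU (x, y) h)
    exact ⟨v, Or.inr ⟨y, h, hv⟩, hv⟩

/-- `R` may be uncountable, but only the closures of a countable part `R₀` are added, so the
one-element extensions can be arranged in a back-and-forth. -/
theorem Isolating.exists_extend {R S R₀ : Set (M × M)} (hd : Isolating L cl (dom R))
    (hr : Isolating L cl (ran R)) (hS : S.Finite) (hRS : PartialIso L (R ∪ S)) (hR₀ : R₀ ⊆ R)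
    (hR₀c : R₀.Countable) :
    ∃ T, S ⊆ T ∧ PartialIso L (R ∪ T) ∧ cl (dom R₀) ⊆ dom T ∧ cl (ran R₀) ⊆ ran T ∧
      T ⊆ S ∪ cl (dom R₀) ×ˢ cl (ran R₀) := by
  refine back_and_forth (hM.countable_cl (hR₀c.image _)) (hM.countable_cl (hR₀c.image _)) hS hRS
    ?_ ?_
  · intro S' hS' _ hP a ha
    obtain ⟨a', ha'⟩ := Isolating.exists_insert hM hd hS' hP a
    exact ⟨a', hM.mem_cl_ran ha' (hR₀.trans Set.subset_union_left)
      (Or.inr (Set.mem_insert _ _)) ha, ha'⟩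
  · intro S' hS' _ hP a' ha'
    obtain ⟨a, ha⟩ := Isolating.exists_insert hM (R := inv R) (S := inv S') (by rwa [dom_inv])
      (finite_inv hS') hP.inv a'
    have ha2 : PartialIso L (R ∪ insert (a, a') S') := by
      have := ha.inv
      rwa [inv_union, inv_insert, inv_inv, inv_inv] at this
    exact ⟨a, (hM.mem_cl_iff ha2 (hR₀.trans Set.subset_union_left)
      (Or.inr (Set.mem_insert _ _))).2 ha', ha2⟩

end Coheir

/-! ### Finite isolation over arbitrary span sets. -/

section Isolation

variable {L : FirstOrder.Language} {M : Type*} [L.Structure M] {cl : Set M → Set M}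

variable (L cl) in

/-- `π` is an automorphism of the closed set `E` that is the identity on `D ∩ E`. -/
structure AutFixing (D E : Set M) (π : Set (M × M)) : Prop where
  iso : PartialIso L π
  dom_eq : dom π = E
  ran_eq : ran π = E
  fixes : ∀ x ∈ D, x ∈ E → (x, x) ∈ π

/-- The part of the `spanSet` that is supported in `J`. -/
def localSpan (cl : Set M → Set M) (J : Set M) (𝒵 : Set (Set M)) : Set M :=
  J ∪ ⋃ Z ∈ 𝒵, cl (J ∩ Z)

variable (hM : IsQuasiminimalPregeometryStructure L cl)
include hM

namespace IsQuasiminimalPregeometryStructure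

theorem localSpan_mono {J J' : Set M} (h : J ⊆ J') (𝒵 : Set (Set M)) :
    localSpan cl J 𝒵 ⊆ localSpan cl J' 𝒵 :=
  Set.union_subset_union h (Set.iUnion₂_mono fun _ _ =>
    hM.pregeometry.cl_mono (Set.inter_subset_inter_left _ h))

/-- Moving `J \ Z₀` into `I` over `cl (J ∩ Z₀)` carries `cl J` into `cl Z₀`, where `π` acts; the
required map is `π` conjugated by this move. As every `Z ∈ 𝒵` contains `I`, points of the local span
land in the span set, where `π` is the identity. -/
theorem exists_pullback_local {B I J Z₀ V : Set M} {𝒵 : Set (Set M)} {π : Set (M × M)}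
    (hB : IndepOver cl ∅ B) (hIB : I ⊆ B) (h𝒵 : ∀ Z ∈ 𝒵, I ⊆ Z)
    (hIZ₀ : I ⊆ Z₀) (hZ₀ : Z₀ ⊆ B) (hπ : AutFixing L (spanSet cl B 𝒵) (cl Z₀) π)
    (hJB : J ⊆ B) (hJ : J.Countable) (hJZ : (J \ Z₀).Finite) (hIJ : (I \ J).Infinite)
    (hV : V ⊆ cl J) :
    ∃ S : Set (M × M), ran S = V ∧
      PartialIso L (S ∪ (diag (localSpan cl J 𝒵) ∪ {p ∈ π | p.1 ∈ cl (J ∩ Z₀)})) := by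
  have hp := hM.pregeometry
  obtain ⟨ι, g, hι, hgc, hgJ, hgW, hgd, hgr, hgF⟩ := hM.exists_mover (J := J ∩ Z₀) (W := J \ Z₀)
    (T := I) hB (Set.inter_subset_left.trans hJB) (hJ.mono Set.inter_subset_left)
    (Set.sdiff_subset.trans hJB) hJZ
    (Set.disjoint_of_subset_right Set.inter_subset_right Set.disjoint_sdiff_left) hIB
    (hIJ.mono (Set.sdiff_subset_sdiff_right Set.inter_subset_left))
  rw [Set.inter_union_sdiff] at hgd
  -- `π` fixes `Z₀` pointwise, so it preserves the closure of each subset of `Z₀`.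
  have hπZ : ∀ K ⊆ Z₀, ∀ x y, (x, y) ∈ π → (x ∈ cl K ↔ y ∈ cl K) := by
    intro K hK x y hxy
    have hsub : diag K ⊆ π := by
      rintro ⟨a, b⟩ ⟨ha, rfl : a = b⟩
      exact hπ.fixes a (subset_spanSet _ _ (hZ₀ (hK ha))) (hp.mem_cl (hK ha))
    have := hM.mem_cl_iff hπ.iso hsub hxy
    rwa [dom_diag, ran_diag] at this
  have hK₀ : J ∩ Z₀ ∪ ι '' (J \ Z₀) ⊆ Z₀ := by
    refine Set.union_subset Set.inter_subset_right ?_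
    rintro _ ⟨w, hw, rfl⟩
    exact hIZ₀ (hι hw).1
  let S : Set (M × M) := {p | p.2 ∈ V ∧ ∃ b c, (p.1, b) ∈ g ∧ (b, c) ∈ π ∧ (p.2, c) ∈ g}
  refine ⟨S, ?_, ?_⟩
  · refine Set.Subset.antisymm (by rintro _ ⟨p, hp, rfl⟩; exact hp.1) fun a ha => ?_
    obtain ⟨c, hc⟩ := exists_of_mem_dom (hgd.symm ▸ hV ha : a ∈ dom g)
    have hcr : c ∈ cl (J ∩ Z₀ ∪ ι '' (J \ Z₀)) := hgr ▸ mem_ran hc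
    obtain ⟨b, hb⟩ := exists_of_mem_ran (hπ.ran_eq.symm ▸ hp.cl_mono hK₀ hcr : c ∈ ran π)
    obtain ⟨x, hx⟩ := exists_of_mem_ran (R := g) (b := b)
      (by rw [hgr]; exact (hπZ _ hK₀ _ _ hb).2 hcr)
    exact ⟨(x, a), ⟨ha, b, c, hx, hb, hc⟩, rfl⟩
  · have h1 : PartialIso L {p : M × M | ∃ c, (p.1, c) ∈ g ∧ (c, p.2) ∈ π} :=
      hgc.iso.comp hπ.iso fun a b h => h
    refine h1.comp hgc.iso.inv ?_
    rintro x y (⟨-, b, c, h1, h2, h3⟩ | ⟨hx, rfl : x = y⟩ | ⟨hxy, hx⟩)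
    · exact ⟨c, ⟨b, h1, h2⟩, h3⟩
    · suffices ∃ x', (x, x') ∈ g ∧ x' ∈ spanSet cl B 𝒵 ∧ x' ∈ cl Z₀ by
        obtain ⟨x', h1, h2, h3⟩ := this
        exact ⟨x', ⟨x', h1, hπ.fixes x' h2 h3⟩, h1⟩
      rcases hx with hx | hx
      · by_cases hxZ : x ∈ Z₀
        · exact ⟨x, hgJ (mem_diag (hp.mem_cl ⟨hx, hxZ⟩)), subset_spanSet _ _ (hJB hx),
            hp.mem_cl hxZ⟩
        · have := (hι ⟨hx, hxZ⟩).1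
          exact ⟨ι x, hgW x ⟨hx, hxZ⟩, subset_spanSet _ _ (hIB this), hp.mem_cl (hIZ₀ this)⟩
      · simp only [Set.mem_iUnion] at hx
        obtain ⟨Z, hZ, hxZ⟩ := hx
        obtain ⟨x', hx'⟩ := exists_of_mem_dom (R := g) (a := x) (by
          rw [hgd]; exact hp.cl_mono Set.inter_subset_left hxZ)
        have := hgF (J ∩ Z) (by rw [Set.inter_union_sdiff]; exact Set.inter_subset_left) _ _ hx' hxZ
        have hsub : J ∩ Z ∩ (J ∩ Z₀) ∪ ι '' (J ∩ Z ∩ (J \ Z₀)) ⊆ Z ∩ Z₀ := by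
          refine Set.union_subset (fun a ha => ⟨ha.1.2, ha.2.2⟩) ?_
          rintro _ ⟨w, hw, rfl⟩
          have := (hι hw.2).1
          exact ⟨h𝒵 Z hZ this, hIZ₀ this⟩
        have := hp.cl_mono hsub this
        exact ⟨x', hx', cl_subset_spanSet hZ (hp.cl_mono Set.inter_subset_left this),
          hp.cl_mono Set.inter_subset_right this⟩
    · simp only at hx
      refine ⟨y, ⟨x, hgJ (mem_diag hx), hxy⟩, hgJ (mem_diag ?_)⟩
      exact (hπZ _ Set.inter_subset_right _ _ hxy).1 hx

/-- An automorphism of `cl Z₀` over `D ∩ cl Z₀` pulls back the type of a finite tuple `V` over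
`D ∪ cl Z₀` to a type that is realized. -/
theorem exists_pullback {B I Z₀ V Ja : Set M} {𝒵 : Set (Set M)} {π : Set (M × M)}
    (hB : IndepOver cl ∅ B) (hIB : I ⊆ B) (hI : I.Countable) (hIinf : I.Infinite)
    (h𝒵 : ∀ Z ∈ 𝒵, I ⊆ Z)
    (h𝒵B : ∀ Z ∈ 𝒵, Z ⊆ B) (hIZ₀ : I ⊆ Z₀) (hZ₀ : Z₀ ⊆ B)
    (hπ : AutFixing L (spanSet cl B 𝒵) (cl Z₀) π)
    (hJaB : Ja ⊆ B) (hJa : Ja.Finite) (hV : V ⊆ cl Ja) :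
    ∃ S : Set (M × M), dom S ⊆ cl Ja ∧ ran S = V ∧
      PartialIso L (S ∪ (diag (spanSet cl B 𝒵) ∪ π)) := by
  have hp := hM.pregeometry
  -- `I₀` is put into every `J` and provides the room for the coheir argument; `I₁` stays free for
  -- the moves in the local version.
  obtain ⟨I₀, I₁, hI01, hdisj, hcard⟩ := hIinf.exists_union_disjoint_cardinal_eq_of_infinite
  have hinf : I₀.Infinite ∧ I₁.Infinite := by
    have h : I₀.Infinite ∨ I₁.Infinite := by
      rw [← Set.infinite_union, hI01]; exact hIinf
    have hiff : I₀.Infinite ↔ I₁.Infinite := by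
      rw [← Set.infinite_coe_iff, ← Set.infinite_coe_iff, Cardinal.infinite_iff,
        Cardinal.infinite_iff, hcard]
    tauto
  have hI₀I : I₀ ⊆ I := hI01 ▸ Set.subset_union_left
  have hloc : ∀ F : Set M, F ⊆ B → F.Finite → ∃ S : Set (M × M), ran S = V ∧
      PartialIso L (S ∪ (diag (localSpan cl (Ja ∪ I₀ ∪ F) 𝒵) ∪
        {p ∈ π | p.1 ∈ cl ((Ja ∪ I₀ ∪ F) ∩ Z₀)})) := by
    intro F hFB hF
    refine hM.exists_pullback_local hB hIB h𝒵 hIZ₀ hZ₀ hπ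
      (Set.union_subset (Set.union_subset hJaB (hI₀I.trans hIB)) hFB)
      ((hJa.countable.union (hI.mono hI₀I)).union hF.countable) ?_ ?_
      (hV.trans (hp.cl_mono (Set.subset_union_left.trans Set.subset_union_left)))
    · refine (hJa.union hF).subset ?_
      rintro x ⟨(h | h) | h, hx⟩
      · exact Or.inl h
      · exact absurd (hIZ₀ (hI₀I h)) hx
      · exact Or.inr h
    · refine (hinf.2.sdiff (hJa.union hF)).mono ?_
      rintro x ⟨hx, hx'⟩
      refine ⟨hI01 ▸ Or.inr hx, ?_⟩
      rintro ((h | h) | h)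
      · exact hx' (Or.inl h)
      · exact hdisj.notMem_of_mem_left h hx
      · exact hx' (Or.inr h)
  have hdomS : ∀ (F : Set M) (S : Set (M × M)), ran S = V →
      PartialIso L (S ∪ (diag (localSpan cl (Ja ∪ I₀ ∪ F) 𝒵) ∪
        {p ∈ π | p.1 ∈ cl ((Ja ∪ I₀ ∪ F) ∩ Z₀)})) → dom S ⊆ cl Ja := by
    rintro F S hSV hS _ ⟨⟨x, y⟩, hxy, rfl⟩
    have := (hM.mem_cl_iff hS (S := diag Ja) (fun p hp => Or.inr (Or.inl
      ⟨Or.inl (Or.inl (Or.inl hp.1)), hp.2⟩)) (Or.inl hxy)).2 (by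
        rw [ran_diag]; exact hV (hSV ▸ mem_ran hxy))
    rwa [dom_diag] at this
  -- The solution for `F = ∅` works globally: a solution `S'` for a larger `F` agrees with it in
  -- type over the small set `C` below, hence over the whole span set by `partialIso_of_coheir`.
  obtain ⟨S, hSV, hS⟩ := hloc ∅ (Set.empty_subset _) Set.finite_empty
  have hSd := hdomS ∅ S hSV hS
  refine ⟨S, hSd, hSV, PartialIso.of_finite fun F₀ hF₀ hF₀f => ?_⟩
  have hsupp : ∀ p ∈ F₀, ∃ F : Set M, F.Finite ∧ F ⊆ B ∧ ∀ J, F ⊆ J →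
      p ∈ S ∪ (diag (localSpan cl J 𝒵) ∪ {p ∈ π | p.1 ∈ cl (J ∩ Z₀)}) := by
    rintro ⟨x, y⟩ hxy
    rcases hF₀ hxy with h | ⟨h | h, rfl : x = y⟩ | h
    · exact ⟨∅, Set.finite_empty, Set.empty_subset _, fun J _ => Or.inl h⟩
    · exact ⟨{x}, Set.finite_singleton x, by simpa using h, fun J hJ => Or.inr (Or.inl
        (mem_diag (Or.inl (hJ rfl))))⟩
    · simp only [Set.mem_iUnion] at h
      obtain ⟨Z, hZ, hxZ⟩ := h
      obtain ⟨F, hF, hFZ, hxF⟩ := hp.finitary _ _ hxZ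
      exact ⟨F, hF, hFZ.trans (h𝒵B Z hZ), fun J hJ => Or.inr (Or.inl (mem_diag (Or.inr
        (Set.mem_biUnion hZ (hp.cl_mono (Set.subset_inter hJ hFZ) hxF)))))⟩
    · obtain ⟨F, hF, hFZ, hxF⟩ := hp.finitary _ _ (hπ.dom_eq ▸ mem_dom h : x ∈ cl Z₀)
      exact ⟨F, hF, hFZ.trans hZ₀, fun J hJ => Or.inr (Or.inr
        ⟨h, hp.cl_mono (Set.subset_inter hJ hFZ) hxF⟩)⟩
  choose! Fs hFs hFsB hFsJ using hsupp
  let F := ⋃ p ∈ F₀, Fs p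
  obtain ⟨S', hS'V, hS'⟩ := hloc F (Set.iUnion₂_subset hFsB) (hF₀f.biUnion hFs)
  have hS'd := hdomS F S' hS'V hS'
  let J₀ := Ja ∪ I₀ ∪ ∅
  let J := Ja ∪ I₀ ∪ F
  have hJ₀J : J₀ ⊆ J := Set.union_subset_union_right _ (Set.empty_subset _)
  let U : Set (M × M) := {p | ∃ a, (p.1, a) ∈ S ∧ (p.2, a) ∈ S'}
  let C := localSpan cl J₀ 𝒵 ∪ cl (J₀ ∩ Z₀)
  have hU : PartialIso L (diag C ∪ U) := by
    refine hS.comp hS'.inv ?_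
    rintro x y (⟨hx | hx, rfl : x = y⟩ | ⟨a, h1, h2⟩)
    · exact ⟨x, Or.inr (Or.inl (mem_diag hx)), Or.inr (Or.inl (mem_diag
        (hM.localSpan_mono hJ₀J _ hx)))⟩
    · obtain ⟨z, hz⟩ := exists_of_mem_dom
        (hπ.dom_eq.symm ▸ hp.cl_mono Set.inter_subset_right hx : x ∈ dom π)
      exact ⟨z, Or.inr (Or.inr ⟨hz, hx⟩), Or.inr (Or.inr ⟨hz, hp.cl_mono
        (Set.inter_subset_inter_left _ hJ₀J) hx⟩)⟩
    · exact ⟨a, Or.inl h1, Or.inl h2⟩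
  have hU' := hM.partialIso_of_coheir (𝒵 := insert Z₀ 𝒵) (S := U) (C := C) (T := I₀) hB hJaB hJa
    (hI₀I.trans hIB) hinf.1 (by
      rintro Z (rfl | hZ)
      · exact hZ₀
      · exact h𝒵B Z hZ)
    (by rintro _ ⟨⟨x, y⟩, ⟨a, h1, -⟩, rfl⟩; exact hSd (mem_dom h1))
    (by rintro _ ⟨⟨x, y⟩, ⟨a, -, h2⟩, rfl⟩; exact hS'd (mem_dom h2))
    (fun x hx => Or.inl (Or.inl (Or.inl (Or.inl hx))))
    (fun x hx => Or.inl (Or.inl (Or.inl (Or.inr hx)))) (by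
      have hsub : ∀ Z, I ⊆ Z → Z ∩ Ja ∪ I₀ ⊆ J₀ ∩ Z := fun Z hIZ =>
        Set.union_subset (fun x hx => ⟨Or.inl (Or.inl hx.2), hx.1⟩)
          (fun x hx => ⟨Or.inl (Or.inr hx), hIZ (hI₀I hx)⟩)
      rintro Z (rfl | hZ) x hx
      · exact Or.inr (hp.cl_mono (hsub _ hIZ₀) hx)
      · exact Or.inl (Or.inr (Set.mem_biUnion hZ (hp.cl_mono (hsub _ (h𝒵 Z hZ)) hx)))) hU
  refine hU'.comp hS' ?_
  intro x y hxy
  rw [spanSet_insert]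
  rcases hFsJ (x, y) hxy J ((Set.subset_biUnion_of_mem hxy).trans Set.subset_union_right) with
    h | h | h
  · obtain ⟨z, hz⟩ := exists_of_mem_ran (hS'V.symm ▸ hSV ▸ mem_ran h : y ∈ ran S')
    exact ⟨z, Or.inr ⟨y, h, hz⟩, Or.inl hz⟩
  · refine ⟨x, Or.inl (mem_diag (Or.inl ?_)), Or.inr (Or.inl h)⟩
    rcases h.1 with h1 | h1
    · refine Or.inl ?_
      rcases h1 with (h1 | h1) | h1
      · exact hJaB h1
      · exact hIB (hI₀I h1)
      · exact Set.iUnion₂_subset hFsB h1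
    · simp only [Set.mem_iUnion] at h1
      obtain ⟨Z, hZ, hxZ⟩ := h1
      exact cl_subset_spanSet hZ (hp.cl_mono Set.inter_subset_right hxZ)
  · exact ⟨x, Or.inl (mem_diag (Or.inr (hπ.dom_eq ▸ mem_dom h.1))), Or.inr (Or.inr h)⟩

end IsQuasiminimalPregeometryStructure

omit hM in
/-- The graph of a permutation of a subset. -/
def graphOn {E : Set M} (σ : Equiv.Perm E) : Set (M × M) := Set.range fun x : E => ((x : M), (σ x : M))

omit hM in
theorem AutFixing.exists_perm {D E : Set M} {π : Set (M × M)} (hπ : AutFixing L D E π) :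
    ∃ σ : Equiv.Perm E, graphOn σ = π := by
  choose f hf using fun x : E => exists_of_mem_dom (hπ.dom_eq.symm ▸ x.2 : (x : M) ∈ dom π)
  choose g hg using fun x : E => exists_of_mem_ran (hπ.ran_eq.symm ▸ x.2 : (x : M) ∈ ran π)
  have hfE : ∀ x, f x ∈ E := fun x => hπ.ran_eq ▸ mem_ran (hf x)
  have hgE : ∀ x, g x ∈ E := fun x => hπ.dom_eq ▸ mem_dom (hg x)
  refine ⟨⟨fun x => ⟨f x, hfE x⟩, fun x => ⟨g x, hgE x⟩, fun x => ?_, fun x => ?_⟩, ?_⟩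
  · exact Subtype.ext (hπ.iso.left_unique (hg _) (hf x))
  · exact Subtype.ext (hπ.iso.right_unique (hf _) (hg x))
  · ext ⟨x, y⟩
    constructor
    · rintro ⟨x, h⟩
      obtain ⟨rfl, rfl⟩ := Prod.mk.inj h
      exact hf x
    · intro h
      refine ⟨⟨x, hπ.dom_eq ▸ mem_dom h⟩, Prod.ext rfl ?_⟩
      exact hπ.iso.right_unique (hf _) h

omit hM in
theorem isPointwiseClosed_partialIso {E : Set M} (S : Set (M × M)) :
    IsPointwiseClosed {σ : Equiv.Perm E | PartialIso L (S ∪ graphOn σ)} := by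
  intro σ hσ
  refine PartialIso.of_finite fun F hF hFf => ?_
  obtain ⟨τ, hτ, h⟩ := hσ {x : E | (x : M) ∈ dom F}
    ((hFf.image Prod.fst).preimage Subtype.val_injective.injOn)
  refine PartialIso.mono hτ fun p hp => ?_
  rcases hF hp with h1 | ⟨x, rfl⟩
  · exact Or.inl h1
  · exact Or.inr ⟨x, by simp only; rw [h x (mem_dom hp)]⟩

namespace IsQuasiminimalPregeometryStructure

/-- The type of a finite tuple `V` over `D ∪ cl Z₀` does not change under automorphisms of
`cl Z₀` that fix `D ∩ cl Z₀` and a suitable finite set. -/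
theorem exists_finite_stabilizer {B I Z₀ V : Set M} {𝒵 : Set (Set M)}
    (hB : IndepOver cl ∅ B) (hBs : cl B = Set.univ) (hIB : I ⊆ B) (hI : I.Countable)
    (hIinf : I.Infinite) (h𝒵 : ∀ Z ∈ 𝒵, I ⊆ Z) (h𝒵B : ∀ Z ∈ 𝒵, Z ⊆ B) (hIZ₀ : I ⊆ Z₀)
    (hZ₀ : Z₀ ⊆ B) (hZ₀c : Z₀.Countable) (hV : V.Finite) :
    ∃ e ⊆ cl Z₀, e.Finite ∧ ∀ π, AutFixing L (spanSet cl B 𝒵) (cl Z₀) π → (∀ x ∈ e, (x, x) ∈ π) →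
      PartialIso L (diag V ∪ (diag (spanSet cl B 𝒵) ∪ π)) := by
  have hp := hM.pregeometry
  set D := spanSet cl B 𝒵
  obtain ⟨Ja, hJa, hJaB, hVJ⟩ := hp.exists_finite_of_finite hV (S := B) (by simp [hBs])
  have := (hM.countable_cl hZ₀c).to_subtype
  have := (hM.qm3 Ja hJa).to_subtype
  have := hV.to_subtype
  have hfix1 : AutFixing L D (cl Z₀) (diag (cl Z₀)) :=
    ⟨PartialIso.diag _, dom_diag _, ran_diag _, fun x _ hx => mem_diag hx⟩
  let Q : Set (Equiv.Perm (cl Z₀)) := {σ | AutFixing L D (cl Z₀) (graphOn σ)}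
  -- `A z` is the set of `σ` for which `z` realizes the pullback of the type of `V`. There are
  -- countably many `z`, and `exists_pullback` makes the closed sets `A z` cover `Q`, so Baire
  -- category applies.
  let G : (V → cl Ja) → Set (M × M) := fun z => Set.range fun v : V => ((z v : M), (v : M))
  let A : (V → cl Ja) → Set (Equiv.Perm (cl Z₀)) := fun z =>
    {σ | PartialIso L (G z ∪ diag D ∪ graphOn σ)}
  have hgd : ∀ σ : Equiv.Perm (cl Z₀), dom (graphOn σ) = cl Z₀ := by
    intro σ; rw [dom, graphOn, ← Set.range_comp]; exact Subtype.range_coe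
  have hgr : ∀ σ : Equiv.Perm (cl Z₀), ran (graphOn σ) = cl Z₀ := by
    intro σ
    have : ran (graphOn σ) = Set.range (Subtype.val ∘ σ) := by
      rw [ran, graphOn, ← Set.range_comp]; rfl
    rw [this, σ.surjective.range_comp, Subtype.range_coe]
  obtain ⟨z, σ₀, hσ₀, F, hF, hstab⟩ := exists_stable_of_countable_cover (Q := Q) (A := A) (by
      obtain ⟨σ, hσ⟩ := hfix1.exists_perm
      exact ⟨σ, by show AutFixing L D (cl Z₀) (graphOn σ); rw [hσ]; exact hfix1⟩) (by
      intro σ hσ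
      refine ⟨?_, hgd σ, hgr σ, ?_⟩
      · have := isPointwiseClosed_partialIso (L := L) (∅ : Set (M × M)) σ (fun F hF => by
          obtain ⟨τ, hτ, h⟩ := hσ F hF
          exact ⟨τ, by simpa using hτ.iso, h⟩)
        simpa using this
      · intro x hx hxE
        obtain ⟨τ, hτ, h⟩ := hσ {⟨x, hxE⟩} (Set.finite_singleton _)
        obtain ⟨y, hy⟩ := hτ.fixes x hx hxE
        obtain ⟨h1, h2⟩ := Prod.mk.inj hy
        have hyx : y = ⟨x, hxE⟩ := Subtype.ext h1
        subst hyx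
        rw [h _ rfl] at h2
        exact ⟨⟨x, hxE⟩, Prod.ext rfl h2⟩)
    (fun z => isPointwiseClosed_partialIso _) (by
      intro σ hσ
      obtain ⟨S, hSd, hSV, hS⟩ := hM.exists_pullback hB hIB hI hIinf h𝒵 h𝒵B hIZ₀ hZ₀ hσ hJaB hJa hVJ
      choose z hz using fun v : V => exists_of_mem_ran (hSV.symm ▸ v.2 : (v : M) ∈ ran S)
      refine Set.mem_iUnion.2 ⟨fun v => ⟨z v, hSd (mem_dom (hz v))⟩, hS.mono ?_⟩
      rw [Set.union_assoc]
      refine Set.union_subset_union_left _ ?_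
      rintro _ ⟨v, rfl⟩
      exact hz v)
  -- If `π` fixes `σ₀ '' F`, then `σ₀` and `σ₀` followed by `π` agree on `F`, so the same `z` serves
  -- both; dividing one by the other leaves `V` fixed and `π` acting.
  refine ⟨(fun x => (σ₀ x : M)) '' F, by rintro _ ⟨x, -, rfl⟩; exact (σ₀ x).2, hF.image _, ?_⟩
  intro π hπ hfix
  obtain ⟨τ, rfl⟩ := hπ.exists_perm
  have h₀ : PartialIso L (G z ∪ diag D ∪ graphOn σ₀) := hstab σ₀ hσ₀ fun _ _ => rfl
  have hτF : ∀ x ∈ F, τ (σ₀ x) = σ₀ x := by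
    intro x hx
    obtain ⟨y, hy⟩ := hfix _ ⟨x, hx, rfl⟩
    obtain ⟨h1, h2⟩ := Prod.mk.inj hy
    rw [Subtype.ext h1] at h2
    exact Subtype.ext h2
  have h₁ : PartialIso L (G z ∪ diag D ∪ graphOn (σ₀.trans τ)) := by
    refine hstab _ ⟨hσ₀.iso.comp hπ.iso ?_, hgd _, hgr _, ?_⟩ (fun x hx => hτF x hx)
    · rintro a b ⟨x, hx⟩
      obtain ⟨rfl, rfl⟩ := Prod.mk.inj hx
      exact ⟨_, ⟨x, rfl⟩, ⟨σ₀ x, rfl⟩⟩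
    · intro x hx hxE
      obtain ⟨y, hy⟩ := hσ₀.fixes x hx hxE
      obtain ⟨y', hy'⟩ := hπ.fixes x hx hxE
      obtain ⟨h1, h2⟩ := Prod.mk.inj hy
      obtain ⟨h3, h4⟩ := Prod.mk.inj hy'
      refine ⟨y, Prod.ext h1 ?_⟩
      have : σ₀ y = y' := Subtype.ext (h2.trans h3.symm)
      show ((τ (σ₀ y) : cl Z₀) : M) = x
      rw [this, h4]
  refine h₀.inv.comp h₁ ?_
  rintro x y (⟨hx, rfl : x = y⟩ | ⟨hx, rfl : x = y⟩ | ⟨w, hw⟩)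
  · exact ⟨z ⟨x, hx⟩, Or.inl (Or.inl ⟨⟨x, hx⟩, rfl⟩), Or.inl (Or.inl ⟨⟨x, hx⟩, rfl⟩)⟩
  · exact ⟨x, Or.inl (Or.inr (mem_diag hx)), Or.inl (Or.inr (mem_diag hx))⟩
  · obtain ⟨rfl, rfl⟩ := Prod.mk.inj hw
    exact ⟨σ₀.symm w, Or.inr ⟨σ₀.symm w, by simp⟩, Or.inr ⟨σ₀.symm w, by simp⟩⟩

/-- Isolation over `D` lifts `S` to a map over `D`, which extends along `cl Z₀` and induces there an
automorphism `π`. Since `S` was tested over the finite set `e` as well, `π` fixes `e` and can be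
undone without disturbing `V`. -/
theorem isolating_insert {B I Z₀ : Set M} {𝒵 : Set (Set M)}
    (hB : IndepOver cl ∅ B) (hBs : cl B = Set.univ) (hIB : I ⊆ B) (hI : I.Countable)
    (hIinf : I.Infinite) (h𝒵 : ∀ Z ∈ 𝒵, I ⊆ Z) (h𝒵B : ∀ Z ∈ 𝒵, Z ⊆ B) (hIZ₀ : I ⊆ Z₀)
    (hZ₀ : Z₀ ⊆ B) (hZ₀c : Z₀.Countable) (hiso : Isolating L cl (spanSet cl B 𝒵)) :
    Isolating L cl (spanSet cl B (insert Z₀ 𝒵)) := by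
  have hp := hM.pregeometry
  intro V hV
  rw [spanSet_insert]
  set D := spanSet cl B 𝒵 with hD
  obtain ⟨e, heZ, he, hstab⟩ := hM.exists_finite_stabilizer hB hBs hIB hI hIinf h𝒵 h𝒵B hIZ₀ hZ₀
    hZ₀c hV
  obtain ⟨c, hcD, hc, hVc, hciso⟩ := hiso (V ∪ e) (hV.union he)
  refine ⟨c ∪ e, Set.union_subset_union hcD heZ, hc.union he,
    (Set.subset_union_left.trans hVc).trans (hp.cl_mono Set.subset_union_left), ?_⟩
  intro S hSV hS
  have hSf : S.Finite := (hS.mono Set.subset_union_right).finite_of_dom (hV.subset hSV)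
  have h1 : PartialIso L (diag D ∪ (S ∪ diag e)) := by
    refine hciso _ ?_ (hS.mono ?_)
    · rw [dom_union, dom_diag]; exact Set.union_subset_union_left _ hSV
    · rintro p (h | h | h)
      · exact Or.inl ⟨Or.inl h.1, h.2⟩
      · exact Or.inr h
      · exact Or.inl ⟨Or.inr h.1, h.2⟩
  have hZ₀D : Z₀ ⊆ D := hZ₀.trans (subset_spanSet _ _)
  obtain ⟨T, hST, hT, hTd, hTr, -⟩ := Isolating.exists_extend hM (R := diag D) (R₀ := diag Z₀)
    (by rwa [dom_diag]) (by rwa [ran_diag]) (hSf.union (diag_finite he)) h1 (diag_mono hZ₀D)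
    ((PartialIso.diag (L := L) Z₀).countable_of_dom (by rwa [dom_diag]))
  rw [dom_diag] at hTd
  rw [ran_diag] at hTr
  have hTcl : ∀ x y, (x, y) ∈ T → (x ∈ cl Z₀ ↔ y ∈ cl Z₀) := by
    intro x y hxy
    have := hM.mem_cl_iff hT (S := diag Z₀) ((diag_mono hZ₀D).trans Set.subset_union_left)
      (Or.inr hxy)
    rwa [dom_diag, ran_diag] at this
  let π : Set (M × M) := {p ∈ T | p.1 ∈ cl Z₀}
  have hπ : AutFixing L D (cl Z₀) π := by
    refine ⟨hT.mono ((Set.sep_subset _ _).trans Set.subset_union_right), ?_, ?_, ?_⟩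
    · refine Set.Subset.antisymm (by rintro _ ⟨p, hp, rfl⟩; exact hp.2) fun x hx => ?_
      obtain ⟨y, hy⟩ := exists_of_mem_dom (hTd hx)
      exact ⟨_, ⟨hy, hx⟩, rfl⟩
    · refine Set.Subset.antisymm ?_ fun y hy => ?_
      · rintro _ ⟨⟨x, y⟩, hxy, rfl⟩; exact (hTcl x y hxy.1).1 hxy.2
      · obtain ⟨x, hx⟩ := exists_of_mem_ran (hTr hy)
        exact ⟨_, ⟨hx, (hTcl x y hx).2 hy⟩, rfl⟩
    · intro x hxD hx
      obtain ⟨y, hy⟩ := exists_of_mem_dom (hTd hx)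
      have : x = y := hT.right_unique (Or.inl (mem_diag hxD)) (Or.inr hy)
      subst this
      exact ⟨hy, hx⟩
  have h2 := hstab π hπ fun x hx => ⟨hST (Or.inr (mem_diag hx)), heZ hx⟩
  refine h2.inv.comp hT ?_
  rintro x y (⟨hx | hx, rfl : x = y⟩ | h)
  · exact ⟨x, Or.inr (Or.inl (mem_diag hx)), Or.inl (mem_diag hx)⟩
  · obtain ⟨w, hw⟩ := exists_of_mem_ran (hπ.ran_eq.symm ▸ hx : x ∈ ran π)
    exact ⟨w, Or.inr (Or.inr hw), Or.inr hw.1⟩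
  · exact ⟨x, Or.inl (mem_diag (hSV (mem_dom h))), Or.inr (hST (Or.inl h))⟩

/-- Types of finite tuples over arbitrary unions of closures are determined by finite subsets. -/
theorem isolating_spanSet {B I : Set M} {𝒵 : Set (Set M)}
    (hB : IndepOver cl ∅ B) (hBs : cl B = Set.univ) (hIB : I ⊆ B) (hI : I.Countable)
    (hIinf : I.Infinite) (h𝒵 : ∀ Z ∈ 𝒵, I ⊆ Z) (h𝒵B : ∀ Z ∈ 𝒵, Z ⊆ B) :
    Isolating L cl (spanSet cl B 𝒵) := by
  have hp := hM.pregeometry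
  have hfin : ∀ 𝒴 : Set (Set M), 𝒴.Finite → (∀ Z ∈ 𝒴, I ⊆ Z ∧ Z ⊆ B ∧ Z.Countable) →
      Isolating L cl (spanSet cl B 𝒴) := by
    intro 𝒴 h𝒴
    induction 𝒴, h𝒴 using Set.Finite.induction_on with
    | empty => intro _; simpa [spanSet] using hM.isolating_basis hB hBs
    | @insert Z 𝒴 _ _ ih =>
      intro h
      have hZ := h Z (Set.mem_insert _ _)
      have h𝒴 := fun Y hY => h Y (Set.mem_insert_of_mem _ hY)
      exact hM.isolating_insert hB hBs hIB hI hIinf (fun Y hY => (h𝒴 Y hY).1)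
        (fun Y hY => (h𝒴 Y hY).2.1) hZ.1 hZ.2.1 hZ.2.2 (ih h𝒴)
  intro V hV
  obtain ⟨J, hJ, hJB, hVJ⟩ := hp.exists_finite_of_finite hV (S := B) (by simp [hBs])
  -- Only the finitely many traces on the support `J` of `V` matter. The finite case handles them,
  -- and the coheir argument with room `I` returns to all of `𝒵`.
  let 𝒴 : Set (Set M) := (fun Z => I ∪ (Z ∩ J)) '' 𝒵
  have h𝒴 : 𝒴.Finite := by
    refine (hJ.powerset.image (fun Y => I ∪ Y)).subset ?_
    rintro _ ⟨Z, -, rfl⟩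
    exact ⟨Z ∩ J, Set.inter_subset_right, rfl⟩
  obtain ⟨c, hc𝒴, hc, hVc, hiso⟩ := hfin 𝒴 h𝒴 (by
    rintro _ ⟨Z, hZ, rfl⟩
    exact ⟨Set.subset_union_left, Set.union_subset hIB (Set.inter_subset_left.trans (h𝒵B Z hZ)),
      hI.union (hJ.countable.mono Set.inter_subset_right)⟩) V hV
  have hsub : spanSet cl B 𝒴 ⊆ spanSet cl B 𝒵 := by
    refine Set.union_subset_union_right _ (Set.iUnion₂_subset ?_)
    rintro _ ⟨Z, hZ, rfl⟩
    exact (hp.cl_mono (Set.union_subset (h𝒵 Z hZ) Set.inter_subset_left)).trans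
      (Set.subset_biUnion_of_mem (u := cl) hZ)
  refine ⟨c ∪ J, Set.union_subset (hc𝒴.trans hsub) (hJB.trans (subset_spanSet _ _)), hc.union hJ,
    hVc.trans (hp.cl_mono Set.subset_union_left), fun S hSV hS => ?_⟩
  have h1 := hiso S hSV (hS.mono (Set.union_subset_union_left _ (diag_mono Set.subset_union_left)))
  refine hM.partialIso_of_coheir hB hJB hJ hIB hIinf h𝒵B (hSV.trans hVJ) ?_
    (hJB.trans (subset_spanSet _ _)) (hIB.trans (subset_spanSet _ _)) ?_ h1
  · rintro _ ⟨⟨x, y⟩, hxy, rfl⟩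
    have := hM.mem_cl_ran hS (S := diag J)
      ((diag_mono Set.subset_union_right).trans Set.subset_union_left) (Or.inr hxy)
      (by rw [dom_diag]; exact hVJ (hSV (mem_dom hxy)))
    rwa [ran_diag] at this
  · intro Z hZ
    rw [Set.union_comm]
    exact cl_subset_spanSet (B := B) (Set.mem_image_of_mem _ hZ)

end IsQuasiminimalPregeometryStructure

end Isolation

/-! ### Automorphisms of the whole structure. -/

section Automorphism

variable {L : FirstOrder.Language} {M : Type*} [L.Structure M] {cl : Set M → Set M}

/-- `N` is infinite-dimensional. -/
def InfDim (cl : Set M → Set M) (N : Set M) : Prop := ∀ F : Set M, F.Finite → ¬ N ⊆ cl F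

theorem InfDim.mono {N N' : Set M} (h : InfDim cl N) (hN : N ⊆ N') : InfDim cl N' :=
  fun F hF hN' => h F hF (hN.trans hN')

theorem infDim_of_indepOver (hp : IsPregeometry cl) {P J N : Set M} (hJ : IndepOver cl P J)
    (hJi : J.Infinite) (hJN : J ⊆ N) : InfDim cl N := by
  intro F hF hN
  obtain ⟨J₀, hJ₀, hcard⟩ := hJi.exists_subset_ncard_eq (F.ncard + 1)
  have hJ₀f : J₀.Finite := Set.finite_of_ncard_pos (by omega)
  obtain ⟨Q, -, hQ, -⟩ := (hJ.mono hp (Set.empty_subset _) hJ₀).exists_replace hp hJ₀f hF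
    (by rw [Set.empty_union]; exact (hJ₀.trans hJN).trans hN)
  omega

variable (hM : IsQuasiminimalPregeometryStructure L cl)
include hM

namespace IsQuasiminimalPregeometryStructure

theorem exists_infinite_indepOver [Uncountable M] {P : Set M} (hP : P.Countable) :
    ∃ J : Set M, J.Infinite ∧ J.Countable ∧ IndepOver cl P J := by
  have hp := hM.pregeometry
  obtain ⟨W, -, -, hW, hWs⟩ := hp.exists_indep_extend (P := P) (W₀ := ∅)
    (IsPregeometry.indepOver_empty P) (Set.subset_univ _)
  have hWi : W.Infinite := by
    intro hWf
    have := (hM.countable_cl (hP.union hWf.countable)).mono hWs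
    exact not_countable (α := M) (Set.countable_univ_iff.1 this)
  let e := hWi.natEmbedding
  refine ⟨Set.range fun n => (e n : M), ?_, Set.countable_range _, hW.mono hp subset_rfl ?_⟩
  · exact Set.infinite_range_of_injective (Subtype.val_injective.comp e.injective)
  · rintro _ ⟨n, rfl⟩; exact (e n).2

/-- Partial isomorphisms between countable closed sets of infinite dimension extend to
automorphisms. -/
theorem exists_automorphism [Uncountable M] {R : Set (M × M)} (hR : ClosedIso L cl R)
    (hinf : InfDim cl (dom R)) : ∃ f : M ≃[L] M, ∀ a b, (a, b) ∈ R → f a = b := by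
  have hp := hM.pregeometry
  obtain ⟨I, -, hIR, hIind, hIs⟩ := hp.exists_indep_extend (P := ∅) (W₀ := ∅)
    (IsPregeometry.indepOver_empty ∅) (Set.empty_subset (dom R))
  rw [Set.empty_union] at hIs
  have hIinf : I.Infinite := fun h => hinf I h hIs
  have hIc : I.Countable := hR.countable.mono hIR
  have hclI : cl I = dom R := (hR.dom_closed ▸ hp.cl_mono hIR).antisymm hIs
  let RI : Set (M × M) := {p ∈ R | p.1 ∈ I}
  have hRIR : RI ⊆ R := Set.sep_subset _ _
  have hdRI : dom RI = I := by
    refine Set.Subset.antisymm (by rintro _ ⟨p, hp, rfl⟩; exact hp.2) fun x hx => ?_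
    obtain ⟨y, hy⟩ := exists_of_mem_dom (hIR hx)
    exact ⟨_, ⟨hy, hx⟩, rfl⟩
  let I' := ran RI
  have hRIc : RI.Countable := (hR.iso.mono hRIR).countable_of_dom (hdRI ▸ hIc)
  have hI'c : I'.Countable := hRIc.image _
  have hI'R : I' ⊆ ran R := ran_mono hRIR
  have hclI' : cl I' = ran R := by
    refine (hR.ran_closed ▸ hp.cl_mono hI'R).antisymm fun y hy => ?_
    obtain ⟨x, hx⟩ := exists_of_mem_ran hy
    exact hM.mem_cl_ran hR.iso hRIR hx (by rw [hdRI]; exact hIs (mem_dom hx))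
  have hI'ind : IndepOver cl ∅ I' := by
    rintro _ ⟨⟨x, y⟩, hxy, rfl⟩ h
    rw [Set.empty_union] at h
    refine hIind x hxy.2 ?_
    rw [Set.empty_union]
    have hx := (hM.mem_cl_iff hR.iso (S := {p ∈ RI | p.1 ≠ x}) ((Set.sep_subset _ _).trans hRIR)
      hxy.1).2 (hp.cl_mono ?_ h)
    · refine hp.cl_mono ?_ hx
      rintro _ ⟨p, hp, rfl⟩
      exact ⟨hp.1.2, hp.2⟩
    · rintro _ ⟨⟨⟨u, v⟩, huv, rfl⟩, hne⟩
      refine ⟨(u, v), ⟨huv, fun e => hne ?_⟩, rfl⟩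
      simp only at e
      subst e
      exact hR.iso.right_unique huv.1 hxy.1
  have hI'inf : I'.Infinite := by
    intro h
    have := (hR.iso.mono hRIR).inv.finite_ran (by rwa [dom_inv])
    rw [ran_inv, hdRI] at this
    exact hIinf this
  obtain ⟨B, hIB, -, hB, hBs⟩ := hp.exists_indep_extend hIind (Set.subset_univ _)
  obtain ⟨B', hI'B', -, hB', hB's⟩ := hp.exists_indep_extend hI'ind (Set.subset_univ _)
  rw [Set.empty_union, Set.univ_subset_iff] at hBs hB's
  have hcard : #(B \ I : Set M) = #(B' \ I' : Set M) := by
    rw [hp.mk_of_spans hM.qm3 hIc (by rw [Set.union_sdiff_cancel hIB, hBs]),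
      hp.mk_of_spans hM.qm3 hI'c (by rw [Set.union_sdiff_cancel hI'B', hB's])]
  obtain ⟨β⟩ := Cardinal.eq.1 hcard
  let Γ : Set (M × M) := Set.range fun c : (B \ I : Set M) => ((c : M), (β c : M))
  have hdΓ : dom Γ = B \ I := by
    rw [dom, ← Set.range_comp]; exact Subtype.range_coe
  have hrΓ : ran Γ = B' \ I' := by
    have : ran Γ = Set.range (Subtype.val ∘ β) := by rw [ran, ← Set.range_comp]; rfl
    rw [this, β.surjective.range_comp, Subtype.range_coe]
  let R₀ := R ∪ Γ
  have hR₀ : PartialIso L R₀ := by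
    refine PartialIso.of_finite fun F hF hFf => ?_
    obtain ⟨T, hT, hTc, -, -⟩ := hM.exists_closure_indep (S := F ∩ Γ) hR (hFf.inter_of_left _)
      (by
        rintro _ ⟨-, c, rfl⟩ _ ⟨-, c', rfl⟩ e
        rw [Subtype.ext e])
      (by
        rintro _ ⟨-, c, rfl⟩ _ ⟨-, c', rfl⟩ e
        rw [β.injective (Subtype.ext e)])
      (by
        rw [← hclI]
        exact ((IndepOver.of_disjoint hp hB hIB Set.sdiff_subset
          Set.disjoint_sdiff_left).cl_left hp).mono hp subset_rfl
            ((dom_mono Set.inter_subset_right).trans hdΓ.subset))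
      (by
        rw [← hclI']
        exact ((IndepOver.of_disjoint hp hB' hI'B' Set.sdiff_subset
          Set.disjoint_sdiff_left).cl_left hp).mono hp subset_rfl
            ((ran_mono Set.inter_subset_right).trans hrΓ.subset))
    refine hTc.iso.mono fun p hp => hT ?_
    exact (hF hp).imp id fun h => ⟨hp, h⟩
  -- Zorn's lemma is restricted to maps whose domain and range are span sets over families of
  -- supersets of `I` and `I'`: these are isolating, so a maximal map could still be extended along
  -- any closure it misses.
  let 𝒞 : Set (Set (M × M)) := {R | PartialIso L R ∧ R₀ ⊆ R ∧
    (∃ 𝒵 : Set (Set M), (∀ Z ∈ 𝒵, I ⊆ Z) ∧ (∀ Z ∈ 𝒵, Z ⊆ B) ∧ dom R = spanSet cl B 𝒵) ∧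
    ∃ 𝒵 : Set (Set M), (∀ Z ∈ 𝒵, I' ⊆ Z) ∧ (∀ Z ∈ 𝒵, Z ⊆ B') ∧ ran R = spanSet cl B' 𝒵}
  have hR₀𝒞 : R₀ ∈ 𝒞 := by
    refine ⟨hR₀, subset_rfl, ⟨{I}, by simp, by simpa, ?_⟩, ⟨{I'}, by simp, by simpa, ?_⟩⟩
    · rw [dom_union, hdΓ]
      simp only [spanSet, Set.biUnion_singleton, hclI]
      ext x; simp only [Set.mem_union, Set.mem_sdiff]
      have := @hIR x
      tauto
    · rw [ran_union, hrΓ]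
      simp only [spanSet, Set.biUnion_singleton, hclI']
      ext x; simp only [Set.mem_union, Set.mem_sdiff]
      have := @hI'R x
      tauto
  have hspan : ∀ (B : Set M) {ι : Type _} (𝒴 : ι → Set (Set M)), Nonempty ι →
      ⋃ i, spanSet cl B (𝒴 i) = spanSet cl B (⋃ i, 𝒴 i) := by
    intro B ι 𝒴 hne
    simp only [spanSet, Set.biUnion_iUnion]
    rw [← Set.union_iUnion]
  obtain ⟨U, hR₀U, hU⟩ := zorn_subset_nonempty 𝒞 (by
    intro c hc hchain hne
    have : Nonempty c := hne.to_subtype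
    choose 𝒵 h1 h2 h3 using fun R : c => (hc R.2).2.2.1
    choose 𝒵' h1' h2' h3' using fun R : c => (hc R.2).2.2.2
    refine ⟨⋃₀ c, ⟨PartialIso.sUnion_chain hchain hne fun R hR => (hc hR).1,
      (hc hne.some_mem).2.1.trans (Set.subset_sUnion_of_mem hne.some_mem),
      ⟨⋃ i, 𝒵 i, ?_, ?_, ?_⟩, ⟨⋃ i, 𝒵' i, ?_, ?_, ?_⟩⟩,
      fun s hs => Set.subset_sUnion_of_mem hs⟩
    · intro Z hZ; obtain ⟨i, hi⟩ := Set.mem_iUnion.1 hZ; exact h1 i Z hi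
    · intro Z hZ; obtain ⟨i, hi⟩ := Set.mem_iUnion.1 hZ; exact h2 i Z hi
    · rw [← hspan _ _ inferInstance, dom, Set.sUnion_eq_iUnion, Set.image_iUnion]
      exact Set.iUnion_congr h3
    · intro Z hZ; obtain ⟨i, hi⟩ := Set.mem_iUnion.1 hZ; exact h1' i Z hi
    · intro Z hZ; obtain ⟨i, hi⟩ := Set.mem_iUnion.1 hZ; exact h2' i Z hi
    · rw [← hspan _ _ inferInstance, ran, Set.sUnion_eq_iUnion, Set.image_iUnion]
      exact Set.iUnion_congr h3') R₀ hR₀𝒞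
  obtain ⟨hUi, -, ⟨𝒵, h𝒵I, h𝒵B, hUd⟩, ⟨𝒵', h𝒵I', h𝒵B', hUr⟩⟩ := hU.1
  have hisod : Isolating L cl (dom U) :=
    hUd ▸ hM.isolating_spanSet hB hBs hIB hIc hIinf h𝒵I h𝒵B
  have hisor : Isolating L cl (ran U) :=
    hUr ▸ hM.isolating_spanSet hB' hB's hI'B' hI'c hI'inf h𝒵I' h𝒵B'
  have huniv : ∀ x y : M, x ∈ dom U ∧ y ∈ ran U := by
    intro x y
    obtain ⟨F, hF, hFB, hxF⟩ := hp.finitary B x (by simp [hBs])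
    obtain ⟨F', hF', hFB', hyF'⟩ := hp.finitary B' y (by simp [hB's])
    let Δ := RI ∪ Γ
    have hΔ : Δ ⊆ U := (Set.union_subset_union_left _ hRIR).trans hR₀U
    have hdΔ : dom Δ = B := by rw [dom_union, hdRI, hdΓ, Set.union_sdiff_cancel hIB]
    have hrΔ : ran Δ = B' := by
      rw [ran_union, hrΓ]; exact Set.union_sdiff_cancel hI'B'
    -- A countable part of the bijection of bases whose domain supports `x` and whose range supports
    -- `y`; it includes `RI` so that the new members contain `I` and `I'`.
    let Δ₁ := RI ∪ ({p ∈ Δ | p.1 ∈ F} ∪ {p ∈ Δ | p.2 ∈ F'})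
    have hΔ₁ : Δ₁ ⊆ Δ := Set.union_subset Set.subset_union_left
      (Set.union_subset (Set.sep_subset _ _) (Set.sep_subset _ _))
    have hΔ₁c : Δ₁.Countable := by
      refine hRIc.union (Set.Countable.union ?_ ?_)
      · refine (hUi.mono ((Set.sep_subset _ _).trans hΔ)).countable_of_dom (hF.countable.mono ?_)
        rintro _ ⟨p, hp, rfl⟩; exact hp.2
      · refine Set.Countable.mono ?_ (((hUi.mono (R := {p ∈ Δ | p.2 ∈ F'})
          ((Set.sep_subset _ _).trans hΔ)).inv.countable_of_dom (hF'.countable.mono ?_)).image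
          Prod.swap)
        · rintro ⟨a, b⟩ h; exact ⟨(b, a), h, rfl⟩
        · rw [dom_inv]; rintro _ ⟨p, hp, rfl⟩; exact hp.2
    obtain ⟨T, -, hT, hTd, hTr, hTsub⟩ := Isolating.exists_extend hM (R := U) (S := ∅) (R₀ := Δ₁)
      hisod hisor Set.finite_empty (by simpa) (hΔ₁.trans hΔ) hΔ₁c
    rw [Set.empty_union] at hTsub
    have hdT : dom T = cl (dom Δ₁) :=
      (by rintro _ ⟨p, hp, rfl⟩; exact (hTsub hp).1 : dom T ⊆ _).antisymm hTd
    have hrT : ran T = cl (ran Δ₁) :=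
      (by rintro _ ⟨p, hp, rfl⟩; exact (hTsub hp).2 : ran T ⊆ _).antisymm hTr
    have hmem : U ∪ T ∈ 𝒞 := by
      refine ⟨hT, hR₀U.trans Set.subset_union_left, ⟨insert (dom Δ₁) 𝒵, ?_, ?_, ?_⟩,
        ⟨insert (ran Δ₁) 𝒵', ?_, ?_, ?_⟩⟩
      · rintro Z (rfl | hZ)
        · rw [← hdRI]; exact dom_mono Set.subset_union_left
        · exact h𝒵I Z hZ
      · rintro Z (rfl | hZ)
        · rw [← hdΔ]; exact dom_mono hΔ₁
        · exact h𝒵B Z hZ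
      · rw [spanSet_insert, dom_union, hUd, hdT]
      · rintro Z (rfl | hZ)
        · exact ran_mono Set.subset_union_left
        · exact h𝒵I' Z hZ
      · rintro Z (rfl | hZ)
        · rw [← hrΔ]; exact ran_mono hΔ₁
        · exact h𝒵B' Z hZ
      · rw [spanSet_insert, ran_union, hUr, hrT]
    have hTU : T ⊆ U := Set.subset_union_right.trans (hU.2 hmem Set.subset_union_left)
    constructor
    · refine dom_mono hTU (hTd (hp.cl_mono ?_ hxF))
      intro a ha
      obtain ⟨b, hb⟩ := exists_of_mem_dom (hdΔ.symm ▸ hFB ha : a ∈ dom Δ)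
      exact mem_dom (b := b) (Or.inr (Or.inl ⟨hb, ha⟩))
    · refine ran_mono hTU (hTr (hp.cl_mono ?_ hyF'))
      intro b hb
      obtain ⟨a, ha⟩ := exists_of_mem_ran (hrΔ.symm ▸ hFB' hb : b ∈ ran Δ)
      exact mem_ran (a := a) (Or.inr (Or.inr ⟨ha, hb⟩))
  obtain ⟨f, hf⟩ := hUi.exists_equiv (Set.eq_univ_of_forall fun x => (huniv x x).1)
    (Set.eq_univ_of_forall fun x => (huniv x x).2)
  exact ⟨f, fun a b h => (hf a b).1 (hR₀U (Or.inl h))⟩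

omit hM in
theorem closedIso_diag {N : Set M} (hN : N.Countable) (hcl : cl N = N) :
    ClosedIso L cl (diag N) :=
  ⟨PartialIso.diag N, by rwa [dom_diag], by rwa [dom_diag], by rwa [ran_diag]⟩

/-- A finite partial isomorphism over a countable closed set of infinite dimension extends to an
automorphism. -/
theorem exists_automorphism_over [Uncountable M] {N : Set M} (hN : N.Countable) (hcl : cl N = N)
    (hinf : InfDim cl N) {S : Set (M × M)} (hS : S.Finite) (hNS : PartialIso L (diag N ∪ S)) :
    ∃ f : M ≃[L] M, Fixes f N ∧ ∀ a b, (a, b) ∈ S → f a = b := by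
  obtain ⟨T, hT, hTc, hTd, -⟩ := hM.exists_closure (Or.inl (closedIso_diag hN hcl)) hS hNS
  obtain ⟨f, hf⟩ := hM.exists_automorphism hTc (hinf.mono (by
    rw [hTd, dom_diag]
    exact Set.subset_union_left.trans (hM.pregeometry.subset_cl _)))
  exact ⟨f, fun a ha => hf a a (hT (Or.inl (mem_diag ha))), fun a b h => hf a b (hT (Or.inr h))⟩

/-- The generic type over a countable set is realized by a single orbit. -/
theorem exists_automorphism_of_notMem [Uncountable M] {P : Set M} (hP : P.Countable) {x y : M}
    (hx : x ∉ cl P) (hy : y ∉ cl P) : ∃ f : M ≃[L] M, Fixes f (cl P) ∧ f x = y := by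
  have hp := hM.pregeometry
  -- `cl P` may be finite-dimensional. Adding `J` makes the dimension infinite without capturing `x`
  -- or `y`.
  obtain ⟨J, hJi, hJc, hJ⟩ := hM.exists_infinite_indepOver (P := P ∪ {x, y})
    (hP.union (Set.toFinite {x, y}).countable)
  have hPQ : P ⊆ cl (P ∪ {x, y}) := Set.subset_union_left.trans (hp.subset_cl _)
  have hx' : x ∉ cl (P ∪ J) := fun h => hx (hJ.mem_cl hp hPQ (hp.mem_cl (by simp)) h)
  have hy' : y ∉ cl (P ∪ J) := fun h => hy (hJ.mem_cl hp hPQ (hp.mem_cl (by simp)) h)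
  have hNc := hM.countable_cl (hP.union hJc)
  obtain ⟨f, hf, hfxy⟩ := hM.exists_automorphism_over hNc (hp.idem _)
    (infDim_of_indepOver hp hJ hJi (Set.subset_union_right.trans (hp.subset_cl _)))
    (Set.finite_singleton (x, y)) (by
      rw [Set.union_singleton]
      exact hM.partialIso_insert_of_notMem (closedIso_diag hNc (hp.idem _))
        (by rwa [dom_diag]) (by rwa [ran_diag]))
  exact ⟨f, fun a ha => hf a (hp.cl_mono Set.subset_union_left ha), hfxy x y rfl⟩

omit hM in
theorem image_equiv (f : M ≃[L] M) (S : Set M) :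
    dom {p : M × M | f p.1 = p.2 ∧ p.1 ∈ S} = S ∧
      ran {p : M × M | f p.1 = p.2 ∧ p.1 ∈ S} = f '' S := by
  constructor
  · ext x; constructor
    · rintro ⟨p, hp, rfl⟩; exact hp.2
    · intro hx; exact ⟨(x, f x), ⟨rfl, hx⟩, rfl⟩
  · ext x; constructor
    · rintro ⟨p, hp, rfl⟩; exact ⟨p.1, hp.2, hp.1⟩
    · rintro ⟨y, hy, rfl⟩; exact ⟨(y, f y), ⟨rfl, hy⟩, rfl⟩

theorem map_mem_cl_iff (f : M ≃[L] M) (S : Set M) (a : M) : f a ∈ cl (f '' S) ↔ a ∈ cl S := by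
  have := hM.mem_cl_iff (PartialIso.of_equiv f) (S := {p : M × M | f p.1 = p.2 ∧ p.1 ∈ S})
    (fun p hp => hp.1) (a := a) (a' := f a) rfl
  rw [(image_equiv f S).1, (image_equiv f S).2] at this
  exact this.symm

theorem image_cl (f : M ≃[L] M) (S : Set M) : f '' cl S = cl (f '' S) := by
  ext y; constructor
  · rintro ⟨x, hx, rfl⟩; exact (hM.map_mem_cl_iff f S x).2 hx
  · intro hy
    obtain ⟨x, rfl⟩ := f.surjective y
    exact ⟨x, (hM.map_mem_cl_iff f S x).1 hy, rfl⟩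

end IsQuasiminimalPregeometryStructure

end Automorphism

/-! ### Imaginaries, bounded closure and dimension. -/

section Imaginaries

variable {L : FirstOrder.Language} {M : Type*} [L.Structure M] {cl : Set M → Set M}

/-- The imaginary elements with a representative in `N`. -/
def imag (L : FirstOrder.Language) {M : Type*} [L.Structure M] (N : Set M) : Set (Meq L M) :=
  {α | ∃ z : Fin α.1.arity → M, (∀ i, z i ∈ N) ∧ Quotient.mk α.1.rel z = α.2}

theorem imag_mono {N N' : Set M} (h : N ⊆ N') : imag L N ⊆ imag L N' :=
  fun _ ⟨z, hz, hα⟩ => ⟨z, fun i => h (hz i), hα⟩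

namespace Meq

theorem map_mk (f : M ≃[L] M) (E : ImagSort L M) (z : Fin E.arity → M) :
    map f ⟨E, Quotient.mk E.rel z⟩ = ⟨E, Quotient.mk E.rel (f ∘ z)⟩ := rfl

theorem map_map (f g : M ≃[L] M) (α : Meq L M) : (α.map f).map g = α.map (g.comp f) := by
  obtain ⟨E, q⟩ := α
  induction q using Quotient.ind
  rfl

theorem map_refl (α : Meq L M) : α.map (FirstOrder.Language.Equiv.refl L M) = α := by
  obtain ⟨E, q⟩ := α
  induction q using Quotient.ind
  rfl

theorem map_symm_map (f : M ≃[L] M) (α : Meq L M) : (α.map f).map f.symm = α := by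
  rw [map_map, FirstOrder.Language.Equiv.symm_comp_self, map_refl]

theorem map_map_symm (f : M ≃[L] M) (α : Meq L M) : (α.map f.symm).map f = α := by
  rw [map_map, FirstOrder.Language.Equiv.self_comp_symm, map_refl]

theorem mk_rep (α : Meq L M) : Quotient.mk α.1.rel α.rep = α.2 := Quotient.out_eq _

theorem map_eq_of_forall_rep {α : Meq L M} {z : Fin α.1.arity → M}
    (hz : Quotient.mk α.1.rel z = α.2) {f g : M ≃[L] M} (h : ∀ i, f (z i) = g (z i)) :
    α.map f = α.map g := by
  have hα : α = ⟨α.1, Quotient.mk α.1.rel z⟩ := by rw [hz]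
  rw [hα, map_mk, map_mk, show f ∘ z = g ∘ z from funext h]

theorem mk_map {α : Meq L M} {z : Fin α.1.arity → M} (hz : Quotient.mk α.1.rel z = α.2)
    (f : M ≃[L] M) : Quotient.mk (α.map f).1.rel (f ∘ z) = (α.map f).2 := by
  unfold map
  rw [← hz]
  rfl

theorem map_eq_self {α : Meq L M} {N : Set M} (hα : α ∈ imag L N) {f : M ≃[L] M}
    (hf : Fixes f N) : α.map f = α := by
  obtain ⟨z, hz, h⟩ := hα
  rw [map_eq_of_forall_rep h (g := FirstOrder.Language.Equiv.refl L M) fun i => hf _ (hz i),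
    map_refl]

theorem map_mem_imag {α : Meq L M} {N : Set M} (hα : α ∈ imag L N) (f : M ≃[L] M) :
    α.map f ∈ imag L (f '' N) := by
  obtain ⟨z, hz, h⟩ := hα
  exact ⟨f ∘ z, fun i => ⟨z i, hz i, rfl⟩, mk_map h f⟩

theorem map_mem_imag_iff {α : Meq L M} {N : Set M} (f : M ≃[L] M) :
    α.map f ∈ imag L (f '' N) ↔ α ∈ imag L N := by
  refine ⟨fun h => ?_, fun h => map_mem_imag h f⟩
  have := map_mem_imag h f.symm
  rw [map_symm_map, ← Set.image_comp] at this
  convert this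
  ext x; simp

theorem mem_imag_rep (α : Meq L M) : α ∈ imag L (Set.range α.rep) :=
  ⟨α.rep, fun i => ⟨i, rfl⟩, α.mk_rep⟩

end Meq

theorem Fixes.symm {f : M ≃[L] M} {A : Set M} (hf : Fixes f A) : Fixes f.symm A := fun a ha => by
  conv_lhs => rw [← hf a ha]
  exact f.symm_apply_apply a

theorem Fixes.comp {f g : M ≃[L] M} {A : Set M} (hg : Fixes g A) (hf : Fixes f A) :
    Fixes (g.comp f) A := fun a ha => by
  rw [FirstOrder.Language.Equiv.comp_apply, hf a ha, hg a ha]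

theorem Fixes.mono {f : M ≃[L] M} {A B : Set M} (hf : Fixes f B) (h : A ⊆ B) : Fixes f A :=
  fun a ha => hf a (h ha)

theorem Fixes.image {f : M ≃[L] M} {A : Set M} (hf : Fixes f A) : f '' A = A := by
  ext x; constructor
  · rintro ⟨a, ha, rfl⟩; rw [hf a ha]; exact ha
  · intro hx; exact ⟨x, hx, hf x hx⟩

theorem FixesEq.comp {f g : M ≃[L] M} {T : Set (Meq L M)} (hg : FixesEq g T) (hf : FixesEq f T) :
    FixesEq (g.comp f) T := fun α hα => by rw [← Meq.map_map, hf α hα, hg α hα]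

theorem FixesEq.symm {f : M ≃[L] M} {T : Set (Meq L M)} (hf : FixesEq f T) :
    FixesEq f.symm T := fun α hα => by
  conv_lhs => rw [← hf α hα]
  exact Meq.map_symm_map f α

/-- The orbit of `c` under the automorphisms that fix `A` and `T`. -/
def orbitOver (A : Set M) (T : Set (Meq L M)) (c : M) : Set M :=
  {b : M | ∃ f : M ≃[L] M, Fixes f A ∧ FixesEq f T ∧ f c = b}

theorem mem_bcl_of_countable [Uncountable M] {A : Set M} {T : Set (Meq L M)} {c : M}
    (h : (orbitOver A T c).Countable) : c ∈ bcl L A T :=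
  (Cardinal.le_aleph0_iff_set_countable.2 h).trans_lt (Cardinal.aleph0_lt_mk_iff.2 inferInstance)

theorem map_mem_bcl {A : Set M} {T : Set (Meq L M)} {c : M} (hc : c ∈ bcl L A T) {f : M ≃[L] M}
    (hf : Fixes f A) (hfT : FixesEq f T) : f c ∈ bcl L A T := by
  have : orbitOver A T (f c) = orbitOver A T c := by
    ext b; constructor
    · rintro ⟨g, hg, hgT, rfl⟩
      exact ⟨g.comp f, hg.comp hf, hgT.comp hfT, FirstOrder.Language.Equiv.comp_apply _ _ _⟩
    · rintro ⟨g, hg, hgT, rfl⟩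
      refine ⟨g.comp f.symm, hg.comp hf.symm, hgT.comp hfT.symm, ?_⟩
      rw [FirstOrder.Language.Equiv.comp_apply, f.symm_apply_apply]
  show #(orbitOver A T (f c)) < #M
  rw [this]; exact hc

theorem tupleDim_le_ncard {A : Set M} {T : Set (Meq L M)} {n : ℕ} {x : Fin n → M} {W : Set M}
    (hW : W ⊆ Set.range x) (h : ∀ i, x i ∈ bcl L (A ∪ W) T) : tupleDim A T x ≤ W.ncard := by
  classical
  rcases W.eq_empty_or_nonempty with rfl | ⟨w₀, hw₀⟩
  · exact Nat.sInf_le ⟨∅, by simp, by simpa using h⟩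
  have hWf : W.Finite := (Set.finite_range x).subset hW
  have : Nonempty (Fin n) := ⟨(hW hw₀).choose⟩
  have hW' : ∀ w ∈ W, ∃ i, x i = w := fun w hw => hW hw
  choose! s hs using hW'
  refine Nat.sInf_le ⟨hWf.toFinset.image s, ?_, ?_⟩
  · rw [Finset.card_image_of_injOn, Set.ncard_eq_toFinset_card _ hWf]
    intro a ha b hb hab
    have ha' := hs _ (hWf.mem_toFinset.1 ha)
    rw [hab, hs _ (hWf.mem_toFinset.1 hb)] at ha'
    exact ha'.symm
  · have : x '' ↑(hWf.toFinset.image s) = W := by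
      ext y; constructor
      · rintro ⟨i, hi, rfl⟩
        obtain ⟨w, hw, rfl⟩ := Finset.mem_image.1 (Finset.mem_coe.1 hi)
        have hw := hWf.mem_toFinset.1 hw
        rw [hs _ hw]; exact hw
      · intro hy
        exact ⟨s y, Finset.mem_coe.2 (Finset.mem_image_of_mem s (hWf.mem_toFinset.2 hy)), hs _ hy⟩
    rwa [this]

variable (hM : IsQuasiminimalPregeometryStructure L cl)
include hM

namespace IsQuasiminimalPregeometryStructure

theorem orbitOver_subset_cl {A : Set M} {T : Set (Meq L M)} {c : M} (hc : c ∈ cl A) :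
    orbitOver A T c ⊆ cl A := by
  rintro _ ⟨f, hf, -, rfl⟩
  have := (hM.map_mem_cl_iff f A c).2 hc
  rwa [hf.image] at this

theorem cl_subset_bcl [Uncountable M] {A : Set M} (hA : A.Countable) (T : Set (Meq L M)) :
    cl A ⊆ bcl L A T := fun _ hc =>
  mem_bcl_of_countable ((hM.countable_cl hA).mono (hM.orbitOver_subset_cl hc))

/-- The points outside the countable set `cl P` form a single orbit over it, of size `#M`. -/
theorem mem_cl_of_mem_bcl [Uncountable M] {A P : Set M} {T : Set (Meq L M)} (hP : P.Countable)
    (hAP : A ⊆ cl P) (hT : ∀ f : M ≃[L] M, Fixes f (cl P) → FixesEq f T) {c : M}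
    (hc : c ∈ bcl L A T) : c ∈ cl P := by
  by_contra hcP
  have hsub : (cl P)ᶜ ⊆ orbitOver A T c := by
    intro y hy
    obtain ⟨f, hf, hfc⟩ := hM.exists_automorphism_of_notMem hP hcP hy
    exact ⟨f, hf.mono hAP, hT f hf, hfc⟩
  have h1 : #((cl P)ᶜ : Set M) = #M := Cardinal.mk_compl_of_infinite _
    ((Cardinal.le_aleph0_iff_set_countable.2 (hM.countable_cl hP)).trans_lt
      (Cardinal.aleph0_lt_mk_iff.2 inferInstance))
  have h2 := Cardinal.mk_le_mk_of_subset hsub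
  rw [h1] at h2
  exact not_lt_of_ge h2 hc

theorem bcl_empty [Uncountable M] {A : Set M} (hA : A.Countable) :
    bcl L A (∅ : Set (Meq L M)) = cl A :=
  Set.Subset.antisymm (fun _ hc => hM.mem_cl_of_mem_bcl hA (hM.pregeometry.subset_cl _)
    (fun _ _ _ h => h.elim) hc) (hM.cl_subset_bcl hA _)

/-- Conjugates of a bounded element are bounded, so they all lie in the countable closure of `A` and
a representative of `α`. -/
theorem orbitOver_countable [Uncountable M] {A : Set M} (hA : A.Countable) {α : Meq L M} {c : M}
    (hc : c ∈ bcl L A {α}) : (orbitOver A {α} c).Countable := by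
  have hp := hM.pregeometry
  have hP : (A ∪ Set.range α.rep).Countable := hA.union (Set.countable_range _)
  refine (hM.countable_cl hP).mono ?_
  rintro _ ⟨f, hf, hfα, rfl⟩
  refine hM.mem_cl_of_mem_bcl hP (Set.subset_union_left.trans (hp.subset_cl _)) ?_
    (map_mem_bcl hc hf hfα)
  rintro g hg _ rfl
  exact Meq.map_eq_self (imag_mono (Set.subset_union_right.trans (hp.subset_cl _)) (Meq.mem_imag_rep _)) hg

/-- The orbit of `c` is covered by countably many translates, one for each conjugate of `b`, of its
countable orbit over `b`. -/
theorem bcl_trans [Uncountable M] {A : Set M} (hA : A.Countable) {α : Meq L M} {b c : M}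
    (hb : b ∈ bcl L A {α}) (hc : c ∈ bcl L (insert b A) {α}) : c ∈ bcl L A {α} := by
  have h1 := hM.orbitOver_countable hA hb
  have h2 := hM.orbitOver_countable (hA.insert b) hc
  have h3 : ∀ y ∈ orbitOver A ({α} : Set (Meq L M)) b, ∃ f : M ≃[L] M, Fixes f A ∧
    FixesEq f {α} ∧ f b = y := fun y hy => hy
  have : Nonempty (M ≃[L] M) := ⟨FirstOrder.Language.Equiv.refl L M⟩
  choose! g hgA hgα hgb using h3
  have h4 : (⋃ y ∈ orbitOver A {α} b, g y '' orbitOver (insert b A) {α} c).Countable :=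
    h1.biUnion fun y _ => h2.image (g y)
  refine mem_bcl_of_countable (h4.mono ?_)
  rintro _ ⟨f, hf, hfα, rfl⟩
  have hy : f b ∈ orbitOver A {α} b := ⟨f, hf, hfα, rfl⟩
  refine Set.mem_biUnion (x := f b) hy ⟨((g (f b)).symm.comp f) c, ⟨(g (f b)).symm.comp f, ?_,
    (hgα _ hy).symm.comp hfα, rfl⟩, ?_⟩
  · rintro a (ha | ha)
    · have h5 := (g (f b)).symm_apply_apply b
      rw [hgb _ hy] at h5
      rw [ha, FirstOrder.Language.Equiv.comp_apply, h5]
    · exact ((hgA _ hy).symm.comp hf) a ha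
  · rw [FirstOrder.Language.Equiv.comp_apply, FirstOrder.Language.Equiv.apply_symm_apply]

theorem exists_tupleDim_basis (A : Set M) (T : Set (Meq L M)) [Uncountable M] (hA : A.Finite)
    {n : ℕ} (x : Fin n → M) :
    ∃ W ⊆ Set.range x, W.ncard = tupleDim A T x ∧ ∀ i, x i ∈ bcl L (A ∪ W) T := by
  have hne : {k | ∃ I : Finset (Fin n), I.card = k ∧ ∀ i, x i ∈ bcl L (A ∪ x '' I) T}.Nonempty := by
    refine ⟨_, Finset.univ, rfl, fun i => hM.cl_subset_bcl ?_ T (hM.pregeometry.mem_cl ?_)⟩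
    · exact (hA.union ((Finset.finite_toSet _).image x)).countable
    · exact Or.inr ⟨i, by simp, rfl⟩
  obtain ⟨I, hI, hIx⟩ := Nat.sInf_mem hne
  refine ⟨x '' I, Set.image_subset_range _ _, le_antisymm ?_ ?_, hIx⟩
  · refine (Set.ncard_image_le I.finite_toSet).trans ?_
    rw [Set.ncard_coe_finset, hI]; exact le_rfl
  · exact tupleDim_le_ncard (Set.image_subset_range _ _) hIx

/-- A finite set that is independent over `A` and `α` can be moved into an infinite-dimensional
set by an automorphism over `A` and `α`. -/
theorem exists_move_into [Uncountable M] {A N : Set M} (hA : A.Finite) (hN : InfDim cl N)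
    {α : Meq L M} {P : Set M} (hP : P.Finite) (hind : ∀ p ∈ P, p ∉ bcl L (A ∪ P \ {p}) {α}) :
    ∃ f : M ≃[L] M, Fixes f A ∧ α.map f = α ∧ f '' P ⊆ N := by
  have hp := hM.pregeometry
  induction h : (P \ N).ncard generalizing P with
  | zero =>
    rw [Set.ncard_eq_zero hP.sdiff, Set.sdiff_eq_empty] at h
    exact ⟨FirstOrder.Language.Equiv.refl L M, fun _ _ => rfl, Meq.map_refl α, by
      rintro _ ⟨p, hp, rfl⟩; exact h hp⟩
  | succ n ih =>
    obtain ⟨p, hpP, hpN⟩ : (P \ N).Nonempty := Set.nonempty_of_ncard_ne_zero (by omega)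
    let Q := A ∪ P \ {p}
    have hQf : (Q ∪ Set.range α.rep).Finite := (hA.union hP.sdiff).union (Set.finite_range _)
    obtain ⟨d, hdN, hd⟩ := Set.not_subset.1 (hN _ hQf)
    -- An unbounded orbit is uncountable, so `p` can first leave the closure of `Q` and a
    -- representative of `α`; from there it can be sent to `d ∈ N` with that representative fixed.
    obtain ⟨f, hfQ, hfα, hfp⟩ : ∃ f : M ≃[L] M, Fixes f Q ∧ FixesEq f {α} ∧
        f p ∉ cl (Q ∪ Set.range α.rep) := by
      by_contra! hcon
      refine hind p hpP (mem_bcl_of_countable ((hM.countable_cl hQf.countable).mono ?_))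
      rintro _ ⟨f, hf, hfα, rfl⟩
      exact hcon f hf hfα
    obtain ⟨g, hg, hgp⟩ := hM.exists_automorphism_of_notMem hQf.countable hfp hd
    have hgα : α.map g = α := Meq.map_eq_self (imag_mono
      (Set.subset_union_right.trans (hp.subset_cl _)) α.mem_imag_rep) hg
    have hgQ : Fixes g Q := hg.mono (Set.subset_union_left.trans (hp.subset_cl _))
    obtain ⟨k, hk⟩ : ∃ k, k = g.comp f := ⟨_, rfl⟩
    have hkQ : Fixes k Q := hk ▸ hgQ.comp hfQ
    have hkA : Fixes k A := hkQ.mono Set.subset_union_left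
    have hkα : α.map k = α := by rw [hk, ← Meq.map_map, hfα α rfl, hgα]
    have hkp : k p = d := by rw [hk, FirstOrder.Language.Equiv.comp_apply, hgp]
    have hkP : k '' P = insert d (P \ {p}) := by
      conv_lhs => rw [← Set.insert_sdiff_self_of_mem hpP]
      rw [Set.image_insert_eq, hkp, (hkQ.mono Set.subset_union_right).image]
    obtain ⟨f', hf'A, hf'α, hf'P⟩ := ih (P := k '' P) (hP.image _) (by
      rintro _ ⟨q, hq, rfl⟩ hmem
      refine hind q hq ?_
      have := mem_bcl_of_countable (c := q) (A := A ∪ P \ {q}) (T := {α}) (((hM.orbitOver_countable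
        (hA.union (hP.image _).sdiff).countable hmem).image k.symm).mono ?_)
      · exact this
      · rintro _ ⟨u, hu, huα, rfl⟩
        refine ⟨k (u q), ⟨k.comp (u.comp k.symm), ?_, ?_, ?_⟩, k.symm_apply_apply _⟩
        · rintro a (ha | ⟨⟨b, hb, rfl⟩, hne⟩)
          · exact (hkA.comp ((hu.mono Set.subset_union_left).comp hkA.symm)) a ha
          · have hbq : b ≠ q := fun e => hne (by rw [e]; rfl)
            rw [FirstOrder.Language.Equiv.comp_apply, FirstOrder.Language.Equiv.comp_apply,
              k.symm_apply_apply, hu b (Or.inr ⟨hb, hbq⟩)]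
        · have hkT : FixesEq k {α} := by rintro _ rfl; exact hkα
          exact hkT.comp (huα.comp hkT.symm)
        · rw [FirstOrder.Language.Equiv.comp_apply, FirstOrder.Language.Equiv.comp_apply,
            k.symm_apply_apply]) (by
      have h1 : k '' P \ N = (P \ N) \ {p} := by
        rw [hkP]
        ext y
        simp only [Set.mem_sdiff, Set.mem_insert_iff, Set.mem_singleton_iff]
        constructor
        · rintro ⟨rfl | h, hy⟩
          · exact absurd hdN hy
          · exact ⟨⟨h.1, hy⟩, h.2⟩
        · rintro ⟨⟨h1, h2⟩, h3⟩
          exact ⟨Or.inr ⟨h1, h3⟩, h2⟩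
      have h2 := Set.ncard_sdiff_singleton_add_one (s := P \ N) ⟨hpP, hpN⟩ hP.sdiff
      rw [h1]; omega)
    refine ⟨f'.comp k, hf'A.comp hkA, by rw [← Meq.map_map, hkα, hf'α], ?_⟩
    rintro _ ⟨q, hq, rfl⟩
    exact hf'P ⟨k q, ⟨q, hq, rfl⟩, FirstOrder.Language.Equiv.comp_apply _ _ _⟩

/-- An imaginary element of dimension `n` over `A` has a representative in the closure of `N` and
`n` elements. -/
theorem exists_mem_imag [Uncountable M] {A N : Set M} (hA : A.Finite) (hN : InfDim cl N)
    (hAN : A ⊆ N) (α : Meq L M) :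
    ∃ Q : Set M, Q.Finite ∧ Q.ncard ≤ α.dim A ∧ α ∈ imag L (cl (N ∪ Q)) := by
  have hp := hM.pregeometry
  obtain ⟨W₁, hW₁, hc₁, hb₁⟩ := hM.exists_tupleDim_basis A {α} hA α.rep
  obtain ⟨W₀, hW₀, hc₀, hb₀⟩ := hM.exists_tupleDim_basis A (∅ : Set (Meq L M)) hA α.rep
  have hW₁f := (Set.finite_range _).subset hW₁
  have hW₀f := (Set.finite_range _).subset hW₀
  have hb₀' : Set.range α.rep ⊆ cl (A ∪ W₀) := by
    rintro _ ⟨i, rfl⟩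
    rw [← hM.bcl_empty (hA.union hW₀f).countable]
    exact hb₀ i
  have hind : ∀ p ∈ W₁, p ∉ bcl L (A ∪ W₁ \ {p}) {α} := by
    intro p hpW hmem
    have h1 := tupleDim_le_ncard (A := A) (T := {α}) (x := α.rep) (W := W₁ \ {p})
      (Set.sdiff_subset.trans hW₁) fun i => hM.bcl_trans (hA.union hW₁f.sdiff).countable hmem (by
        rw [← Set.union_insert, Set.insert_sdiff_self_of_mem hpW]; exact hb₁ i)
    have h2 := Set.ncard_sdiff_singleton_add_one hpW hW₁f
    omega
  have hindcl : IndepOver cl A W₁ := fun p hpW hmem =>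
    hind p hpW (hM.cl_subset_bcl (hA.union hW₁f.sdiff).countable _ hmem)
  -- `W₀` and `W₁` have the two sizes whose difference is `dim(α/A)`, so exchange leaves at most
  -- that many elements in `Q`. Moving `W₁` into `N` over `α` then changes the representative but
  -- not `α`.
  obtain ⟨Q, hQ, hQc, hWQ⟩ := hindcl.exists_replace hp hW₁f hW₀f (hW₁.trans hb₀')
  obtain ⟨f, hfA, hfα, hfW⟩ := hM.exists_move_into hA hN hW₁f hind
  have hQf := hW₀f.subset hQ
  refine ⟨f '' Q, hQf.image _, ?_, ?_⟩
  · refine (Set.ncard_image_le hQf).trans ?_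
    unfold Meq.dim
    omega
  · have h1 : Set.range α.rep ⊆ cl (A ∪ W₁ ∪ Q) := hb₀'.trans (hp.cl_le (Set.union_subset
      (Set.subset_union_left.trans (Set.subset_union_left.trans (hp.subset_cl _))) hWQ))
    have h2 := Meq.map_mem_imag (imag_mono h1 α.mem_imag_rep) f
    rw [hfα, hM.image_cl, Set.image_union, Set.image_union, hfA.image] at h2
    exact imag_mono (hp.cl_mono (Set.union_subset_union_left _ (Set.union_subset hAN hfW))) h2

/-- An imaginary element of positive dimension over `A` has no representative in some
infinite-dimensional countable closed set that contains `A`. -/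
theorem exists_notMem_imag [Uncountable M] {A : Set M} (hA : A.Finite) {α : Meq L M}
    (hα : α.dim A ≠ 0) : ∃ N : Set M, N.Countable ∧ cl N = N ∧ InfDim cl N ∧ A ⊆ N ∧
      α ∉ imag L N := by
  have hp := hM.pregeometry
  obtain ⟨J, hJi, hJc, hJ⟩ := hM.exists_infinite_indepOver (P := A ∪ Set.range α.rep)
    (hA.countable.union (Set.countable_range _))
  refine ⟨cl (A ∪ J), hM.countable_cl (hA.countable.union hJc), hp.idem _,
    infDim_of_indepOver hp hJ hJi (Set.subset_union_right.trans (hp.subset_cl _)),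
    Set.subset_union_left.trans (hp.subset_cl _), fun hmem => hα ?_⟩
  obtain ⟨W, hW, hWc, hb⟩ := hM.exists_tupleDim_basis A {α} hA α.rep
  have hWf := (Set.finite_range _).subset hW
  -- With a representative of `α` in `cl (A ∪ J)`, elements bounded over `A ∪ W` and `α` lie in `cl
  -- (A ∪ W ∪ J)`. Independence removes `J`, so `α` does not lower the dimension of its
  -- representative.
  have hle := tupleDim_le_ncard (A := A) (T := (∅ : Set (Meq L M))) (x := α.rep) hW fun i => by
    rw [hM.bcl_empty (hA.union hWf).countable]
    refine hJ.mem_cl hp (P := A ∪ W) ?_ (hp.mem_cl (Or.inr ⟨i, rfl⟩)) ?_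
    · exact (Set.union_subset_union_right _ hW).trans (hp.subset_cl _)
    · refine hM.mem_cl_of_mem_bcl ((hA.union hWf).countable.union hJc)
        (Set.subset_union_left.trans (hp.subset_cl _)) ?_ (hb i)
      rintro f hf _ rfl
      exact Meq.map_eq_self hmem (hf.mono (hp.cl_mono
        (Set.union_subset_union_left _ Set.subset_union_left)))
  unfold Meq.dim
  omega

end IsQuasiminimalPregeometryStructure

end Imaginaries

/-! ### Types of dimension one over models. -/

section Models

variable {L : FirstOrder.Language} {M : Type*} [L.Structure M] {cl : Set M → Set M}

/-- `N` is a countable infinite-dimensional closed set that contains `A`. -/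
structure IsSmallModel (cl : Set M → Set M) (A N : Set M) : Prop where
  countable : N.Countable
  closed : cl N = N
  infDim : InfDim cl N
  subset : A ⊆ N

namespace SameGaloisType

theorem symm {N : Set M} {α β : Meq L M} (h : SameGaloisType N α β) : SameGaloisType N β α := by
  obtain ⟨f, hf, rfl⟩ := h
  exact ⟨f.symm, hf.symm, Meq.map_symm_map f α⟩

theorem trans {N : Set M} {α β γ : Meq L M} (h : SameGaloisType N α β)
    (h' : SameGaloisType N β γ) : SameGaloisType N α γ := by
  obtain ⟨f, hf, rfl⟩ := h
  obtain ⟨g, hg, rfl⟩ := h'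
  exact ⟨g.comp f, hg.comp hf, (Meq.map_map f g α).symm⟩

theorem mono {N N' : Set M} {α β : Meq L M} (h : SameGaloisType N' α β) (hN : N ⊆ N') :
    SameGaloisType N α β := by
  obtain ⟨f, hf, hαβ⟩ := h
  exact ⟨f, hf.mono hN, hαβ⟩

theorem mem_imag_iff {N : Set M} {α β : Meq L M} (h : SameGaloisType N α β) :
    α ∈ imag L N ↔ β ∈ imag L N := by
  obtain ⟨f, hf, rfl⟩ := h
  have := Meq.map_mem_imag_iff (α := α) (N := N) f
  rw [hf.image] at this
  exact this.symm

end SameGaloisType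

omit [L.Structure M] in
theorem IsSmallModel.exists_notMem [Uncountable M] {A N : Set M} (hN : IsSmallModel cl A N) :
    ∃ x, x ∉ N := by
  by_contra! h
  exact Set.not_countable_univ (α := M) (hN.countable.mono fun x _ => h x)

variable (hM : IsQuasiminimalPregeometryStructure L cl)
include hM

namespace IsSmallModel

theorem insert {A N : Set M} (hN : IsSmallModel cl A N) (x : M) :
    IsSmallModel cl A (cl (insert x N)) where
  countable := hM.countable_cl (hN.countable.insert x)
  closed := hM.pregeometry.idem _
  infDim := hN.infDim.mono ((Set.subset_insert _ _).trans (hM.pregeometry.subset_cl _))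
  subset := hN.subset.trans ((Set.subset_insert _ _).trans (hM.pregeometry.subset_cl _))

theorem union {A N N' : Set M} (hN : IsSmallModel cl A N) (hN' : IsSmallModel cl A N') :
    IsSmallModel cl A (cl (N ∪ N')) where
  countable := hM.countable_cl (hN.countable.union hN'.countable)
  closed := hM.pregeometry.idem _
  infDim := hN.infDim.mono (Set.subset_union_left.trans (hM.pregeometry.subset_cl _))
  subset := hN.subset.trans (Set.subset_union_left.trans (hM.pregeometry.subset_cl _))

theorem image {A N : Set M} (hN : IsSmallModel cl A N) {f : M ≃[L] M} (hf : Fixes f A) :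
    IsSmallModel cl A (f '' N) where
  countable := hN.countable.image f
  closed := by rw [← hM.image_cl, hN.closed]
  infDim := fun F hF hsub => hN.infDim (f.symm '' F) (hF.image _) (by
    intro x hx
    have h := (hM.map_mem_cl_iff f.symm F (f x)).2 (hsub ⟨x, hx, rfl⟩)
    rwa [f.symm_apply_apply] at h)
  subset := by
    rw [← hf.image]
    exact Set.image_mono hN.subset

end IsSmallModel

namespace IsQuasiminimalPregeometryStructure

variable [Uncountable M] {A : Set M}

omit [Uncountable M] in
theorem subset_cl_insert (x : M) (N : Set M) : N ⊆ cl (insert x N) :=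
  (Set.subset_insert _ _).trans (hM.pregeometry.subset_cl _)

/-- An imaginary element in the closures of `N ∪ {y}` and of an extension of `N` that does not
contain `y` has a representative in `N`. -/
theorem mem_imag_of_mem_insert {N N' : Set M} (hN : IsSmallModel cl A N)
    (hN' : IsSmallModel cl A N') (hNN' : N ⊆ N') {y : M} (hy : y ∉ N') {α : Meq L M}
    (h1 : α ∈ imag L (cl (insert y N))) (h2 : α ∈ imag L N') : α ∈ imag L N := by
  have hp := hM.pregeometry
  obtain ⟨z, hz, hzα⟩ := h1
  obtain ⟨z', hz', hzα'⟩ := h2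
  obtain ⟨J, hJf, hJN, hJ⟩ : ∃ J : Set M, J.Finite ∧ J ⊆ N ∧ Set.range z ⊆ cl ({y} ∪ J) := by
    obtain ⟨F, hFf, hF, hzF⟩ := hp.exists_finite_of_finite (Set.finite_range z)
      (Set.range_subset_iff.2 hz)
    refine ⟨F ∩ N, hFf.inter_of_left _, Set.inter_subset_right, hzF.trans (hp.cl_mono ?_)⟩
    intro w hw
    rcases hF hw with h | h
    · exact Or.inl h
    · exact Or.inr ⟨hw, h⟩
  have hf := hJf.union (Set.finite_range z')
  obtain ⟨h, hhN, hh⟩ := Set.not_subset.1 (hN.infDim _ hf)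
  have hsub : cl (J ∪ Set.range z') ⊆ N' := (hp.cl_mono (Set.union_subset (hJN.trans hNN')
    (Set.range_subset_iff.2 hz'))).trans hN'.closed.subset
  -- `y` is sent into `N` while the representative `z'` stays fixed, and with it `α`; the image of
  -- `z` is then a representative in `N`.
  obtain ⟨f, hfix, hfy⟩ := hM.exists_automorphism_of_notMem hf.countable
    (fun h => hy (hsub h)) hh
  have hα : α.map f = α := Meq.map_eq_self ⟨z', fun i =>
    hp.mem_cl (Or.inr (Set.mem_range_self i)), hzα'⟩ hfix
  have hα' : α ∈ imag L (cl ({y} ∪ J)) := ⟨z, fun i => hJ (Set.mem_range_self i), hzα⟩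
  have := Meq.map_mem_imag hα' f
  rw [hα, hM.image_cl, Set.image_union, Set.image_singleton, hfy,
    (hfix.mono (Set.subset_union_left.trans (hp.subset_cl _))).image] at this
  refine imag_mono ?_ this
  rw [← hN.closed]
  exact hp.cl_mono (Set.union_subset (Set.singleton_subset_iff.2 hhN) hJN)

omit [Uncountable M] in
theorem notMem_of_mem_insert {N N' : Set M} (hN' : IsSmallModel cl A N') (hNN' : N ⊆ N') {y : M}
    {α : Meq L M} (h1 : α ∈ imag L (cl (insert y N))) (h2 : α ∉ imag L N') : y ∉ N' :=
  fun hy => h2 (imag_mono ((hM.pregeometry.cl_mono (Set.insert_subset hy hNN')).trans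
    hN'.closed.subset) h1)

/-- An imaginary element of the closure of `N ∪ {x}` that is not in `N` can be moved over `N` out
of any extension of `N`. -/
theorem exists_sameGaloisType_notMem {N N' : Set M} (hN : IsSmallModel cl A N)
    (hN' : IsSmallModel cl A N') (hNN' : N ⊆ N') {x : M} {α : Meq L M}
    (h1 : α ∈ imag L (cl (insert x N))) (h2 : α ∉ imag L N) :
    ∃ f : M ≃[L] M, Fixes f N ∧ α.map f ∉ imag L N' := by
  obtain ⟨x', hx'⟩ := hN'.exists_notMem
  have hx := hM.notMem_of_mem_insert hN subset_rfl h1 h2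
  obtain ⟨f, hf, hfx⟩ := hM.exists_automorphism_of_notMem hN.countable (x := x) (y := x')
    (by rwa [hN.closed]) (by rw [hN.closed]; exact fun h => hx' (hNN' h))
  rw [hN.closed] at hf
  refine ⟨f, hf, fun hmem => h2 ?_⟩
  have h3 := Meq.map_mem_imag h1 f
  rw [hM.image_cl, Set.image_insert_eq, hfx, hf.image] at h3
  have h4 := hM.mem_imag_of_mem_insert hN hN' hNN' hx' h3 hmem
  exact (SameGaloisType.mem_imag_iff ⟨f, hf, rfl⟩).2 h4

/-- Otherwise `α` would have a conjugate over `N` outside `cl (insert x N)`, hence different from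
`α`. -/
theorem mem_imag_of_fixed {N : Set M} (hN : IsSmallModel cl A N) {x : M} {α : Meq L M}
    (h1 : α ∈ imag L (cl (insert x N))) (h : ∀ f : M ≃[L] M, Fixes f N → α.map f = α) :
    α ∈ imag L N := by
  by_contra hα
  obtain ⟨f, hf, hfα⟩ := hM.exists_sameGaloisType_notMem hN (hN.insert hM x)
    (hM.subset_cl_insert x N) h1 hα
  exact hfα (by rwa [h f hf])

/-- A finite set that is independent over a finite set `C` can be moved into an
infinite-dimensional set by an automorphism over `C`. -/
theorem exists_move_indepOver {C N P : Set M} (hC : C.Finite) (hN : InfDim cl N) (hP : P.Finite)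
    (hind : IndepOver cl C P) : ∃ f : M ≃[L] M, Fixes f C ∧ f '' P ⊆ N := by
  -- A dummy imaginary of arity `0`, fixed by every automorphism.
  let E : ImagSort L M := ⟨0, ⊤, fun _ _ _ _ => trivial⟩
  let α : Meq L M := ⟨E, Quotient.mk E.rel Fin.elim0⟩
  have hα : α ∈ imag L (∅ : Set M) := ⟨Fin.elim0, fun i => i.elim0, rfl⟩
  obtain ⟨f, hf, -, hfP⟩ := hM.exists_move_into hC hN (α := α) hP fun p hp hmem => by
    refine hind p hp (hM.mem_cl_of_mem_bcl (hC.union hP.sdiff).countable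
      (hM.pregeometry.subset_cl _) ?_ hmem)
    rintro f - _ rfl
    exact Meq.map_eq_self hα fun _ h => h.elim
  exact ⟨f, hf, hfP⟩

/-- The Galois type of an imaginary element of dimension one over a model has a unique extension
to a larger model that is not realized there. -/
theorem sameGaloisType_of_notMem {N N' : Set M} (hN : IsSmallModel cl A N)
    (hN' : IsSmallModel cl A N') (hNN' : N ⊆ N') {x : M} {α β : Meq L M}
    (h1 : α ∈ imag L (cl (insert x N))) (h : SameGaloisType N α β) (hα : α ∉ imag L N')
    (hβ : β ∉ imag L N') : SameGaloisType N' α β := by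
  have hp := hM.pregeometry
  obtain ⟨f, hf, rfl⟩ := h
  have hx := hM.notMem_of_mem_insert hN' hNN' h1 hα
  have h2 := Meq.map_mem_imag h1 f
  rw [hM.image_cl, Set.image_insert_eq, hf.image] at h2
  have hfx := hM.notMem_of_mem_insert hN' hNN' h2 hβ
  obtain ⟨g, hg, hgx⟩ := hM.exists_automorphism_of_notMem hN'.countable (x := f x) (y := x)
    (by rwa [hN'.closed]) (by rwa [hN'.closed])
  rw [hN'.closed] at hg
  -- `g` brings `f x` back to `x` over `N'`, so it suffices to treat an automorphism that fixes both
  -- `N` and `x`.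
  suffices hs : SameGaloisType N' α (α.map (g.comp f)) by
    refine hs.trans (SameGaloisType.symm ⟨g, hg, Meq.map_map f g α⟩)
  obtain ⟨k, hk⟩ : ∃ k, k = g.comp f := ⟨_, rfl⟩
  have hkN : Fixes k N := hk ▸ (hg.mono hNN').comp hf
  have hkx : k x = x := by rw [hk, FirstOrder.Language.Equiv.comp_apply, hgx]
  rw [← hk]
  clear hk hgx hfx h2 hβ hg g hf f
  obtain ⟨z, hz, hzα⟩ := h1
  obtain ⟨J, hJf, hJN, hJ⟩ : ∃ J : Set M, J.Finite ∧ J ⊆ N ∧ Set.range z ⊆ cl ({x} ∪ J) := by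
    obtain ⟨F, hFf, hF, hzF⟩ := hp.exists_finite_of_finite (Set.finite_range z)
      (Set.range_subset_iff.2 hz)
    refine ⟨F ∩ N, hFf.inter_of_left _, Set.inter_subset_right, hzF.trans (hp.cl_mono ?_)⟩
    intro w hw
    rcases hF hw with h | h
    · exact Or.inl h
    · exact Or.inr ⟨hw, h⟩
  let S : Set (M × M) := Set.range fun i => (z i, k (z i))
  have hSf : S.Finite := Set.finite_range _
  have hkJ : ∀ i, k (z i) ∈ cl ({x} ∪ J) := fun i => by
    have h3 := (hM.map_mem_cl_iff k ({x} ∪ J) (z i)).2 (hJ (Set.mem_range_self i))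
    rwa [Set.image_union, Set.image_singleton, hkx, (hkN.mono hJN).image] at h3
  have hPE : PartialIso L (diag N' ∪ S) := by
    refine PartialIso.diag_union_of_finite fun d hd hdf => ?_
    -- `d` is spanned by `W` over `J`, as `x ∉ N'` contributes nothing. Moving `W` into `N` while
    -- fixing `J`, `z` and `k ∘ z` takes `d` into `N`, where `k` is the identity; so `k` conjugated
    -- by this move fixes `d` and still sends `z` to `k ∘ z`.
    obtain ⟨W, -, hWd, hWi, hdW⟩ := hp.exists_indep_extend (P := {x} ∪ J) (W₀ := ∅)
      (IsPregeometry.indepOver_empty _) (Set.empty_subset d)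
    have hdJ : d ⊆ cl (J ∪ W) := by
      intro q hq
      have hxi : IndepOver cl N' {x} := by
        rintro _ rfl
        rw [Set.sdiff_self, Set.union_empty, hN'.closed]
        exact hx
      refine hxi.mem_cl hp (P := J ∪ W) ?_ (hp.mem_cl (hd hq)) ?_
      · exact (Set.union_subset (hJN.trans hNN') (hWd.trans hd)).trans (hp.subset_cl _)
      · refine hp.cl_mono ?_ (hdW hq)
        rw [Set.union_assoc, Set.union_comm]
    let C : Set M := J ∪ (Set.range z ∪ Set.range fun i => k (z i))
    have hC : C ⊆ cl ({x} ∪ J) := Set.union_subset (Set.subset_union_right.trans (hp.subset_cl _))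
      (Set.union_subset hJ (Set.range_subset_iff.2 hkJ))
    obtain ⟨σ, hσ, hσW⟩ := hM.exists_move_indepOver (C := C)
      (hJf.union ((Set.finite_range _).union (Set.finite_range _))) hN.infDim
      (hdf.subset hWd) ((hWi.cl_left hp).mono hp hC subset_rfl)
    have hσd : ∀ q ∈ d, σ q ∈ N := by
      intro q hq
      have h3 := (hM.map_mem_cl_iff σ (J ∪ W) q).2 (hdJ hq)
      rw [Set.image_union, (hσ.mono Set.subset_union_left).image] at h3
      rw [← hN.closed]
      exact hp.cl_mono (Set.union_subset hJN hσW) h3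
    refine (PartialIso.of_equiv ((σ.symm.comp k).comp σ)).mono ?_
    rintro ⟨a, b⟩ (⟨ha, hab⟩ | ⟨i, hi⟩)
    · obtain rfl : a = b := hab
      show σ.symm (k (σ a)) = a
      rw [hkN _ (hσd a ha), σ.symm_apply_apply]
    · obtain ⟨rfl, rfl⟩ := Prod.mk.inj hi
      show σ.symm (k (σ (z i))) = k (z i)
      have h3 : σ (z i) = z i := hσ _ (Or.inr (Or.inl ⟨i, rfl⟩))
      have h4 : σ (k (z i)) = k (z i) := hσ _ (Or.inr (Or.inr ⟨i, rfl⟩))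
      rw [h3]
      conv_lhs => rw [← h4]
      exact σ.symm_apply_apply _
  obtain ⟨g, hg, hgS⟩ := hM.exists_automorphism_over hN'.countable hN'.closed hN'.infDim hSf hPE
  exact ⟨g, hg, Meq.map_eq_of_forall_rep hzα fun i => hgS _ _ ⟨i, rfl⟩⟩

end IsQuasiminimalPregeometryStructure

end Models

/-! ### Generic types of the group, and its pregeometry. -/

section Groups

variable {L : FirstOrder.Language} {M : Type*} [L.Structure M] {cl : Set M → Set M} {A : Set M}
  {G : Set (Meq L M)} [Group G]

theorem Meq.map_mem_imag_iff_symm {α : Meq L M} {N : Set M} (f : M ≃[L] M) :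
    α.map f ∈ imag L N ↔ α ∈ imag L (f.symm '' N) := by
  rw [← Meq.map_mem_imag_iff (N := N) f.symm, Meq.map_symm_map]

namespace IsGaloisDefinableGroup

variable (hG : IsGaloisDefinableGroup A G)
include hG

theorem map_mem {f : M ≃[L] M} (hf : Fixes f A) (g : G) : (g : Meq L M).map f ∈ G :=
  (hG.carrier f hf).subset (Set.mem_image_of_mem _ g.2)

/-- The group automorphism that an automorphism of `M` over `A` induces. -/
def act {f : M ≃[L] M} (hf : Fixes f A) : G ≃* G where
  toFun g := ⟨(g : Meq L M).map f, hG.map_mem hf g⟩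
  invFun g := ⟨(g : Meq L M).map f.symm, hG.map_mem hf.symm g⟩
  left_inv g := Subtype.ext (Meq.map_symm_map f g)
  right_inv g := Subtype.ext (Meq.map_map_symm f g)
  map_mul' g h := by
    have h1 : Prod.map (Meq.map f) (Prod.map (Meq.map f) (Meq.map f))
        ((g : Meq L M), (h : Meq L M), ((g * h : G) : Meq L M)) ∈ opGraph G := by
      rw [← hG.op f hf]
      exact Set.mem_image_of_mem _ ⟨g, h, rfl⟩
    obtain ⟨g', h', heq⟩ := h1
    simp only [Prod.map_apply, Prod.mk.injEq] at heq
    obtain ⟨hg, hh, hgh⟩ := heq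
    apply Subtype.ext
    simp only [hg, hh, hgh]

omit hG in
theorem coe_act (hG : IsGaloisDefinableGroup A G) {f : M ≃[L] M} (hf : Fixes f A) (g : G) :
    (hG.act hf g : Meq L M) = (g : Meq L M).map f := rfl

theorem act_eq_self {N : Set M} {f : M ≃[L] M} (hf : Fixes f A) (hfN : Fixes f N) {g : G}
    (hg : (g : Meq L M) ∈ imag L N) : hG.act hf g = g :=
  Subtype.ext (Meq.map_eq_self hg hfN)

theorem sameGaloisType_mul_left {N : Set M} (hAN : A ⊆ N) {t a b : G}
    (ht : (t : Meq L M) ∈ imag L N) (h : SameGaloisType N (a : Meq L M) (b : Meq L M)) :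
    SameGaloisType N ((t * a : G) : Meq L M) ((t * b : G) : Meq L M) := by
  obtain ⟨f, hf, hab⟩ := h
  have hfA := hf.mono hAN
  have h1 : hG.act hfA a = b := Subtype.ext hab
  refine ⟨f, hf, ?_⟩
  rw [← hG.coe_act hfA, map_mul, h1, hG.act_eq_self hfA hf ht]

theorem sameGaloisType_mul_right {N : Set M} (hAN : A ⊆ N) {t a b : G}
    (ht : (t : Meq L M) ∈ imag L N) (h : SameGaloisType N (a : Meq L M) (b : Meq L M)) :
    SameGaloisType N ((a * t : G) : Meq L M) ((b * t : G) : Meq L M) := by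
  obtain ⟨f, hf, hab⟩ := h
  have hfA := hf.mono hAN
  have h1 : hG.act hfA a = b := Subtype.ext hab
  refine ⟨f, hf, ?_⟩
  rw [← hG.coe_act hfA, map_mul, h1, hG.act_eq_self hfA hf ht]

theorem countable_imag {N : Set M} (hN : N.Countable) :
    {g : G | (g : Meq L M) ∈ imag L N}.Countable := by
  have := hN.to_subtype
  have h1 : (⋃ E ∈ Sigma.fst '' G, Set.range fun z : Fin E.arity → N =>
      (⟨E, Quotient.mk E.rel fun i => (z i : M)⟩ : Meq L M)).Countable :=
    hG.sorts.biUnion fun E _ => Set.countable_range _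
  refine (h1.preimage (f := ((↑) : G → Meq L M)) Subtype.val_injective).mono ?_
  rintro ⟨⟨E, q⟩, hg⟩ ⟨z, hz, hq⟩
  refine Set.mem_biUnion (x := E) ⟨_, hg, rfl⟩ ⟨fun i => ⟨z i, hz i⟩, ?_⟩
  exact congrArg (Sigma.mk E) hq

end IsGaloisDefinableGroup

/-- A Galois definable group of dimension one with unique generic type. -/
structure IsOneDimensionalGroup (cl : Set M → Set M) (A : Set M) (G : Set (Meq L M)) [Group G] :
    Prop where
  qm : IsQuasiminimalPregeometryStructure L cl
  definable : IsGaloisDefinableGroup A G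
  dim_le : ∀ N, IsSmallModel cl A N → ∀ g : G, ∃ x, (g : Meq L M) ∈ imag L (cl (insert x N))
  exists_notMem : ∃ N, IsSmallModel cl A N ∧ ∃ g : G, (g : Meq L M) ∉ imag L N
  sameType : ∀ N N', IsSmallModel cl A N → IsSmallModel cl A N' → ∀ g h : G,
    (g : Meq L M) ∉ imag L N → (h : Meq L M) ∉ imag L N' →
      SameGaloisType A (g : Meq L M) (h : Meq L M)

theorem isOneDimensionalGroup [Uncountable M] (hM : IsQuasiminimalPregeometryStructure L cl)
    (hG : IsGaloisDefinableGroup A G) (huniq : HasUniqueGenericType A G)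
    (hdim : ∀ α, IsGeneric A G α → α.dim A = 1) : IsOneDimensionalGroup cl A G := by
  obtain ⟨⟨γ, hγ⟩, huniq⟩ := huniq
  have hle : ∀ α ∈ G, α.dim A ≤ 1 := fun α hα => hdim γ hγ ▸ hγ.2 α hα
  -- An element of dimension zero has a representative in every model. Outside some model the
  -- dimension is therefore at least one, the maximum.
  have hgen : ∀ N, IsSmallModel cl A N → ∀ g : G, (g : Meq L M) ∉ imag L N →
      IsGeneric A G (g : Meq L M) := by
    intro N hN g hg
    refine ⟨g.2, fun β hβ => (hle β hβ).trans ?_⟩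
    by_contra hlt
    obtain ⟨Q, hQf, hQ, hgQ⟩ := hM.exists_mem_imag hG.finite hN.infDim hN.subset (g : Meq L M)
    have hQ0 : Q = ∅ := by
      rw [← Set.ncard_eq_zero hQf]; omega
    rw [hQ0, Set.union_empty, hN.closed] at hgQ
    exact hg hgQ
  refine ⟨hM, hG, fun N hN g => ?_, ?_, fun N N' hN hN' g h hg hh =>
    huniq _ _ (hgen N hN g hg) (hgen N' hN' h hh)⟩
  · obtain ⟨Q, hQf, hQ, hgQ⟩ := hM.exists_mem_imag hG.finite hN.infDim hN.subset (g : Meq L M)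
    have hQ1 := hQ.trans (hle g g.2)
    obtain ⟨x, hx⟩ : ∃ x, Q ⊆ {x} := by
      have : Nonempty M := inferInstance
      exact (Set.ncard_le_one_iff_subset_singleton hQf).1 hQ1
    refine ⟨x, imag_mono (hM.pregeometry.cl_mono ?_) hgQ⟩
    rw [Set.union_comm]
    exact Set.union_subset_union_left _ hx
  · obtain ⟨N, h1, h2, h3, h4, h5⟩ := hM.exists_notMem_imag hG.finite (α := γ)
      (by rw [hdim γ hγ]; exact one_ne_zero)
    exact ⟨N, ⟨h1, h2, h3, h4⟩, ⟨γ, hγ.1⟩, h5⟩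

/-- Left multiplication by `t` fixes the Galois type over `N` of an element of `G` that is generic
over `N` and `t`. -/
def StabilizesGeneric (cl : Set M → Set M) (A N : Set M) (t : G) : Prop :=
  ∃ (k : G) (P : Set M), IsSmallModel cl A P ∧ N ⊆ P ∧ (t : Meq L M) ∈ imag L P ∧
    (k : Meq L M) ∉ imag L P ∧ SameGaloisType N ((t * k : G) : Meq L M) (k : Meq L M)

/-- The closure operator on `G` that is induced by the models over `A`. -/
def groupCl (cl : Set M → Set M) (A : Set M) (G : Set (Meq L M)) (S : Set G) : Set G :=
  {g | ∃ F ⊆ S, F.Finite ∧ ∀ N, IsSmallModel cl A N → (∀ f ∈ F, (f : Meq L M) ∈ imag L N) →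
    (g : Meq L M) ∈ imag L N}

namespace IsOneDimensionalGroup

variable (hG : IsOneDimensionalGroup cl A G)
include hG

theorem exists_model_of_countable {N : Set M} (hN : IsSmallModel cl A N)
    {T : Set G} (hT : T.Countable) :
    ∃ N', IsSmallModel cl A N' ∧ N ⊆ N' ∧ ∀ t ∈ T, (t : Meq L M) ∈ imag L N' := by
  have hp := hG.qm.pregeometry
  have hNN : N ⊆ cl (N ∪ ⋃ t ∈ T, Set.range (t : Meq L M).rep) :=
    Set.subset_union_left.trans (hp.subset_cl _)
  refine ⟨_, ⟨hG.qm.countable_cl (hN.countable.union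
    (hT.biUnion fun t _ => Set.countable_range _)), hp.idem _, hN.infDim.mono hNN,
    hN.subset.trans hNN⟩, hNN, fun t ht => imag_mono ?_ (Meq.mem_imag_rep _)⟩
  refine Set.Subset.trans ?_ (hp.subset_cl _)
  exact Set.Subset.trans (Set.subset_biUnion_of_mem (u := fun t : G =>
    Set.range (t : Meq L M).rep) ht) Set.subset_union_right

variable [Uncountable M]

/-- By `mem_imag_of_fixed` these are the fixed points of `Aut(M/N)`, which acts by group
automorphisms. -/
theorem exists_subgroup {N : Set M} (hN : IsSmallModel cl A N) :
    ∃ H : Subgroup G, ∀ g : G, g ∈ H ↔ (g : Meq L M) ∈ imag L N := by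
  have key : ∀ g : G, (∀ (f : M ≃[L] M) (hf : Fixes f N),
      hG.definable.act (hf.mono hN.subset) g = g) → (g : Meq L M) ∈ imag L N := by
    intro g h
    obtain ⟨x, hx⟩ := hG.dim_le N hN g
    exact hG.qm.mem_imag_of_fixed hN hx fun f hf => congrArg Subtype.val (h f hf)
  refine ⟨⟨⟨⟨{g | (g : Meq L M) ∈ imag L N}, fun {a b} ha hb => key _ fun f hf => ?_⟩,
    key _ fun f hf => map_one _⟩, fun {a} ha => key _ fun f hf => ?_⟩, fun g => Iff.rfl⟩
  · rw [map_mul, hG.definable.act_eq_self _ hf ha, hG.definable.act_eq_self _ hf hb]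
  · rw [map_inv, hG.definable.act_eq_self _ hf ha]

theorem mul_mem_imag {N : Set M} (hN : IsSmallModel cl A N) {a b : G}
    (ha : (a : Meq L M) ∈ imag L N) (hb : (b : Meq L M) ∈ imag L N) :
    ((a * b : G) : Meq L M) ∈ imag L N := by
  obtain ⟨H, hH⟩ := hG.exists_subgroup hN
  rw [← hH] at *
  exact H.mul_mem ha hb

theorem inv_mem_imag {N : Set M} (hN : IsSmallModel cl A N) {a : G}
    (ha : (a : Meq L M) ∈ imag L N) : ((a⁻¹ : G) : Meq L M) ∈ imag L N := by
  obtain ⟨H, hH⟩ := hG.exists_subgroup hN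
  rw [← hH] at *
  exact H.inv_mem ha

theorem mul_mem_imag_iff_left {N : Set M} (hN : IsSmallModel cl A N) {a b : G}
    (hb : (b : Meq L M) ∈ imag L N) :
    ((a * b : G) : Meq L M) ∈ imag L N ↔ (a : Meq L M) ∈ imag L N := by
  obtain ⟨H, hH⟩ := hG.exists_subgroup hN
  rw [← hH] at *
  rw [← hH]
  exact H.mul_mem_cancel_right hb

theorem mul_mem_imag_iff_right {N : Set M} (hN : IsSmallModel cl A N) {a b : G}
    (ha : (a : Meq L M) ∈ imag L N) :
    ((a * b : G) : Meq L M) ∈ imag L N ↔ (b : Meq L M) ∈ imag L N := by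
  obtain ⟨H, hH⟩ := hG.exists_subgroup hN
  rw [← hH] at *
  rw [← hH]
  exact H.mul_mem_cancel_left ha

/-- Every element of `G` lies in an extension of `N` that is minimal over `N`. -/
theorem exists_minimal_extension {N : Set M} (hN : IsSmallModel cl A N) (g : G) :
    ∃ N', IsSmallModel cl A N' ∧ N ⊆ N' ∧ (g : Meq L M) ∈ imag L N' ∧
      ∀ Q, IsSmallModel cl A Q → N ⊆ Q → (g : Meq L M) ∉ imag L Q →
        ∀ α : Meq L M, α ∈ imag L N' → α ∈ imag L Q → α ∈ imag L N := by
  obtain ⟨y, hy⟩ := hG.dim_le N hN g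
  -- The last clause is the form in which independence over `N` is used below; it holds because `g ∉
  -- Q` forces `y ∉ Q`.
  refine ⟨cl (insert y N), hN.insert hG.qm y, hG.qm.subset_cl_insert y N, hy,
    fun Q hQ hNQ hgQ α h1 h2 => ?_⟩
  exact hG.qm.mem_imag_of_mem_insert hN hQ hNQ (hG.qm.notMem_of_mem_insert hQ hNQ hy hgQ) h1 h2

theorem exists_moved {N Q : Set M} (hN : IsSmallModel cl A N) (hQ : IsSmallModel cl A Q)
    (hNQ : N ⊆ Q) {g : G} (hg : (g : Meq L M) ∉ imag L N) :
    ∃ g' : G, SameGaloisType N (g : Meq L M) (g' : Meq L M) ∧ (g' : Meq L M) ∉ imag L Q := by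
  obtain ⟨x, hx⟩ := hG.dim_le N hN g
  obtain ⟨f, hf, hfg⟩ := hG.qm.exists_sameGaloisType_notMem hN hQ hNQ hx hg
  exact ⟨⟨_, hG.definable.map_mem (hf.mono hN.subset) g⟩, ⟨f, hf, rfl⟩, hfg⟩

theorem sameGaloisType_up {N Q : Set M} (hN : IsSmallModel cl A N) (hQ : IsSmallModel cl A Q)
    (hNQ : N ⊆ Q) {a b : G} (h : SameGaloisType N (a : Meq L M) (b : Meq L M))
    (ha : (a : Meq L M) ∉ imag L Q) (hb : (b : Meq L M) ∉ imag L Q) :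
    SameGaloisType Q (a : Meq L M) (b : Meq L M) := by
  obtain ⟨x, hx⟩ := hG.dim_le N hN a
  exact hG.qm.sameGaloisType_of_notMem hN hQ hNQ hx h ha hb

omit hG [Uncountable M] in
theorem stabilizesGeneric_down {N Q : Set M} (hNQ : N ⊆ Q) {t : G}
    (h : StabilizesGeneric cl A Q t) : StabilizesGeneric cl A N t := by
  obtain ⟨k, P, hP, hQP, htP, hkP, hk⟩ := h
  exact ⟨k, P, hP, hNQ.trans hQP, htP, hkP, hk.mono hNQ⟩

/-- The witness can be taken generic over a prescribed `Q`: it is moved over `P`, and left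
multiplication by `t ∈ P` respects types over `P`. -/
theorem exists_stabilized {N Q : Set M} (hQ : IsSmallModel cl A Q) {t : G}
    (h : StabilizesGeneric cl A N t) :
    ∃ (k : G) (P : Set M), IsSmallModel cl A P ∧ N ⊆ P ∧ Q ⊆ P ∧ (t : Meq L M) ∈ imag L P ∧
      (k : Meq L M) ∉ imag L P ∧ SameGaloisType N ((t * k : G) : Meq L M) (k : Meq L M) := by
  obtain ⟨k, P, hP, hNP, htP, hkP, hk⟩ := h
  have hPQ := hP.union hG.qm hQ
  have hPP : P ⊆ cl (P ∪ Q) := Set.subset_union_left.trans (hG.qm.pregeometry.subset_cl _)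
  obtain ⟨k', hkk', hk'⟩ := hG.exists_moved hP hPQ hPP hkP
  refine ⟨k', _, hPQ, hNP.trans hPP,
    Set.subset_union_right.trans (hG.qm.pregeometry.subset_cl _), imag_mono hPP htP, hk', ?_⟩
  exact ((hG.definable.sameGaloisType_mul_left hP.subset htP hkk'.symm).mono hNP).trans
    (hk.trans (hkk'.mono hNP))

/-- With the witness generic over `Q`, both `k` and `t * k` lie outside `Q`, so stationarity lifts
the equality of their types. -/
theorem stabilizesGeneric_up {N Q : Set M} (hN : IsSmallModel cl A N) (hQ : IsSmallModel cl A Q)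
    (hNQ : N ⊆ Q) {t : G} (h : StabilizesGeneric cl A N t) : StabilizesGeneric cl A Q t := by
  obtain ⟨k, P, hP, -, hQP, htP, hkP, hk⟩ := hG.exists_stabilized hQ h
  refine ⟨k, P, hP, hQP, htP, hkP, hG.sameGaloisType_up hN hQ hNQ hk (fun hmem => hkP ?_)
    fun hmem => hkP (imag_mono hQP hmem)⟩
  exact (hG.mul_mem_imag_iff_right hP htP).1 (imag_mono hQP hmem)

/-- For independent realizations `k`, `g` of one type over `N`, the quotient `t = g * k⁻¹` sends `k`
to `g`. It lies outside a model containing `k`, so `k` is in turn generic over a model containing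
`t`. -/
theorem exists_stabilizesGeneric : ∃ (N : Set M) (t : G), IsSmallModel cl A N ∧
    (t : Meq L M) ∉ imag L N ∧ StabilizesGeneric cl A N t := by
  obtain ⟨N, hN, k, hk⟩ := hG.exists_notMem
  obtain ⟨P, hP, hNP, hkP, -⟩ := hG.exists_minimal_extension hN k
  obtain ⟨g, hkg, hg⟩ := hG.exists_moved hN hP hNP hk
  have ht : ((g * k⁻¹ : G) : Meq L M) ∉ imag L P := fun h =>
    hg ((hG.mul_mem_imag_iff_left hP (hG.inv_mem_imag hP hkP)).1 h)
  refine ⟨N, g * k⁻¹, hN, fun h => ht (imag_mono hNP h), ?_⟩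
  obtain ⟨Q, hQ, hNQ, htQ, hmin⟩ := hG.exists_minimal_extension hN (g * k⁻¹)
  refine ⟨k, Q, hQ, hNQ, htQ, fun hkQ => hk (hmin P hP hNP ht _ hkQ hkP), ?_⟩
  rw [inv_mul_cancel_right]
  exact hkg.symm

omit [Uncountable M] in
theorem stabilizesGeneric_map {N : Set M} {t : G} (h : StabilizesGeneric cl A N t)
    {f : M ≃[L] M} (hf : Fixes f A) :
    StabilizesGeneric cl A (f '' N) (hG.definable.act hf t) := by
  obtain ⟨k, P, hP, hNP, htP, hkP, u, hu, huk⟩ := h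
  refine ⟨hG.definable.act hf k, f '' P, hP.image hG.qm hf, Set.image_mono hNP,
    Meq.map_mem_imag htP f, fun h => hkP ((Meq.map_mem_imag_iff f).1 h),
    (f.comp u).comp f.symm, ?_, ?_⟩
  · rintro _ ⟨x, hx, rfl⟩
    show f (u (f.symm (f x))) = f x
    rw [f.symm_apply_apply, hu x hx]
  · rw [← map_mul, hG.definable.coe_act, hG.definable.coe_act, ← Meq.map_map, ← Meq.map_map,
      Meq.map_symm_map, huk]

/-- Uniqueness of the generic type over `A` enters here: a single example is carried to `t` by an
automorphism over `A`. Going up to a common model and down again replaces the transported model by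
`N`. -/
theorem stabilizesGeneric {N Q : Set M} (hN : IsSmallModel cl A N) (hQ : IsSmallModel cl A Q)
    {t : G} (ht : (t : Meq L M) ∉ imag L Q) : StabilizesGeneric cl A N t := by
  obtain ⟨N₀, t₀, hN₀, ht₀, h₀⟩ := hG.exists_stabilizesGeneric
  obtain ⟨f, hf, hft⟩ := hG.sameType N₀ Q hN₀ hQ t₀ t ht₀ ht
  have h1 := hG.stabilizesGeneric_map h₀ hf
  rw [show hG.definable.act hf t₀ = t from Subtype.ext hft] at h1
  have h2 := hN₀.image hG.qm hf
  exact stabilizesGeneric_down (Set.subset_union_right.trans (hG.qm.pregeometry.subset_cl _))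
    (hG.stabilizesGeneric_up h2 (h2.union hG.qm hN)
      (Set.subset_union_left.trans (hG.qm.pregeometry.subset_cl _)) h1)

/-- Left multiplication by `t` fixes the Galois type over `N` of every element of `G` that is
generic over `N` and `t`. -/
theorem sameGaloisType_mul_generic {N P : Set M} (hN : IsSmallModel cl A N)
    (hP : IsSmallModel cl A P) (hNP : N ⊆ P) {t m : G} (ht : StabilizesGeneric cl A N t)
    (htP : (t : Meq L M) ∈ imag L P) (hm : (m : Meq L M) ∉ imag L P) :
    SameGaloisType N ((t * m : G) : Meq L M) (m : Meq L M) := by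
  obtain ⟨P', hP', hPP', hmP', -⟩ := hG.exists_minimal_extension hP m
  obtain ⟨k, Q, hQ, hNQ, hPQ, htQ, hkQ, hk⟩ := hG.exists_stabilized hP' ht
  have hmQ := imag_mono hPQ hmP'
  -- Write `m = k * l` with `l = k⁻¹ * m`. As `k` is generic over `t` and `m`, so is `l`; hence `k`
  -- and `t * k` lie outside the model `R` containing `l`, they stay conjugate over `R`, and right
  -- multiplication by `l` gives the claim for `m`.
  obtain ⟨R, hR, hNR, hlR, hmin⟩ := hG.exists_minimal_extension hN (k⁻¹ * m)
  have hlQ : ((k⁻¹ * m : G) : Meq L M) ∉ imag L Q := by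
    rw [hG.mul_mem_imag_iff_left hQ hmQ]
    intro h
    have := hG.inv_mem_imag hQ h
    rw [_root_.inv_inv] at this
    exact hkQ this
  have hmin' := hmin Q hQ hNQ hlQ
  have hkl : k * (k⁻¹ * m) = m := mul_inv_cancel_left k m
  have h1 : SameGaloisType R ((t * k : G) : Meq L M) (k : Meq L M) := by
    refine hG.sameGaloisType_up hN hR hNR hk (fun h => ?_) fun h => ?_
    · have h2 := (hG.mul_mem_imag_iff_left hR hlR).2 h
      rw [mul_assoc, hkl] at h2
      have h3 := hmin' _ h2 (hG.mul_mem_imag hQ htQ hmQ)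
      exact hm ((hG.mul_mem_imag_iff_right hP htP).1 (imag_mono hNP h3))
    · have h2 := (hG.mul_mem_imag_iff_left hR hlR).2 h
      rw [hkl] at h2
      exact hm (imag_mono hNP (hmin' _ h2 hmQ))
  have h2 := hG.definable.sameGaloisType_mul_right hR.subset hlR h1
  rw [mul_assoc, hkl] at h2
  exact h2.mono hNR

/-- Over every model there is a unique generic Galois type of `G`. -/
theorem sameGaloisType_of_notMem {N : Set M} (hN : IsSmallModel cl A N) {s t : G}
    (hs : (s : Meq L M) ∉ imag L N) (ht : (t : Meq L M) ∉ imag L N) :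
    SameGaloisType N (s : Meq L M) (t : Meq L M) := by
  obtain ⟨Q, hQ, hNQ, hstQ⟩ := hG.exists_model_of_countable hN (Set.toFinite {s, t}).countable
  have hsQ := hstQ s (by simp)
  have htQ := hstQ t (by simp)
  -- For `m` generic over `s` and `t`, both `s * m` and `t * m` have the type of `m` over `N`. By
  -- independence `s` and `t` stay outside the model `R` containing `m`, so the two products are
  -- conjugate over `R` and `m` can be cancelled.
  obtain ⟨m, -, hm⟩ := hG.exists_moved hN hQ hNQ ht
  obtain ⟨R, hR, hNR, hmR, hmin⟩ := hG.exists_minimal_extension hN m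
  have h1 : SameGaloisType N ((s * m : G) : Meq L M) ((t * m : G) : Meq L M) :=
    (hG.sameGaloisType_mul_generic hN hQ hNQ (hG.stabilizesGeneric hN hN hs) hsQ hm).trans
      (hG.sameGaloisType_mul_generic hN hQ hNQ (hG.stabilizesGeneric hN hN ht) htQ hm).symm
  have h2 := hG.sameGaloisType_up hN hR hNR h1
    (fun h => hs (hmin Q hQ hNQ hm _ ((hG.mul_mem_imag_iff_left hR hmR).1 h) hsQ))
    (fun h => ht (hmin Q hQ hNQ hm _ ((hG.mul_mem_imag_iff_left hR hmR).1 h) htQ))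
  have h3 := hG.definable.sameGaloisType_mul_right hR.subset (hG.inv_mem_imag hR hmR) h2
  rw [mul_inv_cancel_right, mul_inv_cancel_right] at h3
  exact h3.mono hNR

omit [Uncountable M] in
theorem map_mem_groupCl {f : M ≃[L] M} (hf : Fixes f A) {S : Set G} {g : G}
    (hg : g ∈ groupCl cl A G S) :
    hG.definable.act hf g ∈ groupCl cl A G (hG.definable.act hf '' S) := by
  obtain ⟨F, hFS, hF, h⟩ := hg
  refine ⟨hG.definable.act hf '' F, Set.image_mono hFS, hF.image _, fun N hN hFN => ?_⟩
  rw [hG.definable.coe_act, Meq.map_mem_imag_iff_symm]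
  refine h _ (hN.image hG.qm hf.symm) fun k hk => ?_
  rw [← Meq.map_mem_imag_iff_symm]
  exact hFN _ ⟨k, hk, rfl⟩

omit [Uncountable M] in
theorem act_image_groupCl {f : M ≃[L] M} (hf : Fixes f A) (S : Set G) :
    hG.definable.act hf '' groupCl cl A G S = groupCl cl A G (hG.definable.act hf '' S) := by
  apply Set.Subset.antisymm
  · rintro _ ⟨g, hg, rfl⟩
    exact hG.map_mem_groupCl hf hg
  · intro g hg
    have h1 := hG.map_mem_groupCl hf.symm hg
    have h2 : hG.definable.act hf.symm '' (hG.definable.act hf '' S) = S := by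
      exact (hG.definable.act hf).toEquiv.symm_image_image S
    rw [h2] at h1
    exact ⟨_, h1, Subtype.ext (Meq.map_map_symm f g)⟩

/-- Suppose `N₁` contains `a` and `F \ {b}` but not `b`, and `N` contains `F \ {b}` but not `a`.
Move `b` over `N₁` away from both models. Since `a` is fixed, it lies in the minimal extension `R`
of `N` by the new `b`; it also lies in the join of `N₁` and `N`, and these meet only in `N`. -/
theorem exchange_groupCl {S : Set G} {a b : G} (ha : a ∈ groupCl cl A G (insert b S))
    (haS : a ∉ groupCl cl A G S) : b ∈ groupCl cl A G (insert a S) := by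
  obtain ⟨F, hFS, hF, h⟩ := ha
  refine ⟨insert a (F \ {b}), Set.insert_subset_insert (Set.sdiff_singleton_subset_iff.2 hFS),
    hF.sdiff.insert a, fun N₁ hN₁ hFN₁ => ?_⟩
  by_contra hb
  obtain ⟨N, hN, hFN, haN⟩ : ∃ N, IsSmallModel cl A N ∧
      (∀ f ∈ F \ {b}, (f : Meq L M) ∈ imag L N) ∧ (a : Meq L M) ∉ imag L N := by
    by_contra! hcon
    exact haS ⟨F \ {b}, Set.sdiff_singleton_subset_iff.2 hFS, hF.sdiff, hcon⟩
  have hp := hG.qm.pregeometry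
  have hQ := hN₁.union hG.qm hN
  have hN₁Q : N₁ ⊆ cl (N₁ ∪ N) := Set.subset_union_left.trans (hp.subset_cl _)
  have hNQ : N ⊆ cl (N₁ ∪ N) := Set.subset_union_right.trans (hp.subset_cl _)
  obtain ⟨b', ⟨f, hf, hfb⟩, hb'⟩ := hG.exists_moved hN₁ hQ hN₁Q hb
  have hfA := hf.mono hN₁.subset
  obtain ⟨R, hR, hNR, hbR, hmin⟩ := hG.exists_minimal_extension hN b'
  have haN₁ := hFN₁ a (Set.mem_insert _ _)
  refine haN (hmin _ hQ hNQ hb' _ ?_ (imag_mono hN₁Q haN₁))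
  have h1 := h (f.symm '' R) (hR.image hG.qm hfA.symm) fun k hk => ?_
  · rw [← Meq.map_mem_imag_iff_symm, Meq.map_eq_self haN₁ hf] at h1
    exact h1
  · rw [← Meq.map_mem_imag_iff_symm]
    by_cases hkb : k = b
    · rw [hkb, hfb]; exact hbR
    · rw [Meq.map_eq_self (hFN₁ k (Or.inr ⟨hk, hkb⟩)) hf]
      exact imag_mono hNR (hFN k ⟨hk, hkb⟩)

theorem isPregeometry_groupCl : IsPregeometry (groupCl cl A G) where
  subset_cl S g hg := ⟨{g}, Set.singleton_subset_iff.2 hg, Set.finite_singleton g,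
    fun _ _ h => h g rfl⟩
  mono _ _ hST _ := fun ⟨F, hF, h⟩ => ⟨F, hF.trans hST, h⟩
  idem S := by
    apply Set.Subset.antisymm
    · rintro g ⟨F, hFS, hF, h⟩
      have hFS' : ∀ f ∈ F, f ∈ groupCl cl A G S := fun f hf => hFS hf
      choose! E hES hE hEN using hFS'
      exact ⟨⋃ f ∈ F, E f, Set.iUnion₂_subset hES, hF.biUnion hE, fun N hN hEN' =>
        h N hN fun f hf => hEN f hf N hN fun e he => hEN' e (Set.mem_biUnion hf he)⟩
    · intro g hg
      exact ⟨{g}, Set.singleton_subset_iff.2 hg, Set.finite_singleton g, fun _ _ h => h g rfl⟩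
  finitary _ _ := fun ⟨F, hFS, hF, h⟩ => ⟨F, hF, hFS, F, subset_rfl, hF, h⟩
  exchange _ _ _ := hG.exchange_groupCl

omit [Uncountable M] in
theorem countable_groupCl {S : Set G} (hS : S.Finite) : (groupCl cl A G S).Countable := by
  obtain ⟨N, hN, -⟩ := hG.exists_notMem
  obtain ⟨Q, hQ, -, hSQ⟩ := hG.exists_model_of_countable hN hS.countable
  refine (hG.definable.countable_imag hQ.countable).mono ?_
  rintro g ⟨F, hFS, -, h⟩
  exact h Q hQ fun f hf => hSQ f (hFS hf)

theorem uncountable : Uncountable G := by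
  rw [← not_countable_iff]
  intro hc
  obtain ⟨N, hN, g, hg⟩ := hG.exists_notMem
  obtain ⟨Q, hQ, hNQ, hQG⟩ := hG.exists_model_of_countable hN (Set.countable_univ (α := G))
  obtain ⟨g', -, hg'⟩ := hG.exists_moved hN hQ hNQ hg
  exact hg' (hQG g' trivial)

/-- The models witnessing `a, b ∉ groupCl cl A G S` may differ. Each point is moved over its own
model out of their join, where the unique generic type connects the two; all the automorphisms used
fix `S`. -/
theorem exists_mulEquiv {S : Set G} {a b : G} (hS : S.Finite) (ha : a ∉ groupCl cl A G S)
    (hb : b ∉ groupCl cl A G S) :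
    ∃ (f : M ≃[L] M) (hf : Fixes f A), (∀ s ∈ S, hG.definable.act hf s = s) ∧
      hG.definable.act hf a = b := by
  have key : ∀ c : G, c ∉ groupCl cl A G S → ∃ N, IsSmallModel cl A N ∧
      (∀ s ∈ S, (s : Meq L M) ∈ imag L N) ∧ (c : Meq L M) ∉ imag L N := by
    intro c hc
    by_contra! hcon
    exact hc ⟨S, subset_rfl, hS, hcon⟩
  obtain ⟨N, hN, hSN, haN⟩ := key a ha
  obtain ⟨N', hN', hSN', hbN'⟩ := key b hb
  have hp := hG.qm.pregeometry
  have hQ := hN.union hG.qm hN'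
  have hNQ : N ⊆ cl (N ∪ N') := Set.subset_union_left.trans (hp.subset_cl _)
  have hNQ' : N' ⊆ cl (N ∪ N') := Set.subset_union_right.trans (hp.subset_cl _)
  obtain ⟨a', ⟨u, hu, hua⟩, ha'⟩ := hG.exists_moved hN hQ hNQ haN
  obtain ⟨b', ⟨v, hv, hvb⟩, hb'⟩ := hG.exists_moved hN' hQ hNQ' hbN'
  obtain ⟨w, hw, hwa⟩ := hG.sameGaloisType_of_notMem hQ ha' hb'
  refine ⟨v.symm.comp (w.comp u), (hv.mono hN'.subset).symm.comp
    ((hw.mono hQ.subset).comp (hu.mono hN.subset)), fun s hs => Subtype.ext ?_, Subtype.ext ?_⟩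
  · rw [hG.definable.coe_act, ← Meq.map_map, ← Meq.map_map, Meq.map_eq_self (hSN s hs) hu,
      Meq.map_eq_self (imag_mono hNQ (hSN s hs)) hw, Meq.map_eq_self (hSN' s hs) hv.symm]
  · rw [hG.definable.coe_act, ← Meq.map_map, ← Meq.map_map, hua, hwa, ← hvb, Meq.map_symm_map]

theorem carriesOmegaHomogeneousPregeometry : CarriesOmegaHomogeneousPregeometry G := by
  have hp := hG.isPregeometry_groupCl
  have := hG.uncountable
  refine ⟨inferInstance, groupCl cl A G, hp, ?_, fun S a b hS ha hb => ?_⟩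
  -- `G` is uncountable and closures of finite sets are countable, so any basis has the size of `G`.
  · obtain ⟨B, -, -, hB, hBs⟩ := hp.exists_indep_extend (P := ∅) (W₀ := ∅)
      (IsPregeometry.indepOver_empty _) (Set.empty_subset Set.univ)
    refine ⟨B, ⟨fun b hb => ?_, ?_⟩, hp.mk_of_spans (fun S hS => hG.countable_groupCl hS)
      Set.countable_empty (Set.univ_subset_iff.1 hBs)⟩
    · have := hB b hb
      rwa [Set.empty_union] at this
    · rw [Set.empty_union] at hBs
      exact Set.univ_subset_iff.1 hBs
  · obtain ⟨f, hf, hfS, hfa⟩ := hG.exists_mulEquiv hS ha hb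
    exact ⟨hG.definable.act hf, hG.act_image_groupCl hf, hfS, hfa⟩

end IsOneDimensionalGroup

end Groups

end Quasiminimal

theorem mainTheorem7 {L : FirstOrder.Language} [Countable L.Symbols]
    {M : Type*} [L.Structure M] [Uncountable M] (cl : Set M → Set M)
    (hM : Quasiminimal.IsQuasiminimalPregeometryStructure L cl)
    (hnc : ¬ Quasiminimal.InterpretsNonclassicalGroup L M)
    (A : Set M) (G : Set (Quasiminimal.Meq L M)) [Group G]
    (hG : Quasiminimal.IsGaloisDefinableGroup A G)
    (huniq : Quasiminimal.HasUniqueGenericType A G)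
    (hdim : ∀ α, Quasiminimal.IsGeneric A G α → α.dim A = 1) :
    ∀ g h : G, g * h = h * g := by
  -- If not Abelian, `G` itself is the forbidden non-classical group.
  by_contra hcomm
  exact hnc ⟨A, G, inferInstance, hG, hcomm,
    (Quasiminimal.isOneDimensionalGroup hM hG huniq hdim).carriesOmegaHomogeneousPregeometry⟩
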